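/- Let $t>0$ be a real number, $\tau=\frac12+\mathsf{i}t$, $\Lambda=\mathbf{Z}\oplus\mathbf{Z}\tau\subset\mathbf{C}$, $E=\mathbf{C}/\Lambda$ and $A=E\times E=\mathbf{C}^2/\Lambda^2$. Let $\Sigma_A\subset A$ be the image of the real plane $\mathrm{Vect}_{\mathbf{R}}\big((\tau,0),(0,\tau)\big)$. Let $\eta(x,y)=(-x,-y)$ on $A$, let $X_0=A/\eta$, let $X\to X_0$ be the smooth Kummer (K3) surface obtained by resolving the sixteen singular points of $X_0$ (equivalently, the quotient by the lift of $\eta$ of the blow-up of $A$ at the sixteen fixed points of $\eta$), and let $\Sigma_X\subset X$ be the proper transform of the projection $\Sigma_0$ of $\Sigma_A$ to $X_0$, that is, the closure of the preimage of $\Sigma_0\setminus\mathrm{Sing}(X_0)$. A real structure on a complex surface is an anti-holomorphic involution of it; its real part is its fixed point set. **Theorem.** The following properties are equivalent: (a) there is a real structure on $A$ whose real part contains $\Sigma_A$; (b) there is a real structure on $X$ whose real part contains $\Sigma_X$; (c) $t\in\{\sqrt3/2,\ 1/2,\ \sqrt3/6\}$. In addition, when $t=1/2$ the curve $E$ is isomorphic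 to $\mathbf{C}/\mathbf{Z}[\mathsf{i}]$, and when $t=\sqrt3/2$ or $t=\sqrt3/6$ it is isomorphic to $\mathbf{C}/\mathbf{Z}[(1+\mathsf{i}\sqrt3)/2]$. **Corollary.** Suppose that $t\notin\{\sqrt3/2,1/2,\sqrt3/6\}$, and let $(Y,\Sigma)$ be $(A,\Sigma_A)$ or $(X,\Sigma_X)$. Then $\Sigma$ is a totally real, real analytic surface in $Y$: without boundary if $Y=A$, and with boundary the intersection of $\Sigma_X$ with the exceptional curves of $X\to X_0$ if $Y=X$. There is a group $\Gamma$ of holomorphic automorphisms of $Y$ such that (0) $\Gamma$ is non-elementary: its image in $\mathsf{GL}(H^2(Y;\mathbf{Z}))$ contains a non-abelian free group; (1) $\Gamma$ preserves $\Sigma$; (2) $\Gamma$ has a dense orbit in $Y$, it has an orbit in $\Sigma$ that is dense in $\Sigma$, and there is a $\Gamma$-invariant, ergodic probability measure with support equal to $\Sigma$ and with smooth positive density on $\Sigma$. Moreover, (3) there is no real structure on $Y$ whose real part contains $\Sigma$. -/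

import Mathlib

open scoped ContDiff LinearAlgebra.Projectivization

noncomputable section

namespace RealStructures

/-! ### Complex structures, holomorphic and anti-holomorphic maps -/

/-- A complex structure on a space `X`, recorded by its local holomorphic functions: `HolAt f x`
says that `f` is holomorphic on a neighbourhood of `x` (the values of `f` away from `x` play no
role).  The instances are given below: complex tori, the blown-up plane, the Kummer surface. -/
class HolomorphicGerms (X : Type*) [TopologicalSpace X] where
  HolAt : (X → ℂ) → X → Prop

section Maps

variable {X Y : Type*} [TopologicalSpace X] [HolomorphicGerms X]
  [TopologicalSpace Y] [HolomorphicGerms Y]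

/-- Holomorphic maps: continuous maps that pull back holomorphic functions to holomorphic
functions. -/
def IsHolMap (g : X → Y) : Prop :=
  Continuous g ∧ ∀ (x : X) (f : Y → ℂ),
    HolomorphicGerms.HolAt f (g x) → HolomorphicGerms.HolAt (fun y => f (g y)) x

/-- Anti-holomorphic maps: continuous maps that pull back holomorphic functions to complex
conjugates of holomorphic functions. -/
def IsAntiHolMap (s : X → Y) : Prop :=
  Continuous s ∧ ∀ (x : X) (f : Y → ℂ),
    HolomorphicGerms.HolAt f (s x) →
      HolomorphicGerms.HolAt (fun y => (starRingEnd ℂ) (f (s y))) x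

/-- A real structure: an anti-holomorphic involution. -/
def IsRealStructure (s : X → X) : Prop :=
  IsAntiHolMap s ∧ Function.Involutive s

/-- The real part of a real structure: its set of fixed points. -/
def realPart (s : X → X) : Set X := Function.fixedPoints s

/-- Local holomorphic coordinates on a complex surface: a homeomorphism `φ` from an open subset
onto an open subset of `ℂ × ℂ` through which the local holomorphic functions correspond. -/
def IsHolChart (φ : OpenPartialHomeomorph X (ℂ × ℂ)) : Prop :=
  ∀ x ∈ φ.source, ∀ f : X → ℂ,
    HolomorphicGerms.HolAt f x ↔ AnalyticAt ℂ (fun w => f (φ.symm w)) (φ x)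

end Maps

/-! ### Totally real analytic surfaces and smooth measures on them -/

/-- The inclusion of `ℝ²` in `ℂ²`. -/
def complexify (p : ℝ × ℝ) : ℂ × ℂ := ((p.1 : ℂ), (p.2 : ℂ))

/-- The closed half-plane `{p₁ ≥ 0}` of `ℝ²`. -/
def halfPlane : Set (ℝ × ℝ) := {p | 0 ≤ p.1}

section Surfaces

variable {X : Type*} [TopologicalSpace X] [HolomorphicGerms X]

/-- In the chart `φ` the set `S` is the part `H` of the real plane `ℝ² ⊆ ℂ²`. -/
def IsAdapted (φ : OpenPartialHomeomorph X (ℂ × ℂ)) (S : Set X) (H : Set (ℝ × ℝ)) : Prop :=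
  ∀ y ∈ φ.source, y ∈ S ↔ ∃ p ∈ H, φ y = complexify p

/-- `S` is a (smooth) totally real, real analytic surface with boundary `B`: near each point of
`S \ B`, respectively of `B`, there are local holomorphic coordinates in which `S` is the plane
`ℝ² ⊆ ℂ²`, respectively the half-plane `{p₁ ≥ 0}` of `ℝ²`, the point being on its edge.
(By complexifying a real analytic parametrization, each totally real analytic surface has this
local form.) -/
def IsTotallyRealSurface (S B : Set X) : Prop :=
  B ⊆ S ∧ ∀ x ∈ S, ∃ φ : OpenPartialHomeomorph X (ℂ × ℂ), IsHolChart φ ∧ x ∈ φ.source ∧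
    (x ∉ B → IsAdapted φ S Set.univ) ∧
    (x ∈ B → (φ x).1 = 0 ∧ IsAdapted φ S halfPlane)

/-- `μ` has a smooth positive density on the totally real surface `S`: near each point of `S`
there are holomorphic coordinates in which `S` is the real plane (or a half-plane of it) and `μ`
is Lebesgue measure times a smooth positive function. -/
def HasSmoothDensity [MeasurableSpace X] (μ : MeasureTheory.Measure X) (S : Set X) : Prop :=
  ∀ x ∈ S, ∃ φ : OpenPartialHomeomorph X (ℂ × ℂ), IsHolChart φ ∧ x ∈ φ.source ∧
    ∃ H : Set (ℝ × ℝ), (H = Set.univ ∨ H = halfPlane) ∧ IsAdapted φ S H ∧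
    ∃ ρ : ℝ × ℝ → ℝ, ContDiffOn ℝ ∞ ρ (complexify ⁻¹' φ.target) ∧
      (∀ p, complexify p ∈ φ.target → 0 < ρ p) ∧
      ∀ B : Set X, MeasurableSet B → B ⊆ φ.source →
        μ B = ∫⁻ p in {p | p ∈ H ∧ complexify p ∈ φ.target ∧ φ.symm (complexify p) ∈ B},
          ENNReal.ofReal (ρ p)

end Surfaces

/-! ### Second singular cohomology with integer coefficients -/

section Cohomology

/-- Singular `n`-simplices. -/
abbrev SingularSimplex (X : Type*) [TopologicalSpace X] (n : ℕ) : Type _ :=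
  C(stdSimplex ℝ (Fin (n + 1)), X)

/-- Integral singular `n`-cochains. -/
abbrev SingularCochain (X : Type*) [TopologicalSpace X] (n : ℕ) : Type _ :=
  SingularSimplex X n → ℤ

/-- The inclusion of the `i`-th face of the standard simplex. -/
def face (n : ℕ) (i : Fin (n + 2)) :
    C(stdSimplex ℝ (Fin (n + 1)), stdSimplex ℝ (Fin (n + 2))) :=
  ⟨stdSimplex.map i.succAbove, stdSimplex.continuous_map _⟩

/-- The singular coboundary `(δ c)(σ) = ∑ᵢ (-1)ⁱ c(σ ∘ faceᵢ)`. -/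
def coboundary (X : Type*) [TopologicalSpace X] (n : ℕ) :
    SingularCochain X n →+ SingularCochain X (n + 1) where
  toFun c := fun σ => ∑ i : Fin (n + 2), (-1 : ℤ) ^ (i : ℕ) * c (σ.comp (face n i))
  map_zero' := by ext σ; simp
  map_add' c d := by ext σ; simp [mul_add, Finset.sum_add_distrib]

/-- `H²(X; ℤ)`: singular 2-cocycles modulo coboundaries. -/
abbrev H2 (X : Type*) [TopologicalSpace X] : Type _ :=
  (coboundary X 2).ker ⧸ ((coboundary X 1).range.addSubgroupOf (coboundary X 2).ker)

/-- The pullback of singular cochains by a continuous map. -/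
def cochainPullback {X Y : Type*} [TopologicalSpace X] [TopologicalSpace Y] (g : C(X, Y))
    (n : ℕ) : SingularCochain Y n →+ SingularCochain X n where
  toFun c := fun σ => c (g.comp σ)
  map_zero' := rfl
  map_add' _ _ := rfl

theorem coboundary_cochainPullback {X Y : Type*} [TopologicalSpace X] [TopologicalSpace Y]
    (g : C(X, Y)) (n : ℕ) (c : SingularCochain Y n) :
    coboundary X n (cochainPullback g n c) = cochainPullback g (n + 1) (coboundary Y n c) := rfl

/-- The pullback of singular 2-cocycles. -/
def cocyclePullback {X Y : Type*} [TopologicalSpace X] [TopologicalSpace Y] (g : C(X, Y)) :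
    (coboundary Y 2).ker →+ (coboundary X 2).ker :=
  ((cochainPullback g 2).comp (coboundary Y 2).ker.subtype).codRestrict _ (fun c => by
    have hc : coboundary Y 2 c = 0 := c.2
    change coboundary X 2 (cochainPullback g 2 c) = 0
    rw [coboundary_cochainPullback, hc, map_zero])

/-- The map `g^* : H²(Y; ℤ) → H²(X; ℤ)` induced by a continuous map `g : X → Y`. -/
def H2pullback {X Y : Type*} [TopologicalSpace X] [TopologicalSpace Y] (g : C(X, Y)) :
    H2 Y →+ H2 X :=
  QuotientAddGroup.map _ _ (cocyclePullback g) (by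
    rintro ⟨c, hc⟩ ⟨b, hb⟩
    exact ⟨cochainPullback g 1 b, by
      rw [coboundary_cochainPullback, hb]; rfl⟩)

/-- The map `g^*` on `H²` of a homeomorphism, as an automorphism. -/
def H2equiv {X : Type*} [TopologicalSpace X] (g : X ≃ₜ X) : H2 X ≃+ H2 X where
  toFun := H2pullback (g : C(X, X))
  invFun := H2pullback (g.symm : C(X, X))
  left_inv := by
    rintro ⟨c⟩
    refine congrArg (Quot.mk _) (Subtype.ext (funext fun σ => congrArg c.1 ?_))
    ext; simp
  right_inv := by
    rintro ⟨c⟩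
    refine congrArg (Quot.mk _) (Subtype.ext (funext fun σ => congrArg c.1 ?_))
    ext; simp
  map_add' := map_add _

/-- The action of homeomorphisms on `H²(X; ℤ)`, `g` acting by `(g⁻¹)^*`, with values in the group
`GL(H²(X; ℤ))` of `ℤ`-linear automorphisms. -/
def H2action (X : Type*) [TopologicalSpace X] : (X ≃ₜ X) →* (H2 X ≃ₗ[ℤ] H2 X) where
  toFun g := (H2equiv g.symm).toIntLinearEquiv
  map_one' := by
    apply LinearEquiv.ext
    rintro ⟨c⟩
    rfl
  map_mul' g h := by
    apply LinearEquiv.ext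
    rintro ⟨c⟩
    rfl

/-- A group of homeomorphisms is non-elementary if its image in `GL(H²(X; ℤ))` contains a
non-abelian free group. -/
def NonElementary {X : Type*} [TopologicalSpace X] (G : Subgroup (X ≃ₜ X)) : Prop :=
  ∃ j : FreeGroup (Fin 2) →* (H2 X ≃ₗ[ℤ] H2 X),
    Function.Injective j ∧ j.range ≤ G.map (H2action X)

end Cohomology

/-! ### Group actions with an ergodic measure on a surface -/

/-- `G` is a non-elementary group of holomorphic automorphisms of `X` which preserves `S`, has a
dense orbit in `X` and an orbit dense in `S`, and there is a smooth probability
measure with support `S` that is invariant and ergodic under `G`. -/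
def ActsErgodicallyOn {X : Type*} [TopologicalSpace X] [HolomorphicGerms X]
    (G : Subgroup (X ≃ₜ X)) (S : Set X) : Prop :=
  letI : MeasurableSpace X := borel X
  (∀ g ∈ G, IsHolMap g) ∧ NonElementary G ∧ (∀ g ∈ G, g '' S = S) ∧
  (∃ x : X, Dense {y | ∃ g ∈ G, g x = y}) ∧
  (∃ x ∈ S, S ⊆ closure {y | ∃ g ∈ G, g x = y}) ∧
  ∃ μ : MeasureTheory.Measure X,
    MeasureTheory.IsProbabilityMeasure μ ∧ μ.support = S ∧ HasSmoothDensity μ S ∧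
    (∀ g ∈ G, μ.map g = μ) ∧
    ∀ B : Set X, MeasurableSet B → (∀ g ∈ G, g ⁻¹' B =ᵐ[μ] B) → μ B = 0 ∨ μ Bᶜ = 0

/-! ### Complex tori -/

/-- A quotient `V / L`: a function is holomorphic if its lift to `V` is. -/
instance torusGerms {V : Type*} [NormedAddCommGroup V] [NormedSpace ℂ V] (L : AddSubgroup V) :
    HolomorphicGerms (V ⧸ L) where
  HolAt f a := ∀ z : V, (z : V ⧸ L) = a → AnalyticAt ℂ (fun w : V => f (w : V ⧸ L)) z

/-- The subgroup `ℤ + ℤ τ` of `ℂ`. -/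
def lattice (τ : ℂ) : AddSubgroup ℂ := AddSubgroup.closure {1, τ}

/-- The curve `ℂ / (ℤ + ℤ τ)`. -/
abbrev Curve (τ : ℂ) : Type := ℂ ⧸ lattice τ

/-- The two curves `ℂ / (ℤ + ℤ τ)` and `ℂ / (ℤ + ℤ τ')` are isomorphic. -/
def CurvesIsomorphic (τ τ' : ℂ) : Prop :=
  ∃ e : Curve τ ≃+ Curve τ', IsHolMap e ∧ IsHolMap e.symm

/-- The lattice `Λ² ⊆ ℂ²`, where `Λ = ℤ + ℤ τ`. -/
def latticeSq (τ : ℂ) : AddSubgroup (ℂ × ℂ) := (lattice τ).prod (lattice τ)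

/-- The abelian surface `A = E × E = ℂ² / Λ²`. -/
abbrev AbelianSurface (τ : ℂ) : Type := (ℂ × ℂ) ⧸ latticeSq τ

/-- The real torus `Σ_A`, image in `A` of the real span of `(τ, 0)` and `(0, τ)`. -/
def SigmaA (τ : ℂ) : Set (AbelianSurface τ) :=
  (fun z : ℂ × ℂ => (z : AbelianSurface τ)) ''
    (Submodule.span ℝ {((τ, 0) : ℂ × ℂ), (0, τ)} : Set (ℂ × ℂ))

/-! ### The singular Kummer surface -/

/-- The equivalence relation of the involution `η = -1` of `A`. -/
def etaSetoid (τ : ℂ) : Setoid (AbelianSurface τ) where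
  r a b := b = a ∨ b = -a
  iseqv :=
    { refl := fun _ => Or.inl rfl
      symm := by
        rintro a b (h | h)
        · exact Or.inl h.symm
        · exact Or.inr (by rw [h, neg_neg])
      trans := by
        rintro a b c (h | h) (h' | h')
        · exact Or.inl (by rw [h', h])
        · exact Or.inr (by rw [h', h])
        · exact Or.inr (by rw [h', h])
        · exact Or.inl (by rw [h', h, neg_neg]) }

/-- The singular Kummer surface `X₀ = A / η`. -/
abbrev SingularKummer (τ : ℂ) : Type := Quotient (etaSetoid τ)

/-- The singular points of `X₀`, images of the fixed points of `η`. -/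
def singularPoints (τ : ℂ) : Set (SingularKummer τ) :=
  (fun a => (Quotient.mk (etaSetoid τ) a)) '' {a : AbelianSurface τ | -a = a}

/-- `Σ₀`, the projection of `Σ_A` in `X₀`. -/
def Sigma0 (τ : ℂ) : Set (SingularKummer τ) :=
  (fun a => (Quotient.mk (etaSetoid τ) a)) '' SigmaA τ

/-! ### The smooth Kummer surface

Let `Ĉ` be the blow-up of `ℂ²` at the points of `½ Λ²`, the preimage of the fixed points of `η`.
Then `Ĉ / Λ²` is the blow-up of `A` at the sixteen fixed points of `η`, and the Kummer surface is
`X = Ĉ / (Λ² ⋊ {±1})`, the quotient of that blow-up by the involution lifting `η`. -/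

/-- The set `½ Λ²` of the points of `ℂ²` that are 2-torsion in `A`. -/
def halfLattice (τ : ℂ) : Set (ℂ × ℂ) := {p | p + p ∈ latticeSq τ}

/-- The quotient topology on the projective line. -/
instance projectiveLineTopology : TopologicalSpace (ℙ ℂ (ℂ × ℂ)) :=
  inferInstanceAs (TopologicalSpace (Quotient (projectivizationSetoid ℂ (ℂ × ℂ))))

/-- The blow-up of `ℂ²` at the discrete set `½ Λ²`: the points `z` of `ℂ²` together with, for each
centre `p`, a line through `0` containing `z - p` (which is determined by `z` unless `z = p`). -/
abbrev BlownUpPlane (τ : ℂ) : Type :=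
  {y : (ℂ × ℂ) × (halfLattice τ → ℙ ℂ (ℂ × ℂ)) //
    ∀ p : halfLattice τ, y.1 - (p : ℂ × ℂ) ∈ (y.2 p).submodule}

/-- The two families of directions `(1, v)` and `(v, 1)`. -/
def direction (b : Bool) (v : ℂ) : ℂ × ℂ := if b then (1, v) else (v, 1)

theorem direction_ne_zero (b : Bool) (v : ℂ) : direction b v ≠ 0 := by
  cases b <;> simp [direction, Prod.ext_iff]

/-- The point `p + (u, u v)`, respectively `p + (u v, u)`, of `ℂ²`. -/
def blowPoint (p : ℂ × ℂ) (b : Bool) (w : ℂ × ℂ) : ℂ × ℂ := p + w.1 • direction b w.2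

open scoped Classical in
/-- The standard parametrizations of the blow-up around the exceptional curve over `p`:
`(u, v)` is sent to the point `p + (u, u v)` (or `p + (u v, u)`) with the line of direction
`(1, v)` (or `(v, 1)`) at `p`.  They are only used where no centre other than `p` is hit. -/
def blowChart (τ : ℂ) (p : halfLattice τ) (b : Bool) (w : ℂ × ℂ) : BlownUpPlane τ :=
  ⟨(blowPoint p b w, fun p' =>
      if h : blowPoint p b w - (p' : ℂ × ℂ) ≠ 0 ∧ p' ≠ p then
        Projectivization.mk ℂ (blowPoint p b w - (p' : ℂ × ℂ)) h.1
      else Projectivization.mk ℂ (direction b w.2) (direction_ne_zero b w.2)), by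
    intro p'
    by_cases h : blowPoint p b w - (p' : ℂ × ℂ) ≠ 0 ∧ p' ≠ p
    · simp only [dif_pos h, Projectivization.submodule_mk]
      exact Submodule.mem_span_singleton_self _
    · simp only [dif_neg h, Projectivization.submodule_mk]
      by_cases hp : p' = p
      · subst hp
        rw [blowPoint, add_sub_cancel_left]
        exact Submodule.smul_mem _ _ (Submodule.mem_span_singleton_self _)
      · have h0 : blowPoint p b w - (p' : ℂ × ℂ) = 0 := by
          by_contra h1
          exact h ⟨h1, hp⟩
        rw [h0]
        exact Submodule.zero_mem _⟩

/-- The complex structure of the blow-up: a function is holomorphic if it is so in the standard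
parametrizations. -/
instance blownUpPlaneGerms (τ : ℂ) : HolomorphicGerms (BlownUpPlane τ) where
  HolAt f y := ∀ (p : halfLattice τ) (b : Bool) (w : ℂ × ℂ),
    (∀ p' : halfLattice τ, blowPoint p b w = p' → p' = p) → blowChart τ p b w = y →
      AnalyticAt ℂ (fun w' => f (blowChart τ p b w')) w

/-- The orbit equivalence relation of `Λ² ⋊ {±1}` on the blow-up: the transformation
`z ↦ ε z + l` sends the line `ℓ` at the centre `p` to the line `ε ℓ = ℓ` at `ε p + l`. -/
def kummerSetoid (τ : ℂ) : Setoid (BlownUpPlane τ) where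
  r y y' := ∃ ε : ℤˣ, ∃ l ∈ latticeSq τ, y'.1.1 = (ε : ℤ) • y.1.1 + l ∧
    ∀ p p' : halfLattice τ, (p' : ℂ × ℂ) = (ε : ℤ) • (p : ℂ × ℂ) + l → y'.1.2 p' = y.1.2 p
  iseqv :=
    { refl := fun y => ⟨1, 0, zero_mem _, by simp, fun p p' h => by
        have : p' = p := Subtype.ext (by simpa using h)
        rw [this]⟩
      symm := by
        rintro y y' ⟨ε, l, hl, hz, hp⟩
        refine ⟨ε, -((ε : ℤ) • l), neg_mem (zsmul_mem hl _), ?_, fun p p' h => (hp p' p ?_).symm⟩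
        · rw [hz]
          rcases Int.units_eq_one_or ε with rfl | rfl <;> simp
        · rw [h]
          rcases Int.units_eq_one_or ε with rfl | rfl <;> simp
      trans := by
        rintro y y' y'' ⟨ε, l, hl, hz, hp⟩ ⟨ε', l', hl', hz', hp'⟩
        refine ⟨ε' * ε, (ε' : ℤ) • l + l', add_mem (zsmul_mem hl _) hl', ?_, fun p p'' h => ?_⟩
        · rw [hz', hz, smul_add, Units.val_mul, mul_smul, add_assoc]
        · have hq : (ε : ℤ) • (p : ℂ × ℂ) + l ∈ halfLattice τ := by
            have hpp : (p : ℂ × ℂ) + p ∈ latticeSq τ := p.2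
            have := add_mem (zsmul_mem hpp (ε : ℤ)) (add_mem hl hl)
            change _ + _ ∈ latticeSq τ
            convert this using 1
            rw [smul_add]; abel
          rw [← hp p ⟨_, hq⟩ rfl]
          refine hp' ⟨_, hq⟩ p'' ?_
          rw [h, Units.val_mul, mul_smul, smul_add, add_assoc] }

/-- The smooth Kummer surface `X`. -/
abbrev KummerSurface (τ : ℂ) : Type := Quotient (kummerSetoid τ)

/-- The complex structure of `X`, as a quotient: a function is holomorphic if its lift to the
blow-up is. -/
instance kummerGerms (τ : ℂ) : HolomorphicGerms (KummerSurface τ) where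
  HolAt f x := ∀ y : BlownUpPlane τ, Quotient.mk (kummerSetoid τ) y = x →
    HolomorphicGerms.HolAt (fun y' => f (Quotient.mk (kummerSetoid τ) y')) y

/-- The resolution of singularities `X → X₀`. -/
def resolution (τ : ℂ) : KummerSurface τ → SingularKummer τ :=
  Quotient.lift
    (fun y => Quotient.mk (etaSetoid τ) ((y.1.1 : ℂ × ℂ) : AbelianSurface τ)) (by
      rintro y y' ⟨ε, l, hl, hz, -⟩
      refine Quotient.sound ?_
      have h0 : ((l : ℂ × ℂ) : AbelianSurface τ) = 0 := (QuotientAddGroup.eq_zero_iff l).2 hl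
      change _ ∨ _
      rcases Int.units_eq_one_or ε with rfl | rfl
      · left
        rw [hz, QuotientAddGroup.mk_add, h0]; simp
      · right
        rw [hz, QuotientAddGroup.mk_add, h0]; simp)

/-- The union of the sixteen exceptional curves of `X`. -/
def exceptionalLocus (τ : ℂ) : Set (KummerSurface τ) := resolution τ ⁻¹' singularPoints τ

/-- `Σ_X`, the proper transform of `Σ₀`: the closure of the preimage of `Σ₀` minus the singular
points. -/
def SigmaX (τ : ℂ) : Set (KummerSurface τ) :=
  closure (resolution τ ⁻¹' (Sigma0 τ \ singularPoints τ))

/-- `τ = 1/2 + i t`. -/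
def tau (t : ℝ) : ℂ := 1 / 2 + t * Complex.I

end RealStructures

end

/-!
The two surfaces are treated together. Both are covered, off a countable set `N` of centres, by a
local isomorphism `q` from `ℂ²` whose fibres are the orbits of `Λ² ⋊ E`, with `E = {1}` for the
abelian surface and `E = {±1}` for the Kummer surface; this is the structure `Uniformized`. In both
cases `Σ` is the closure of the image of `τℝ²`.

*Real structures.* A real structure that fixes `Σ` pointwise agrees near a point of `τℝ²` with the
map induced by `z ↦ u z̄`, where `u = τ / τ̄`, since `τℝ²` is a maximal totally real subspace. By
analytic continuation along the connected complement of the centres the two agree everywhere, so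
that `z ↦ u z̄` maps `Λ²` into itself (`Uniformized.conj_smul_mem_latticeSq`). As `τ + τ̄ = 1`, one
has `u = -1 + |τ|⁻² τ`, so that the condition is that `|τ|⁻² = (1/4 + t²)⁻¹` be an integer; it lies
between `0` and `4`, and the values `1`, `2`, `3` give the three special parameters (`special_iff`).
Conversely, if `u Λ̄ = Λ` then `z ↦ u z̄` descends to the abelian surface and lifts to the blow-up,
hence to the Kummer surface (`exists_realStructure_abelian`, `exists_realStructure_kummer`).

*The group.* The group `Γ` is `SL₂(ℤ)`, acting linearly on `ℂ²`. On the torus `(ℝ/ℤ)ᵈ` a group of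
automorphisms whose dual orbits of nonzero characters are infinite is ergodic, because the Fourier
coefficients of an invariant function are constant along these orbits and square-summable
(`torus_ergodic`). For `τℝ²` this gives the ergodicity of the image of Haar measure on `Σ` and an
orbit dense in `Σ`; for `ℂ² = ℝ⁴` it gives an orbit dense in the surface.

*The action on cohomology.* Each factor of `ℂ²` carries a continuous family of complex lines in `ℂ²`
that is invariant under the lattice and under `z ↦ -z`: the line through a section with theta-type
multipliers of degree `2` (`ellipticProj`). Being even, it descends to both surfaces. Its Euler
class is represented by an explicit singular cocycle, whose value on the image by `h ∈ SL₂(ℤ)` of an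
elliptic curve parallel to an axis is `2 (h i j)²` (`evalTorus_axisTorus`). An element acting
trivially on `H²` therefore has square `1`. Two shears generate a free group by ping-pong
(`lift_shears_injective`), and free groups have no torsion, so this free group acts faithfully
on `H²`.

*The boundary of `Σ_X`.* Near a real centre the blow-up has coordinates `(u, v)`, the transverse
parameter and the slope, in which the involution is `(u, v) ↦ (-u, v)`. Hence `(u², v)` are
holomorphic coordinates on the Kummer surface, where `Σ_X` is the half-plane `u² ≥ 0`
(`EdgeChart.exists_chart`). That a function of `(u², v)` that is analytic in `(u, v)` is analytic in
`(u², v)` follows from Osgood's lemma (`analyticAt_of_separately`, `analyticAt_of_comp_sq`). The map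
`(a, v) ↦ (√a, √a v)` halves areas (`volume_image_sqrtPolar`), so the invariant measure has constant
density up to the boundary.
-/

noncomputable section
namespace RealStructures
open Filter Topology Set MeasureTheory Metric

/-! ### Holomorphic functions of two variables -/

/-- Integration over a square along a continuous map, as a continuous linear functional. -/
def squareIntegral {K : Type*} [TopologicalSpace K] [CompactSpace K] (γ : ℝ × ℝ → K)
    (hγ : Continuous γ) (T : ℝ) : C(K, ℂ) →L[ℂ] ℂ :=
  have hint : ∀ f : C(K, ℂ), IntegrableOn (fun x => f (γ x)) (Icc (0 : ℝ) T ×ˢ Icc (0 : ℝ) T) :=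
    fun f => (f.continuous.comp hγ).continuousOn.integrableOn_compact
      (isCompact_Icc.prod isCompact_Icc)
  LinearMap.mkContinuous
    { toFun := fun f => ∫ x in Icc (0 : ℝ) T ×ˢ Icc (0 : ℝ) T, f (γ x)
      map_add' := fun f g => by
        simpa using integral_add (hint f) (hint g)
      map_smul' := fun c f => by
        simpa using integral_const_mul c (fun x => f (γ x)) }
    (volume.real (Icc (0 : ℝ) T ×ˢ Icc (0 : ℝ) T)) (fun f => by
      have h := norm_setIntegral_le_of_norm_le_const (μ := (volume : Measure (ℝ × ℝ)))
        (s := Icc (0 : ℝ) T ×ˢ Icc (0 : ℝ) T) (f := fun x => f (γ x)) (C := ‖f‖)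
        (isCompact_Icc.prod isCompact_Icc).measure_lt_top
        (fun x _ => f.norm_coe_le_norm _)
      rw [mul_comm]
      exact h)

theorem squareIntegral_apply {K : Type*} [TopologicalSpace K] [CompactSpace K] (γ : ℝ × ℝ → K)
    (hγ : Continuous γ) {T : ℝ} (hT : 0 ≤ T) (f : C(K, ℂ)) :
    squareIntegral γ hγ T f = ∫ x in 0..T, ∫ y in 0..T, f (γ (x, y)) := by
  have h1 : squareIntegral γ hγ T f = ∫ x in Icc (0 : ℝ) T ×ˢ Icc (0 : ℝ) T, f (γ x) := rfl
  rw [h1, Measure.volume_eq_prod, setIntegral_prod _ (by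
    rw [← Measure.volume_eq_prod]
    exact (f.continuous.comp hγ).continuousOn.integrableOn_compact
      (isCompact_Icc.prod isCompact_Icc))]
  rw [intervalIntegral.integral_of_le hT, integral_Icc_eq_integral_Ioc]
  congr 1 with x
  rw [intervalIntegral.integral_of_le hT, integral_Icc_eq_integral_Ioc]

/-- The resolvent of a continuous function on a compact space is analytic off its range. -/
theorem analyticAt_inverse_sub {K : Type*} [TopologicalSpace K] [CompactSpace K]
    (a : C(K, ℂ)) (w : ℂ) (h : ∀ x, a x ≠ w) :
    AnalyticAt ℂ (fun z : ℂ => Ring.inverse (a - algebraMap ℂ C(K, ℂ) z)) w := by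
  have hu : IsUnit (a - algebraMap ℂ C(K, ℂ) w) := by
    rw [ContinuousMap.isUnit_iff_forall_ne_zero]
    intro x
    simpa [sub_ne_zero] using h x
  have h1 : AnalyticAt ℂ (fun z : ℂ => a - algebraMap ℂ C(K, ℂ) z) w :=
    analyticAt_const.sub ((Algebra.linearMap ℂ C(K, ℂ)).toContinuousLinearMap.analyticAt w)
  have h2 := analyticAt_inverse (𝕜 := ℂ) hu.unit
  exact AnalyticAt.fun_comp (f := fun z : ℂ => a - algebraMap ℂ C(K, ℂ) z) h2 h1

theorem inverse_sub_apply {K : Type*} [TopologicalSpace K] [CompactSpace K]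
    (a : C(K, ℂ)) (w : ℂ) (h : ∀ x, a x ≠ w) (x : K) :
    Ring.inverse (a - algebraMap ℂ C(K, ℂ) w) x = (a x - w)⁻¹ := by
  have hu : IsUnit (a - algebraMap ℂ C(K, ℂ) w) := by
    rw [ContinuousMap.isUnit_iff_forall_ne_zero]
    intro x
    simpa [sub_ne_zero] using h x
  have h1 := Ring.mul_inverse_cancel _ hu
  have h2 := DFunLike.congr_fun h1 x
  simp only [ContinuousMap.mul_apply, ContinuousMap.sub_apply, ContinuousMap.one_apply] at h2
  exact eq_inv_of_mul_eq_one_right (by simpa using h2)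

/-- **Osgood's lemma** in two variables: a continuous, separately holomorphic function is analytic.
Cauchy's formula writes the function as a continuous linear functional of a product of two
resolvents in the Banach algebra of continuous functions on a torus, and resolvents are analytic. -/
theorem analyticAt_of_separately {f : ℂ × ℂ → ℂ} {p : ℂ × ℂ} {r : ℝ} (hr : 0 < r)
    (hc : ContinuousOn f (closedBall p.1 r ×ˢ closedBall p.2 r))
    (h1 : ∀ y ∈ closedBall p.2 r, DifferentiableOn ℂ (fun x => f (x, y)) (ball p.1 r))
    (h2 : ∀ x ∈ closedBall p.1 r, DifferentiableOn ℂ (fun y => f (x, y)) (ball p.2 r)) :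
    AnalyticAt ℂ f p := by
  let γ : ℝ × ℝ → sphere p.1 r × sphere p.2 r := fun x =>
    (⟨circleMap p.1 r x.1, circleMap_mem_sphere _ hr.le _⟩,
    ⟨circleMap p.2 r x.2, circleMap_mem_sphere _ hr.le _⟩)
  have hγ : Continuous γ := by
    apply Continuous.prodMk
    · exact Continuous.subtype_mk ((continuous_circleMap _ _).comp continuous_fst) _
    · exact Continuous.subtype_mk ((continuous_circleMap _ _).comp continuous_snd) _
  let a : C(sphere p.1 r × sphere p.2 r, ℂ) := ⟨fun x => x.1, by fun_prop⟩
  let b : C(sphere p.1 r × sphere p.2 r, ℂ) := ⟨fun x => x.2, by fun_prop⟩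
  let G : C(sphere p.1 r × sphere p.2 r, ℂ) := ⟨fun x =>
    (((x.1 : ℂ) - p.1) * Complex.I) * (((x.2 : ℂ) - p.2) * Complex.I) * f (x.1, x.2), by
      apply Continuous.mul (by fun_prop)
      exact hc.comp_continuous (by fun_prop)
        (fun x => ⟨sphere_subset_closedBall x.1.2, sphere_subset_closedBall x.2.2⟩)⟩
  let k : ℂ × ℂ → C(sphere p.1 r × sphere p.2 r, ℂ) := fun w =>
    Ring.inverse (a - algebraMap ℂ _ w.1) * Ring.inverse (b - algebraMap ℂ _ w.2) * G
  have hane : ∀ w ∈ ball p.1 r, ∀ x, a x ≠ w := by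
    intro w hw x hx
    have := x.1.2
    change (x.1 : ℂ) = w at hx
    rw [hx, mem_sphere] at this
    rw [mem_ball] at hw
    linarith
  have hbne : ∀ w ∈ ball p.2 r, ∀ x, b x ≠ w := by
    intro w hw x hx
    have := x.2.2
    change (x.2 : ℂ) = w at hx
    rw [hx, mem_sphere] at this
    rw [mem_ball] at hw
    linarith
  have hk : AnalyticAt ℂ k p := by
    refine AnalyticAt.mul (AnalyticAt.mul ?_ ?_) analyticAt_const
    · exact AnalyticAt.fun_comp (f := fun w : ℂ × ℂ => w.1)
        (analyticAt_inverse_sub a p.1 (hane _ (mem_ball_self hr))) analyticAt_fst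
    · exact AnalyticAt.fun_comp (f := fun w : ℂ × ℂ => w.2)
        (analyticAt_inverse_sub b p.2 (hbne _ (mem_ball_self hr))) analyticAt_snd
  have hL : AnalyticAt ℂ (fun w => ((2 * Real.pi * Complex.I : ℂ)⁻¹ * (2 * Real.pi * Complex.I)⁻¹) *
      squareIntegral γ hγ (2 * Real.pi) (k w)) p :=
    analyticAt_const.mul (AnalyticAt.fun_comp ((squareIntegral γ hγ (2 * Real.pi)).analyticAt _) hk)
  refine hL.congr ?_
  filter_upwards [prod_mem_nhds (ball_mem_nhds p.1 hr) (ball_mem_nhds p.2 hr)] with w hw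
  have hin : ∀ x ∈ closedBall p.1 r,
      (∮ y in C(p.2, r), (y - w.2)⁻¹ • f (x, y)) = (2 * Real.pi * Complex.I : ℂ) • f (x, w.2) := by
    intro x hx
    refine DiffContOnCl.circleIntegral_sub_inv_smul ⟨h2 x hx, ?_⟩ hw.2
    rw [closure_ball _ hr.ne']
    exact hc.comp (by fun_prop) (fun y hy => ⟨hx, hy⟩)
  have hout : (∮ x in C(p.1, r), (x - w.1)⁻¹ • f (x, w.2)) =
      (2 * Real.pi * Complex.I : ℂ) • f (w.1, w.2) := by
    refine DiffContOnCl.circleIntegral_sub_inv_smul ⟨h1 _ (ball_subset_closedBall hw.2), ?_⟩ hw.1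
    rw [closure_ball _ hr.ne']
    exact hc.comp (by fun_prop) (fun y hy => ⟨hy, ball_subset_closedBall hw.2⟩)
  have hpi : (2 * Real.pi * Complex.I : ℂ) ≠ 0 := by simp [Real.pi_ne_zero]
  rw [squareIntegral_apply _ _ (by positivity)]
  have e1 : ∀ x y : ℝ, k w (γ (x, y)) = deriv (circleMap p.1 r) x *
      ((circleMap p.1 r x - w.1)⁻¹ * (deriv (circleMap p.2 r) y *
        ((circleMap p.2 r y - w.2)⁻¹ * f (circleMap p.1 r x, circleMap p.2 r y)))) := by
    intro x y
    have ha := inverse_sub_apply a w.1 (hane _ hw.1) (γ (x, y))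
    have hb := inverse_sub_apply b w.2 (hbne _ hw.2) (γ (x, y))
    simp only [k, ContinuousMap.mul_apply, ha, hb]
    simp only [a, b, G, γ, ContinuousMap.coe_mk, deriv_circleMap, circleMap]
    ring
  simp_rw [e1, intervalIntegral.integral_const_mul]
  have e2 : ∀ x : ℝ, (∫ y in 0..2 * Real.pi, deriv (circleMap p.2 r) y *
        ((circleMap p.2 r y - w.2)⁻¹ * f (circleMap p.1 r x, circleMap p.2 r y))) =
      (2 * Real.pi * Complex.I : ℂ) • f (circleMap p.1 r x, w.2) := fun x =>
    hin _ (circleMap_mem_closedBall _ hr.le _)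
  simp_rw [e2, smul_eq_mul]
  have e3 : (∫ x in 0..2 * Real.pi, deriv (circleMap p.1 r) x *
        ((circleMap p.1 r x - w.1)⁻¹ * f (circleMap p.1 r x, w.2))) =
      (2 * Real.pi * Complex.I : ℂ) • f (w.1, w.2) := hout
  have e4 : ∀ x : ℝ, deriv (circleMap p.1 r) x * ((circleMap p.1 r x - w.1)⁻¹ *
      (2 * Real.pi * Complex.I * f (circleMap p.1 r x, w.2))) = 2 * Real.pi * Complex.I *
      (deriv (circleMap p.1 r) x * ((circleMap p.1 r x - w.1)⁻¹ * f (circleMap p.1 r x, w.2))) := by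
    intro x; ring
  simp_rw [e4]
  rw [intervalIntegral.integral_const_mul, e3, smul_eq_mul]
  field_simp

/-- Complex conjugation of both coordinates of `ℂ²`. -/
def conj2 (z : ℂ × ℂ) : ℂ × ℂ := ((starRingEnd ℂ) z.1, (starRingEnd ℂ) z.2)

theorem continuous_conj2 : Continuous conj2 := by unfold conj2; fun_prop

@[simp] theorem conj2_conj2 (z : ℂ × ℂ) : conj2 (conj2 z) = z := by simp [conj2]

theorem analyticAt_conj_comp_conj2 {f : ℂ × ℂ → ℂ} {p : ℂ × ℂ} (hf : AnalyticAt ℂ f (conj2 p)) :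
    AnalyticAt ℂ (fun z => (starRingEnd ℂ) (f (conj2 z))) p := by
  have hev : ∀ᶠ z in 𝓝 p, AnalyticAt ℂ f (conj2 z) :=
    continuous_conj2.continuousAt.eventually hf.eventually_analyticAt
  obtain ⟨r, hr, hsub⟩ := nhds_basis_closedBall.mem_iff.1 hev
  rw [← closedBall_prod_same] at hsub
  refine analyticAt_of_separately hr ?_ ?_ ?_
  · intro z hz
    have h1 : ContinuousAt f (conj2 z) := (hsub hz).continuousAt
    exact (Complex.continuous_conj.continuousAt.comp
      (h1.comp continuous_conj2.continuousAt)).continuousWithinAt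
  · intro y hy x hx
    have h1 : AnalyticAt ℂ f (conj2 (x, y)) := hsub ⟨ball_subset_closedBall hx, hy⟩
    have h2 : DifferentiableAt ℂ (fun x' => f (x', (starRingEnd ℂ) y)) ((starRingEnd ℂ) x) :=
      DifferentiableAt.comp (f := fun x' : ℂ => (x', (starRingEnd ℂ) y)) ((starRingEnd ℂ) x)
        h1.differentiableAt (by fun_prop)
    have h3 := h2.conj_conj
    rw [Complex.conj_conj] at h3
    exact h3.differentiableWithinAt
  · intro x hx y hy
    have h1 : AnalyticAt ℂ f (conj2 (x, y)) := hsub ⟨hx, ball_subset_closedBall hy⟩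
    have h2 : DifferentiableAt ℂ (fun y' => f ((starRingEnd ℂ) x, y')) ((starRingEnd ℂ) y) :=
      DifferentiableAt.comp (f := fun y' : ℂ => ((starRingEnd ℂ) x, y')) ((starRingEnd ℂ) y)
        h1.differentiableAt (by fun_prop)
    have h3 := h2.conj_conj
    rw [Complex.conj_conj] at h3
    exact h3.differentiableWithinAt

theorem isOpenMap_sq : IsOpenMap fun z : ℂ => z ^ 2 := by
  have h : AnalyticOnNhd ℂ (fun z : ℂ => z ^ 2) univ := fun z _ => analyticAt_id.pow 2
  rcases h.is_constant_or_isOpen isPreconnected_univ with ⟨c, hc⟩ | h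
  · have h0 := hc 0 trivial
    have h1 := hc 1 trivial
    simp only [zero_pow two_ne_zero, one_pow] at h0 h1
    exact absurd (h0.trans h1.symm) zero_ne_one
  · exact fun U hU => h U (subset_univ _) hU

/-- A function of `(w, v)` is analytic as soon as it is so after the substitution `w = u²`. -/
theorem analyticAt_of_comp_sq {h : ℂ × ℂ → ℂ} {u v : ℂ}
    (hg : AnalyticAt ℂ (fun z : ℂ × ℂ => h (z.1 ^ 2, z.2)) (u, v)) :
    AnalyticAt ℂ h (u ^ 2, v) := by
  have key : ∀ u v : ℂ, u ≠ 0 → AnalyticAt ℂ (fun z : ℂ × ℂ => h (z.1 ^ 2, z.2)) (u, v) →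
      AnalyticAt ℂ h (u ^ 2, v) := by
    intro u v hu hg
    -- a branch of the square root near `u ^ 2`
    let ρ : ℂ → ℂ := fun a => u * Complex.exp (Complex.log (a / u ^ 2) / 2)
    have hu2 : u ^ 2 ≠ 0 := pow_ne_zero 2 hu
    have hρ : AnalyticAt ℂ ρ (u ^ 2) := by
      refine analyticAt_const.mul (AnalyticAt.cexp (AnalyticAt.div (AnalyticAt.clog
        (analyticAt_id.div analyticAt_const hu2) ?_) analyticAt_const two_ne_zero))
      simp [hu2]
    have hρu : ρ (u ^ 2) = u := by simp [ρ, hu2]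
    have h1 : AnalyticAt ℂ (fun z : ℂ × ℂ => (ρ z.1, z.2)) (u ^ 2, v) :=
      (AnalyticAt.fun_comp (f := fun z : ℂ × ℂ => z.1) hρ analyticAt_fst).prod analyticAt_snd
    have h2 : AnalyticAt ℂ (fun z : ℂ × ℂ => h ((ρ z.1) ^ 2, z.2)) (u ^ 2, v) := by
      refine AnalyticAt.fun_comp (g := fun z : ℂ × ℂ => h (z.1 ^ 2, z.2))
        (f := fun z : ℂ × ℂ => (ρ z.1, z.2)) ?_ h1
      simpa only [hρu] using hg
    refine h2.congr ?_
    have : ∀ᶠ z : ℂ × ℂ in 𝓝 (u ^ 2, v), z.1 ≠ 0 :=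
      (continuous_fst.continuousAt (x := ((u ^ 2, v) : ℂ × ℂ))).eventually_ne hu2
    filter_upwards [this] with z hz
    have : (ρ z.1) ^ 2 = z.1 := by
      simp only [ρ]
      rw [mul_pow, ← Complex.exp_nat_mul]
      push_cast
      rw [mul_div_cancel₀ _ two_ne_zero, Complex.exp_log (div_ne_zero hz hu2)]
      field_simp
    rw [this]
  rcases eq_or_ne u 0 with rfl | hu
  swap
  · exact key u v hu hg
  obtain ⟨ρ, hρ, hsub⟩ := nhds_basis_ball.mem_iff.1 hg.eventually_analyticAt
  rw [← ball_prod_same] at hsub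
  -- every point of the polydisc is the image of a point where the substitution is analytic
  have hpt : ∀ a ∈ ball (0 : ℂ) (ρ ^ 2), ∀ y ∈ ball v ρ, ∃ u : ℂ, u ^ 2 = a ∧
      AnalyticAt ℂ (fun z : ℂ × ℂ => h (z.1 ^ 2, z.2)) (u, y) := by
    intro a ha y hy
    obtain ⟨u, hu⟩ := IsAlgClosed.exists_pow_nat_eq a (n := 2) (by norm_num)
    refine ⟨u, hu, hsub ⟨?_, hy⟩⟩
    rw [mem_ball_zero_iff] at ha ⊢
    rw [← hu, norm_pow] at ha
    exact lt_of_pow_lt_pow_left₀ 2 hρ.le ha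
  have hsq : IsOpenMap (fun z : ℂ × ℂ => (z.1 ^ 2, z.2)) := isOpenMap_sq.prodMap IsOpenMap.id
  have hcont : ∀ a ∈ ball (0 : ℂ) (ρ ^ 2), ∀ y ∈ ball v ρ, ContinuousAt h (a, y) := by
    intro a ha y hy
    obtain ⟨u, rfl, hu⟩ := hpt a ha y hy
    have h1 : Tendsto (h ∘ fun z : ℂ × ℂ => (z.1 ^ 2, z.2)) (𝓝 (u, y)) (𝓝 (h (u ^ 2, y))) :=
      hu.continuousAt
    exact (tendsto_map'_iff.2 h1).mono_left (hsq.nhds_le (u, y))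
  have hdiff : ∀ a ∈ ball (0 : ℂ) (ρ ^ 2), a ≠ 0 → ∀ y ∈ ball v ρ, DifferentiableAt ℂ h (a, y) := by
    intro a ha ha0 y hy
    obtain ⟨u, rfl, hu⟩ := hpt a ha y hy
    exact (key u y (by rintro rfl; simp at ha0) hu).differentiableAt
  have hr : 0 < min (ρ ^ 2) ρ / 2 := by positivity
  have hrρ : min (ρ ^ 2) ρ / 2 < ρ ^ 2 := by
    have := min_le_left (ρ ^ 2) ρ
    have : 0 < ρ ^ 2 := by positivity
    linarith
  have hrρ' : min (ρ ^ 2) ρ / 2 < ρ := by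
    have := min_le_right (ρ ^ 2) ρ
    linarith
  rw [show (0 : ℂ) ^ 2 = 0 by norm_num]
  refine analyticAt_of_separately (p := (0, v)) hr ?_ ?_ ?_
  · intro z hz
    exact (hcont z.1 (closedBall_subset_ball hrρ hz.1) z.2
      (closedBall_subset_ball hrρ' hz.2)).continuousWithinAt
  · intro y hy
    have hy' := closedBall_subset_ball hrρ' hy
    refine (Complex.differentiableOn_compl_singleton_and_continuousAt_iff
      (ball_mem_nhds (0 : ℂ) hr)).1 ⟨?_, ?_⟩
    · intro x hx
      have := hdiff x (ball_subset_ball hrρ.le hx.1) hx.2 y hy'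
      exact (this.comp (f := fun x : ℂ => (x, y)) x (by fun_prop)).differentiableWithinAt
    · exact (hcont 0 (mem_ball_self (by positivity)) y hy').comp
        (f := fun x : ℂ => (x, y)) (by fun_prop)
  · intro x hx
    have hx' := closedBall_subset_ball hrρ hx
    intro y hy
    have hy' := ball_subset_ball hrρ'.le hy
    obtain ⟨u, rfl, hu⟩ := hpt x hx' y hy'
    exact (hu.differentiableAt.comp (f := fun y : ℂ => (u, y)) y
      (by fun_prop)).differentiableWithinAt

/-- A function analytic on a polydisc which vanishes on the real points is zero. -/
theorem eqOn_zero_of_real {f : ℂ × ℂ → ℂ} {a b : ℝ} {r : ℝ} (hr : 0 < r)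
    (hf : AnalyticOnNhd ℂ f (ball (a : ℂ) r ×ˢ ball (b : ℂ) r))
    (h0 : ∀ x y : ℝ, (x : ℂ) ∈ ball (a : ℂ) r → (y : ℂ) ∈ ball (b : ℂ) r → f (x, y) = 0) :
    ∀ z ∈ ball (a : ℂ) r ×ˢ ball (b : ℂ) r, f z = 0 := by
  have one : ∀ (g : ℂ → ℂ) (c : ℝ), AnalyticOnNhd ℂ g (ball (c : ℂ) r) →
      (∀ x : ℝ, (x : ℂ) ∈ ball (c : ℂ) r → g x = 0) → ∀ z ∈ ball (c : ℂ) r, g z = 0 := by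
    intro g c hg hgr
    refine hg.eqOn_zero_of_preconnected_of_frequently_eq_zero (convex_ball _ _).isPreconnected
      (mem_ball_self hr) ?_
    have ht : Tendsto (fun x : ℝ => (x : ℂ)) (𝓝[≠] c) (𝓝[≠] (c : ℂ)) := by
      refine tendsto_nhdsWithin_iff.2 ⟨(Complex.continuous_ofReal.tendsto c).mono_left
        nhdsWithin_le_nhds, ?_⟩
      filter_upwards [self_mem_nhdsWithin] with x hx
      simpa using hx
    refine ht.frequently (Eventually.frequently ?_)
    have : ∀ᶠ x : ℝ in 𝓝[≠] c, (x : ℂ) ∈ ball (c : ℂ) r :=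
      (ht.mono_right nhdsWithin_le_nhds).eventually (ball_mem_nhds _ hr)
    filter_upwards [this] with x hx using hgr x hx
  rintro ⟨z1, z2⟩ ⟨hz1, hz2⟩
  have step : ∀ y : ℝ, (y : ℂ) ∈ ball (b : ℂ) r → f (z1, y) = 0 := fun y hy =>
    one (fun x => f (x, y)) a (fun x hx => AnalyticAt.fun_comp (f := fun x : ℂ => (x, (y : ℂ)))
      (hf (x, y) ⟨hx, hy⟩) (analyticAt_id.prod analyticAt_const)) (fun x hx => h0 x y hx hy) z1 hz1
  exact one (fun y => f (z1, y)) b (fun y hy => AnalyticAt.fun_comp (f := fun y : ℂ => (z1, y))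
      (hf (z1, y) ⟨hz1, hy⟩) (analyticAt_const.prod analyticAt_id)) step z2 hz2

/-! ### Lifts and logarithms on simplices -/

instance (n : ℕ) : LocallyPathConnectedSpace (stdSimplex ℝ (Fin (n + 1))) :=
  (convex_stdSimplex ℝ (Fin (n + 1))).locallyPathConnectedSpace

instance (n : ℕ) : ContractibleSpace (stdSimplex ℝ (Fin (n + 1))) :=
  (convex_stdSimplex ℝ (Fin (n + 1))).contractibleSpace ⟨_, (stdSimplex.vertex 0).2⟩

theorem exists_continuous_log {n : ℕ} (f : C(stdSimplex ℝ (Fin (n + 1)), ℂ)) (hf : ∀ x, f x ≠ 0) :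
    ∃ l : C(stdSimplex ℝ (Fin (n + 1)), ℂ), ∀ x, Complex.exp (l x) = f x := by
  obtain ⟨l, ⟨-, hl⟩, -⟩ := Complex.isCoveringMapOn_exp.existsUnique_continuousMap_lifts f
    (a₀ := stdSimplex.vertex 0) (e₀ := Complex.log (f (stdSimplex.vertex 0)))
    (Complex.exp_log (hf _)) hf
  exact ⟨l, fun x => congrFun hl x⟩

/-- Two logarithms of the same function have the same increments. -/
theorem log_sub_eq {n : ℕ} {l l' : C(stdSimplex ℝ (Fin (n + 1)), ℂ)}
    (h : ∀ x, Complex.exp (l x) = Complex.exp (l' x)) (x y : stdSimplex ℝ (Fin (n + 1))) :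
    l x - l y = l' x - l' y := by
  obtain ⟨k, hk⟩ := Complex.exp_eq_exp_iff_exists_int.1 (h y)
  let f : C(stdSimplex ℝ (Fin (n + 1)), ℂ) := ⟨fun x => Complex.exp (l x), by fun_prop⟩
  have hu := Complex.isCoveringMapOn_exp.existsUnique_continuousMap_lifts f
    (a₀ := y) (e₀ := l y) rfl (fun x => Complex.exp_ne_zero _)
  let m : C(stdSimplex ℝ (Fin (n + 1)), ℂ) := ⟨fun x => l' x + k * (2 * Real.pi * Complex.I),
    by fun_prop⟩
  have h1 : l = m := hu.unique ⟨rfl, rfl⟩ ⟨hk.symm, by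
    funext x
    change Complex.exp (l' x + k * (2 * Real.pi * Complex.I)) = Complex.exp (l x)
    rw [h x, Complex.exp_eq_exp_iff_exists_int]
    exact ⟨k, rfl⟩⟩
  rw [h1]
  simp [m]

/-- The increment along an edge of a logarithm of a function. -/
def logIncrement (f : stdSimplex ℝ (Fin 2) → ℂ) : ℂ :=
  open scoped Classical in
  if h : ∃ l : C(stdSimplex ℝ (Fin 2), ℂ), ∀ x, Complex.exp (l x) = f x then
    h.choose (stdSimplex.vertex 1) - h.choose (stdSimplex.vertex 0) else 0

theorem logIncrement_eq {f : stdSimplex ℝ (Fin 2) → ℂ} (l : C(stdSimplex ℝ (Fin 2), ℂ))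
    (h : ∀ x, Complex.exp (l x) = f x) :
    logIncrement f = l (stdSimplex.vertex 1) - l (stdSimplex.vertex 0) := by
  have h' : ∃ l : C(stdSimplex ℝ (Fin 2), ℂ), ∀ x, Complex.exp (l x) = f x := ⟨l, h⟩
  rw [logIncrement, dif_pos h']
  exact log_sub_eq (fun x => by rw [h'.choose_spec, h]) _ _

/-- A continuous family of lines in `ℂ²`, given by rank-one idempotents. -/
structure IsLineFamily {Y : Type*} [TopologicalSpace Y]
    (P : C(Y, (ℂ × ℂ) →L[ℂ] (ℂ × ℂ))) : Prop where
  idem : ∀ y v, P y (P y v) = P y v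
  exists_ne : ∀ y, ∃ v, v ≠ 0 ∧ P y v = v
  rank_one : ∀ y v w, v ≠ 0 → P y v = v → P y w = w → ∃ c : ℂ, w = c • v

/-- A nowhere vanishing section `a` of the pullback by `σ` of a family of lines. -/
def IsLineLift {K Y : Type*} [TopologicalSpace K] [TopologicalSpace Y]
    (P : C(Y, (ℂ × ℂ) →L[ℂ] (ℂ × ℂ))) (σ : C(K, Y)) (a : C(K, ℂ × ℂ)) : Prop :=
  ∀ x, P (σ x) (a x) = a x ∧ a x ≠ 0

theorem IsLineLift.comp {K L Y : Type*} [TopologicalSpace K] [TopologicalSpace L]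
    [TopologicalSpace Y] {P : C(Y, (ℂ × ℂ) →L[ℂ] (ℂ × ℂ))} {σ : C(K, Y)} {a : C(K, ℂ × ℂ)}
    (h : IsLineLift P σ a) (g : C(L, K)) : IsLineLift P (σ.comp g) (a.comp g) :=
  fun x => h (g x)

/-- Projecting a section along a small change of the family of lines keeps it nonzero; along a
contraction of the simplex this reduces the existence of sections to a constant family. -/
theorem IsLineFamily.exists_lift {Y : Type*} [TopologicalSpace Y]
    {P : C(Y, (ℂ × ℂ) →L[ℂ] (ℂ × ℂ))} (hP : IsLineFamily P) {n : ℕ}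
    (σ : C(stdSimplex ℝ (Fin (n + 1)), Y)) : ∃ a, IsLineLift P σ a := by
  obtain ⟨y, ⟨H⟩⟩ := id_nullhomotopic (stdSimplex ℝ (Fin (n + 1)))
  let G : C(unitInterval × stdSimplex ℝ (Fin (n + 1)), (ℂ × ℂ) →L[ℂ] (ℂ × ℂ)) :=
    P.comp (σ.comp H.toContinuousMap)
  let Q : C(unitInterval, C(stdSimplex ℝ (Fin (n + 1)), (ℂ × ℂ) →L[ℂ] (ℂ × ℂ))) := G.curry
  let S : Set unitInterval := {s | ∃ a : C(stdSimplex ℝ (Fin (n + 1)), ℂ × ℂ),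
    ∀ x, Q s x (a x) = a x ∧ a x ≠ 0}
  have hstep : ∀ s s', dist (Q s) (Q s') < 1 → s ∈ S → s' ∈ S := by
    rintro s s' hd ⟨a, ha⟩
    refine ⟨⟨fun x => Q s' x (a x), by fun_prop⟩, fun x => ⟨hP.idem _ _, fun h0 => ?_⟩⟩
    have h1 : ‖Q s x - Q s' x‖ < 1 := by
      rw [← dist_eq_norm]
      exact (ContinuousMap.dist_apply_le_dist x).trans_lt hd
    have h2 : (Q s x - Q s' x) (a x) = a x := by
      change Q s' x (a x) = 0 at h0
      rw [sub_apply, h0, sub_zero, (ha x).1]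
    have h3 := (Q s x - Q s' x).le_opNorm (a x)
    rw [h2] at h3
    have h4 : 0 < ‖a x‖ := norm_pos_iff.2 (ha x).2
    nlinarith
  have hnear : ∀ s, ∀ᶠ s' in 𝓝 s, dist (Q s) (Q s') < 1 := fun s => by
    have : Tendsto (fun s' => dist (Q s) (Q s')) (𝓝 s) (𝓝 (dist (Q s) (Q s))) :=
      (continuous_const.dist Q.continuous).tendsto s
    rw [dist_self] at this
    exact this.eventually_lt_const one_pos
  have hS : IsClopen S := by
    constructor
    · rw [← isOpen_compl_iff, isOpen_iff_mem_nhds]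
      intro s hs
      filter_upwards [hnear s] with s' h' hs'
      exact hs (hstep s' s (by rwa [dist_comm]) hs')
    · rw [isOpen_iff_mem_nhds]
      intro s hs
      filter_upwards [hnear s] with s' h' using hstep s s' h' hs
  have h1 : (1 : unitInterval) ∈ S := by
    obtain ⟨v, hv0, hv⟩ := hP.exists_ne (σ y)
    refine ⟨ContinuousMap.const _ v, fun x => ⟨?_, hv0⟩⟩
    change P (σ (H (1, x))) v = v
    rw [H.apply_one]
    exact hv
  have h0 : (0 : unitInterval) ∈ S := by
    rw [(isClopen_iff.1 hS).resolve_left (fun h => by rw [h] at h1; exact h1)]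
    trivial
  obtain ⟨a, ha⟩ := h0
  refine ⟨a, fun x => ⟨?_, (ha x).2⟩⟩
  have := (ha x).1
  change P (σ (H (0, x))) (a x) = a x at this
  rwa [H.apply_zero] at this

/-- The scalar `c` with `w = c v`, for `w` in the line of the nonzero vector `v`. -/
def lineRatio (v w : ℂ × ℂ) : ℂ :=
  ((starRingEnd ℂ) v.1 * w.1 + (starRingEnd ℂ) v.2 * w.2) /
    ((starRingEnd ℂ) v.1 * v.1 + (starRingEnd ℂ) v.2 * v.2)

theorem sum_conj_mul_self_ne_zero {v : ℂ × ℂ} (hv : v ≠ 0) :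
    (starRingEnd ℂ) v.1 * v.1 + (starRingEnd ℂ) v.2 * v.2 ≠ 0 := by
  rw [← Complex.normSq_eq_conj_mul_self, ← Complex.normSq_eq_conj_mul_self]
  norm_cast
  intro h
  have h1 := Complex.normSq_nonneg v.1
  have h2 := Complex.normSq_nonneg v.2
  exact hv (Prod.ext (Complex.normSq_eq_zero.1 (by linarith))
    (Complex.normSq_eq_zero.1 (by linarith)))

@[simp] theorem lineRatio_smul {v : ℂ × ℂ} (hv : v ≠ 0) (c : ℂ) : lineRatio v (c • v) = c := by
  rw [lineRatio, div_eq_iff (sum_conj_mul_self_ne_zero hv)]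
  simp
  ring

theorem continuous_lineRatio {K : Type*} [TopologicalSpace K] (a b : C(K, ℂ × ℂ))
    (ha : ∀ x, a x ≠ 0) : Continuous fun x => lineRatio (a x) (b x) := by
  unfold lineRatio
  refine Continuous.div (by fun_prop) (by fun_prop) (fun x => sum_conj_mul_self_ne_zero (ha x))

/-! ### The Euler class of a family of lines -/

theorem face_vertex (n : ℕ) (i : Fin (n + 2)) (j : Fin (n + 1)) :
    face n i (stdSimplex.vertex j) = stdSimplex.vertex (i.succAbove j) :=
  stdSimplex.map_vertex _ _

theorem face_comp_face (n : ℕ) (j : Fin (n + 3)) (i : Fin (n + 2)) :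
    (face (n + 1) j).comp (face n i) = ⟨stdSimplex.map (j.succAbove ∘ i.succAbove),
      stdSimplex.continuous_map _⟩ := by
  ext1 x
  exact stdSimplex.map_comp_apply _ _ _

section Euler

variable {Y : Type*} [TopologicalSpace Y] {P : C(Y, (ℂ × ℂ) →L[ℂ] (ℂ × ℂ))}

theorem IsLineFamily.eq_lineRatio_smul (hP : IsLineFamily P) {y : Y} {v w : ℂ × ℂ}
    (hv : v ≠ 0) (h1 : P y v = v) (h2 : P y w = w) : w = lineRatio v w • v := by
  obtain ⟨c, rfl⟩ := hP.rank_one y v w hv h1 h2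
  rw [lineRatio_smul hv]

theorem IsLineFamily.lineRatio_ne_zero (hP : IsLineFamily P) {y : Y} {v w : ℂ × ℂ}
    (hv : v ≠ 0) (h1 : P y v = v) (h2 : P y w = w) (hw : w ≠ 0) : lineRatio v w ≠ 0 := by
  intro h
  apply hw
  rw [hP.eq_lineRatio_smul hv h1 h2, h, zero_smul]

theorem IsLineFamily.lineRatio_mul (hP : IsLineFamily P) {y : Y} {u v w : ℂ × ℂ}
    (hu : u ≠ 0) (hv : v ≠ 0) (h0 : P y u = u) (h1 : P y v = v) (h2 : P y w = w) :
    lineRatio u v * lineRatio v w = lineRatio u w := by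
  obtain ⟨c, rfl⟩ := hP.rank_one y u v hu h0 h1
  obtain ⟨d, rfl⟩ := hP.rank_one y _ w hv h1 h2
  rw [lineRatio_smul hu, lineRatio_smul hv, smul_smul, lineRatio_smul hu, mul_comm]

/-- A chosen nonzero vector in the line over `y`. -/
def IsLineFamily.base (hP : IsLineFamily P) (y : Y) : ℂ × ℂ := (hP.exists_ne y).choose

/-- A chosen section over a simplex. -/
def IsLineFamily.lift (hP : IsLineFamily P) {n : ℕ} (σ : SingularSimplex Y n) :
    C(stdSimplex ℝ (Fin (n + 1)), ℂ × ℂ) :=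
  (hP.exists_lift σ).choose

theorem IsLineFamily.lift_spec (hP : IsLineFamily P) {n : ℕ} (σ : SingularSimplex Y n) :
    IsLineLift P σ (hP.lift σ) :=
  (hP.exists_lift σ).choose_spec

theorem IsLineFamily.base_ne (hP : IsLineFamily P) (y : Y) : hP.base y ≠ 0 :=
  (hP.exists_ne y).choose_spec.1

theorem IsLineFamily.base_spec (hP : IsLineFamily P) (y : Y) : P y (hP.base y) = hP.base y :=
  (hP.exists_ne y).choose_spec.2

/-- The coordinate of a section `a` over the edge `e` with respect to the chosen section has an
additive increment; it is corrected so that its exponential only depends on the values of `a` at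
the two vertices. -/
def IsLineFamily.edgeIncrement (hP : IsLineFamily P) (e : SingularSimplex Y 1)
    (a : C(stdSimplex ℝ (Fin 2), ℂ × ℂ)) : ℂ :=
  logIncrement (fun x => lineRatio (hP.lift e x) (a x)) +
    Complex.log (lineRatio (hP.base (e (stdSimplex.vertex 1))) (hP.lift e (stdSimplex.vertex 1)) /
      lineRatio (hP.base (e (stdSimplex.vertex 0))) (hP.lift e (stdSimplex.vertex 0)))

theorem IsLineFamily.exists_log_lift (hP : IsLineFamily P) {e : SingularSimplex Y 1}
    {a : C(stdSimplex ℝ (Fin 2), ℂ × ℂ)} (ha : IsLineLift P e a) :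
    ∃ l : C(stdSimplex ℝ (Fin 2), ℂ), ∀ x, Complex.exp (l x) = lineRatio (hP.lift e x) (a x) :=
  exists_continuous_log ⟨_, continuous_lineRatio (hP.lift e) a (fun x => (hP.lift_spec e x).2)⟩
    (fun x => hP.lineRatio_ne_zero (hP.lift_spec e x).2 (hP.lift_spec e x).1 (ha x).1 (ha x).2)

theorem IsLineFamily.exp_edgeIncrement (hP : IsLineFamily P) {e : SingularSimplex Y 1}
    {a : C(stdSimplex ℝ (Fin 2), ℂ × ℂ)} (ha : IsLineLift P e a) :
    Complex.exp (hP.edgeIncrement e a) =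
      lineRatio (hP.base (e (stdSimplex.vertex 1))) (a (stdSimplex.vertex 1)) /
      lineRatio (hP.base (e (stdSimplex.vertex 0))) (a (stdSimplex.vertex 0)) := by
  obtain ⟨l, hl⟩ := hP.exists_log_lift ha
  have hne : ∀ x, lineRatio (hP.base (e x)) (hP.lift e x) ≠ 0 := fun x =>
    hP.lineRatio_ne_zero (hP.base_ne _) (hP.base_spec _) (hP.lift_spec e x).1 (hP.lift_spec e x).2
  have hm : ∀ x, lineRatio (hP.base (e x)) (a x) =
      lineRatio (hP.base (e x)) (hP.lift e x) * lineRatio (hP.lift e x) (a x) := fun x =>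
    (hP.lineRatio_mul (hP.base_ne _) (hP.lift_spec e x).2 (hP.base_spec _) (hP.lift_spec e x).1
      (ha x).1).symm
  rw [edgeIncrement, logIncrement_eq l hl, Complex.exp_add, Complex.exp_sub, hl, hl,
    Complex.exp_log (div_ne_zero (hne _) (hne _)), hm, hm, div_mul_div_comm, mul_comm,
    mul_comm (lineRatio (hP.lift e _) _)]

/-- Multiplying a section by `exp m` changes the increment by that of `m`. -/
theorem IsLineFamily.edgeIncrement_mul (hP : IsLineFamily P) {e : SingularSimplex Y 1}
    {a b : C(stdSimplex ℝ (Fin 2), ℂ × ℂ)} (ha : IsLineLift P e a)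
    (m : C(stdSimplex ℝ (Fin 2), ℂ)) (hb : ∀ x, b x = Complex.exp (m x) • a x) :
    hP.edgeIncrement e b = hP.edgeIncrement e a +
      (m (stdSimplex.vertex 1) - m (stdSimplex.vertex 0)) := by
  obtain ⟨l, hl⟩ := hP.exists_log_lift ha
  have h1 : ∀ x, Complex.exp ((l + m) x) = lineRatio (hP.lift e x) (b x) := by
    intro x
    rw [ContinuousMap.add_apply, Complex.exp_add, hl, hb]
    simp only [lineRatio, Prod.smul_fst, Prod.smul_snd, smul_eq_mul]
    ring
  rw [edgeIncrement, edgeIncrement, logIncrement_eq l hl, logIncrement_eq (l + m) h1]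
  simp only [ContinuousMap.add_apply]
  ring

/-- The sum of the increments of a section along the boundary of a triangle. -/
def IsLineFamily.boundaryIncrement (hP : IsLineFamily P) (σ : SingularSimplex Y 2)
    (a : C(stdSimplex ℝ (Fin 3), ℂ × ℂ)) : ℂ :=
  ∑ i : Fin 3, (-1 : ℂ) ^ (i : ℕ) * hP.edgeIncrement (σ.comp (face 1 i)) (a.comp (face 1 i))

/-- The boundary increment does not depend on the section over the triangle: two sections differ by
a factor with a logarithm on the triangle, whose increments along the boundary cancel. -/
theorem IsLineFamily.boundaryIncrement_congr (hP : IsLineFamily P) {σ : SingularSimplex Y 2}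
    {a b : C(stdSimplex ℝ (Fin 3), ℂ × ℂ)} (ha : IsLineLift P σ a) (hb : IsLineLift P σ b) :
    hP.boundaryIncrement σ a = hP.boundaryIncrement σ b := by
  obtain ⟨l, hl⟩ := exists_continuous_log ⟨_, continuous_lineRatio a b (fun x => (ha x).2)⟩
    (fun x => hP.lineRatio_ne_zero (ha x).2 (ha x).1 (hb x).1 (hb x).2)
  have h1 : ∀ i, hP.edgeIncrement (σ.comp (face 1 i)) (b.comp (face 1 i)) =
      hP.edgeIncrement (σ.comp (face 1 i)) (a.comp (face 1 i)) +
      (l (stdSimplex.vertex (i.succAbove 1)) - l (stdSimplex.vertex (i.succAbove 0))) := by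
    intro i
    have := hP.edgeIncrement_mul (ha.comp (face 1 i)) (b := b.comp (face 1 i)) (l.comp (face 1 i))
      (fun x => by
        simp only [ContinuousMap.comp_apply, hl]
        exact hP.eq_lineRatio_smul (ha _).2 (ha _).1 (hb _).1)
    rw [this]
    simp only [ContinuousMap.comp_apply]
    rw [face_vertex 1 i 1, face_vertex 1 i 0]
  have e1 : (0 : Fin 3).succAbove (1 : Fin 2) = 2 := rfl
  have e2 : (0 : Fin 3).succAbove (0 : Fin 2) = 1 := rfl
  have e3 : (1 : Fin 3).succAbove (1 : Fin 2) = 2 := rfl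
  have e4 : (1 : Fin 3).succAbove (0 : Fin 2) = 0 := rfl
  have e5 : (2 : Fin 3).succAbove (1 : Fin 2) = 1 := rfl
  have e6 : (2 : Fin 3).succAbove (0 : Fin 2) = 0 := rfl
  simp only [boundaryIncrement, Fin.sum_univ_three, h1, e1, e2, e3, e4, e5, e6]
  simp
  ring

/-- The exponentials of the three edge increments cancel vertex by vertex. -/
theorem IsLineFamily.exists_int_boundaryIncrement (hP : IsLineFamily P) {σ : SingularSimplex Y 2}
    {a : C(stdSimplex ℝ (Fin 3), ℂ × ℂ)} (ha : IsLineLift P σ a) :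
    ∃ k : ℤ, hP.boundaryIncrement σ a = k * (2 * Real.pi * Complex.I) := by
  rw [← Complex.exp_eq_one_iff]
  have h1 := fun i => hP.exp_edgeIncrement (ha.comp (face 1 i))
  simp only [ContinuousMap.comp_apply] at h1
  have h2 : ∀ i, Complex.exp (hP.edgeIncrement (σ.comp (face 1 i)) (a.comp (face 1 i))) =
      lineRatio (hP.base (σ (stdSimplex.vertex (i.succAbove 1))))
        (a (stdSimplex.vertex (i.succAbove 1))) /
      lineRatio (hP.base (σ (stdSimplex.vertex (i.succAbove 0))))
        (a (stdSimplex.vertex (i.succAbove 0))) := by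
    intro i
    rw [h1, face_vertex 1 i 1, face_vertex 1 i 0]
  have hne : ∀ x, lineRatio (hP.base (σ x)) (a x) ≠ 0 := fun x =>
    hP.lineRatio_ne_zero (hP.base_ne _) (hP.base_spec _) (ha x).1 (ha x).2
  have e1 : (0 : Fin 3).succAbove (1 : Fin 2) = 2 := rfl
  have e2 : (0 : Fin 3).succAbove (0 : Fin 2) = 1 := rfl
  have e3 : (1 : Fin 3).succAbove (1 : Fin 2) = 2 := rfl
  have e4 : (1 : Fin 3).succAbove (0 : Fin 2) = 0 := rfl
  have e5 : (2 : Fin 3).succAbove (1 : Fin 2) = 1 := rfl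
  have e6 : (2 : Fin 3).succAbove (0 : Fin 2) = 0 := rfl
  have h3 : hP.boundaryIncrement σ a =
      hP.edgeIncrement (σ.comp (face 1 0)) (a.comp (face 1 0)) -
      hP.edgeIncrement (σ.comp (face 1 1)) (a.comp (face 1 1)) +
      hP.edgeIncrement (σ.comp (face 1 2)) (a.comp (face 1 2)) := by
    rw [boundaryIncrement, Fin.sum_univ_three]
    simp
    ring
  rw [h3, Complex.exp_add, Complex.exp_sub, h2, h2, h2, e1, e2, e3, e4, e5, e6]
  have := hne (stdSimplex.vertex 0)
  have := hne (stdSimplex.vertex 1)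
  have := hne (stdSimplex.vertex 2)
  field_simp

/-- The Euler cochain: the winding number, along the boundary of a triangle, of the chosen sections
over its edges with respect to a section over the triangle. -/
def IsLineFamily.eulerCochain (hP : IsLineFamily P) : SingularCochain Y 2 := fun σ =>
  (hP.exists_int_boundaryIncrement (hP.lift_spec σ)).choose

theorem IsLineFamily.eulerCochain_spec (hP : IsLineFamily P) {σ : SingularSimplex Y 2}
    {a : C(stdSimplex ℝ (Fin 3), ℂ × ℂ)} (ha : IsLineLift P σ a) :
    (hP.eulerCochain σ : ℂ) * (2 * Real.pi * Complex.I) = hP.boundaryIncrement σ a := by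
  rw [hP.boundaryIncrement_congr ha (hP.lift_spec σ)]
  exact (hP.exists_int_boundaryIncrement (hP.lift_spec σ)).choose_spec.symm

theorem IsLineFamily.coboundary_eulerCochain (hP : IsLineFamily P) :
    coboundary Y 2 hP.eulerCochain = 0 := by
  funext σ
  change ∑ j : Fin 4, (-1 : ℤ) ^ (j : ℕ) * hP.eulerCochain (σ.comp (face 2 j)) = 0
  have hpi : (2 * Real.pi * Complex.I : ℂ) ≠ 0 := by simp [Real.pi_ne_zero]
  have ha := hP.lift_spec σ
  set a := hP.lift σ
  -- for one section over the tetrahedron restricted to all its faces, each of the six edges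
  -- contributes twice, with opposite signs
  let J : (Fin 2 → Fin 4) → ℂ := fun g => hP.edgeIncrement
    (σ.comp ⟨stdSimplex.map g, stdSimplex.continuous_map _⟩)
    (a.comp ⟨stdSimplex.map g, stdSimplex.continuous_map _⟩)
  have h1 : ∀ j : Fin 4, (hP.eulerCochain (σ.comp (face 2 j)) : ℂ) * (2 * Real.pi * Complex.I) =
      ∑ i : Fin 3, (-1 : ℂ) ^ (i : ℕ) * J (j.succAbove ∘ i.succAbove) := by
    intro j
    rw [hP.eulerCochain_spec (ha.comp (face 2 j)), boundaryIncrement]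
    refine Finset.sum_congr rfl fun i _ => ?_
    rw [ContinuousMap.comp_assoc, ContinuousMap.comp_assoc, face_comp_face]
  have h2 : ((∑ j : Fin 4, (-1 : ℤ) ^ (j : ℕ) * hP.eulerCochain (σ.comp (face 2 j)) : ℤ) : ℂ) *
      (2 * Real.pi * Complex.I) = 0 := by
    push_cast
    rw [Finset.sum_mul, Finset.sum_congr rfl fun j _ => by rw [mul_assoc, h1 j]]
    have f1 : ((0 : Fin 4).succAbove ∘ (0 : Fin 3).succAbove : Fin 2 → Fin 4) =
      (1 : Fin 4).succAbove ∘ (0 : Fin 3).succAbove := by decide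
    have f2 : ((0 : Fin 4).succAbove ∘ (1 : Fin 3).succAbove : Fin 2 → Fin 4) =
      (2 : Fin 4).succAbove ∘ (0 : Fin 3).succAbove := by decide
    have f3 : ((0 : Fin 4).succAbove ∘ (2 : Fin 3).succAbove : Fin 2 → Fin 4) =
      (3 : Fin 4).succAbove ∘ (0 : Fin 3).succAbove := by decide
    have f4 : ((1 : Fin 4).succAbove ∘ (1 : Fin 3).succAbove : Fin 2 → Fin 4) =
      (2 : Fin 4).succAbove ∘ (1 : Fin 3).succAbove := by decide
    have f5 : ((1 : Fin 4).succAbove ∘ (2 : Fin 3).succAbove : Fin 2 → Fin 4) =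
      (3 : Fin 4).succAbove ∘ (1 : Fin 3).succAbove := by decide
    have f6 : ((2 : Fin 4).succAbove ∘ (2 : Fin 3).succAbove : Fin 2 → Fin 4) =
      (3 : Fin 4).succAbove ∘ (2 : Fin 3).succAbove := by decide
    simp only [Fin.sum_univ_four, Fin.sum_univ_three, f1, f2, f3, f4, f5, f6]
    simp
    ring
  rcases mul_eq_zero.1 h2 with h | h
  · exact_mod_cast h
  · exact absurd h hpi

/-- The Euler class in `H²(Y; ℤ)` of a family of lines. -/
def IsLineFamily.eulerClass (hP : IsLineFamily P) : H2 Y :=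
  QuotientAddGroup.mk ⟨hP.eulerCochain, hP.coboundary_eulerCochain⟩

end Euler

/-! ### Evaluation of cohomology classes on tori -/

section Torus

variable {Y : Type*} [TopologicalSpace Y]

/-- The triangle with vertices `(0, 0)`, `(1, 0)`, `(1, 1)`. -/
def lowerTriangle : C(stdSimplex ℝ (Fin 3), ℝ × ℝ) := ⟨fun x => (x 1 + x 2, x 2), by
  have h : ∀ i, Continuous fun x : stdSimplex ℝ (Fin 3) => x i := fun i =>
    (continuous_apply i).comp continuous_subtype_val
  exact ((h 1).add (h 2)).prodMk (h 2)⟩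

/-- The triangle with vertices `(0, 0)`, `(0, 1)`, `(1, 1)`. -/
def upperTriangle : C(stdSimplex ℝ (Fin 3), ℝ × ℝ) := ⟨fun x => (x 2, x 1 + x 2), by
  have h : ∀ i, Continuous fun x : stdSimplex ℝ (Fin 3) => x i := fun i =>
    (continuous_apply i).comp continuous_subtype_val
  exact (h 2).prodMk ((h 1).add (h 2))⟩

/-- The horizontal edge of height `c` of the unit square. -/
def horizontalEdge (c : ℝ) : C(stdSimplex ℝ (Fin 2), ℝ × ℝ) := ⟨fun x => (x 1, c), by
  have h : ∀ i, Continuous fun x : stdSimplex ℝ (Fin 2) => x i := fun i =>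
    (continuous_apply i).comp continuous_subtype_val
  exact (h 1).prodMk continuous_const⟩

/-- The vertical edge of abscissa `c` of the unit square. -/
def verticalEdge (c : ℝ) : C(stdSimplex ℝ (Fin 2), ℝ × ℝ) := ⟨fun x => (c, x 1), by
  have h : ∀ i, Continuous fun x : stdSimplex ℝ (Fin 2) => x i := fun i =>
    (continuous_apply i).comp continuous_subtype_val
  exact continuous_const.prodMk (h 1)⟩

theorem face_one_apply (i : Fin 3) (x : stdSimplex ℝ (Fin 2)) (k : Fin 3) :
    face 1 i x k = ∑ j : Fin 2, if i.succAbove j = k then x j else 0 := by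
  change (stdSimplex.map i.succAbove x) k = _
  rw [stdSimplex.map_coe, FunOnFinite.linearMap_apply_apply, Finset.sum_filter]

theorem lowerTriangle_faces : lowerTriangle.comp (face 1 0) = verticalEdge 1 ∧
    lowerTriangle.comp (face 1 1) = upperTriangle.comp (face 1 1) ∧
    lowerTriangle.comp (face 1 2) = horizontalEdge 0 ∧
    upperTriangle.comp (face 1 0) = horizontalEdge 1 ∧
    upperTriangle.comp (face 1 2) = verticalEdge 0 := by
  refine ⟨?_, ?_, ?_, ?_, ?_⟩ <;> ext1 x <;>
    simp [lowerTriangle, upperTriangle, verticalEdge, horizontalEdge, face_one_apply,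
      Fin.sum_univ_two, Fin.succAbove, Fin.lt_def, stdSimplex.add_eq_one]

/-- Doubly periodic maps of the plane. -/
def IsDoublyPeriodic (T : C(ℝ × ℝ, Y)) : Prop :=
  ∀ x y, T (x + 1, y) = T (x, y) ∧ T (x, y + 1) = T (x, y)

theorem IsDoublyPeriodic.edges {T : C(ℝ × ℝ, Y)} (hT : IsDoublyPeriodic T) :
    T.comp (verticalEdge 1) = T.comp (verticalEdge 0) ∧
    T.comp (horizontalEdge 1) = T.comp (horizontalEdge 0) := by
  constructor <;> ext1 x
  · simpa [verticalEdge] using (hT 0 (x 1)).1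
  · simpa [horizontalEdge] using (hT (x 1) 0).2

/-- Evaluation of classes of degree two on the cycle made of the two triangles of a torus. -/
def evalTorus (T : C(ℝ × ℝ, Y)) (hT : IsDoublyPeriodic T) : H2 Y →+ ℤ :=
  QuotientAddGroup.lift _
    (((Pi.evalAddMonoidHom (fun _ : SingularSimplex Y 2 => ℤ) (T.comp lowerTriangle)) -
      (Pi.evalAddMonoidHom (fun _ : SingularSimplex Y 2 => ℤ) (T.comp upperTriangle))).comp
      (coboundary Y 2).ker.subtype) (by
    rintro ⟨c, hc⟩ ⟨b, hb⟩
    change coboundary Y 1 b = c at hb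
    change c (T.comp lowerTriangle) - c (T.comp upperTriangle) = 0
    obtain ⟨h1, h2, h3, h4, h5⟩ := lowerTriangle_faces
    subst hb
    change (∑ i : Fin 3, (-1 : ℤ) ^ (i : ℕ) * b ((T.comp lowerTriangle).comp (face 1 i))) -
      (∑ i : Fin 3, (-1 : ℤ) ^ (i : ℕ) * b ((T.comp upperTriangle).comp (face 1 i))) = 0
    simp only [Fin.sum_univ_three, ContinuousMap.comp_assoc]
    rw [h1, h2, h3, h4, h5, hT.edges.1, hT.edges.2]
    simp
    ring)

theorem evalTorus_mk (T : C(ℝ × ℝ, Y)) (hT : IsDoublyPeriodic T) (c : (coboundary Y 2).ker) :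
    evalTorus T hT (QuotientAddGroup.mk c) = c.1 (T.comp lowerTriangle) - c.1 (T.comp upperTriangle)
    := rfl

theorem IsDoublyPeriodic.comp {Z : Type*} [TopologicalSpace Z] {T : C(ℝ × ℝ, Y)}
    (hT : IsDoublyPeriodic T) (g : C(Y, Z)) : IsDoublyPeriodic (g.comp T) := fun x y =>
  ⟨congrArg g (hT x y).1, congrArg g (hT x y).2⟩

theorem evalTorus_H2pullback {Z : Type*} [TopologicalSpace Z] (T : C(ℝ × ℝ, Y))
    (hT : IsDoublyPeriodic T) (g : C(Y, Z)) (c : H2 Z) :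
    evalTorus T hT (H2pullback g c) = evalTorus (g.comp T) (hT.comp g) c := by
  obtain ⟨c, rfl⟩ := QuotientAddGroup.mk_surjective c
  rfl

/-- The Euler number of a family of lines on a torus, from the factor of automorphy of a section
over the plane. -/
theorem IsLineFamily.evalTorus_eulerClass {P : C(Y, (ℂ × ℂ) →L[ℂ] (ℂ × ℂ))}
    (hP : IsLineFamily P) (T : C(ℝ × ℝ, Y)) (hT : IsDoublyPeriodic T) (F : C(ℝ × ℝ, ℂ × ℂ))
    (hF : IsLineLift P T F) (h1 : ∀ y, F (1, y) = F (0, y)) (m : ℝ → ℂ) (hm : Continuous m)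
    (h2 : ∀ x, F (x, 1) = Complex.exp (m x) • F (x, 0)) :
    (evalTorus T hT hP.eulerClass : ℂ) * (2 * Real.pi * Complex.I) = m 0 - m 1 := by
  obtain ⟨f1, f2, f3, f4, f5⟩ := lowerTriangle_faces
  rw [IsLineFamily.eulerClass, evalTorus_mk]
  push_cast
  rw [sub_mul, hP.eulerCochain_spec (hF.comp lowerTriangle),
    hP.eulerCochain_spec (hF.comp upperTriangle)]
  simp only [boundaryIncrement, Fin.sum_univ_three, ContinuousMap.comp_assoc]
  rw [f1, f2, f3, f4, f5, hT.edges.1, hT.edges.2]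
  have g1 : F.comp (verticalEdge 1) = F.comp (verticalEdge 0) := by
    ext1 x
    exact h1 _
  have hx1 : Continuous fun x : stdSimplex ℝ (Fin 2) => x 1 :=
    (continuous_apply (1 : Fin 2)).comp continuous_subtype_val
  have g2 := hP.edgeIncrement_mul (hF.comp (horizontalEdge 0)) (b := F.comp (horizontalEdge 1))
    ⟨fun x => m (x 1), hm.comp hx1⟩ (fun x => h2 _)
  rw [g1, g2]
  simp
  ring

end Torus

/-! ### Ergodic groups of automorphisms of tori -/

section TorusErgodic

local instance : MeasureSpace UnitAddCircle := ⟨AddCircle.haarAddCircle⟩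

local instance : IsProbabilityMeasure (volume : Measure UnitAddCircle) :=
  inferInstanceAs (IsProbabilityMeasure AddCircle.haarAddCircle)

variable {d : Type*} [Fintype d]

/-- The normalized Haar measure of the torus. -/
def torusMeasure (d : Type*) [Fintype d] : Measure (UnitAddTorus d) :=
  Measure.pi fun _ => AddCircle.haarAddCircle

instance : IsProbabilityMeasure (torusMeasure d) := by
  unfold torusMeasure; infer_instance

instance : (torusMeasure d).IsAddHaarMeasure := by
  unfold torusMeasure; infer_instance

/-- The endomorphism of a torus given by an integer matrix. -/
def torusMap (A : Matrix d d ℤ) : UnitAddTorus d →+ UnitAddTorus d where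
  toFun x := fun i => ∑ j, A i j • x j
  map_zero' := by ext i; simp
  map_add' x y := by ext i; simp [Finset.sum_add_distrib]

theorem torusMap_apply (A : Matrix d d ℤ) (x : UnitAddTorus d) (i : d) :
    torusMap A x i = ∑ j, A i j • x j := rfl

theorem continuous_torusMap (A : Matrix d d ℤ) : Continuous (torusMap A) := by
  change Continuous fun x : UnitAddTorus d => fun i => ∑ j, A i j • x j
  fun_prop

theorem torusMap_mul (A B : Matrix d d ℤ) (x : UnitAddTorus d) :
    torusMap (A * B) x = torusMap A (torusMap B x) := by
  ext i
  simp only [torusMap_apply, Matrix.mul_apply, Finset.sum_smul, Finset.smul_sum, mul_smul]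
  exact Finset.sum_comm

theorem torusMap_one [DecidableEq d] (x : UnitAddTorus d) :
    torusMap (1 : Matrix d d ℤ) x = x := by
  ext i
  simp [torusMap_apply, Matrix.one_apply]

section

variable {G : Type*} [Group G] [DecidableEq d] (ρ : G →* Matrix d d ℤ)

theorem torusMap_inv_cancel (g : G) (x : UnitAddTorus d) :
    torusMap (ρ g) (torusMap (ρ g⁻¹) x) = x := by
  rw [← torusMap_mul, ← map_mul, mul_inv_cancel, map_one, torusMap_one]

theorem measurePreserving_torusMap (g : G) :
    MeasurePreserving (torusMap (ρ g)) (torusMeasure d) (torusMeasure d) :=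
  AddMonoidHom.measurePreserving (continuous_torusMap _)
    (fun x => ⟨_, torusMap_inv_cancel ρ g x⟩) (by simp)

theorem mFourier_torusMap (A : Matrix d d ℤ) (n : d → ℤ) (x : UnitAddTorus d) :
    UnitAddTorus.mFourier n (torusMap A x) = UnitAddTorus.mFourier (Matrix.vecMul n A) x := by
  have key : ∀ (m : d → ℤ) (y : UnitAddTorus d),
      UnitAddTorus.mFourier m y = ((∑ i, m i • y i : UnitAddCircle).toCircle : ℂ) := by
    intro m y
    have h : ∀ s : Finset d, ∏ i ∈ s, (fourier (m i) (y i) : ℂ) =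
        ((∑ i ∈ s, m i • y i : UnitAddCircle).toCircle : ℂ) := by
      intro s
      classical
      induction s using Finset.induction_on with
      | empty => simp
      | insert a s ha ih =>
        rw [Finset.prod_insert ha, Finset.sum_insert ha, ih, AddCircle.toCircle_add, fourier_apply]
        rfl
    exact h Finset.univ
  rw [key, key]
  congr 2
  simp only [torusMap_apply, Finset.smul_sum, Matrix.vecMul, dotProduct, Finset.sum_smul, mul_smul]
  exact Finset.sum_comm

/-- The Fourier coefficients of an invariant function are constant along the orbits of the dual
action; they are square summable, hence vanish on infinite orbits. -/
theorem torus_ergodic (horb : ∀ n : d → ℤ, n ≠ 0 → (range fun g => Matrix.vecMul n (ρ g)).Infinite)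
    {B : Set (UnitAddTorus d)} (hB : NullMeasurableSet B (torusMeasure d))
    (hinv : ∀ g, torusMap (ρ g) ⁻¹' B =ᵐ[torusMeasure d] B) :
    torusMeasure d B = 0 ∨ torusMeasure d Bᶜ = 0 := by
  wlog hBm : MeasurableSet B generalizing B
  · obtain ⟨B', hB', hBB'⟩ := hB.exists_measurable_superset_ae_eq.imp fun _ h => h.2
    have h := this hB'.nullMeasurableSet (fun g =>
      (((measurePreserving_torusMap ρ g).quasiMeasurePreserving.preimage_ae_eq hBB').trans
        (hinv g)).trans hBB'.symm) hB'
    rwa [measure_congr hBB', measure_congr hBB'.compl] at h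
  change (volume : Measure (UnitAddTorus d)) B = 0 ∨ (volume : Measure (UnitAddTorus d)) Bᶜ = 0
  let f : Lp ℂ 2 (volume : Measure (UnitAddTorus d)) :=
    indicatorConstLp 2 hBm (measure_ne_top _ _) (1 : ℂ)
  have hf : f =ᵐ[volume] B.indicator fun _ => (1 : ℂ) := indicatorConstLp_coeFn
  have hcoef : ∀ n, UnitAddTorus.mFourierCoeff f n =
      ∫ x, UnitAddTorus.mFourier (-n) x • B.indicator (fun _ => (1 : ℂ)) x := fun n =>
    integral_congr_ae (hf.mono fun x hx => by simp only [hx])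
  have hconst : ∀ n g, UnitAddTorus.mFourierCoeff f (Matrix.vecMul n (ρ g)) =
      UnitAddTorus.mFourierCoeff f n := by
    intro n g
    rw [hcoef, hcoef]
    have hmp : MeasurePreserving (torusMap (ρ g)) (volume : Measure (UnitAddTorus d)) volume :=
      measurePreserving_torusMap ρ g
    have hsm : AEStronglyMeasurable (fun x : UnitAddTorus d => UnitAddTorus.mFourier (-n) x •
        B.indicator (fun _ => (1 : ℂ)) x) volume := by
      refine ((UnitAddTorus.mFourier (-n)).continuous.aestronglyMeasurable).smul ?_
      exact (stronglyMeasurable_const.indicator hBm).aestronglyMeasurable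
    have hmap := integral_map (μ := volume) hmp.aemeasurable
      (f := fun x : UnitAddTorus d => UnitAddTorus.mFourier (-n) x •
        B.indicator (fun _ => (1 : ℂ)) x) (by rwa [hmp.map_eq])
    rw [hmp.map_eq] at hmap
    rw [hmap]
    refine integral_congr_ae ?_
    filter_upwards [hinv g] with x hx
    have hx' : torusMap (ρ g) x ∈ B ↔ x ∈ B := iff_of_eq hx
    rw [mFourier_torusMap, Matrix.neg_vecMul]
    congr 1
    by_cases h : x ∈ B
    · rw [indicator_of_mem h, indicator_of_mem (hx'.2 h)]
    · rw [indicator_of_notMem h, indicator_of_notMem (fun h' => h (hx'.1 h'))]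
  have hzero : ∀ n, n ≠ 0 → UnitAddTorus.mFourierCoeff f n = 0 := by
    intro n hn
    by_contra hne
    have hs := (UnitAddTorus.hasSum_sq_mFourierCoeff f).summable
    have hfin := hs.tendsto_cofinite_zero.eventually
      (gt_mem_nhds (show 0 < ‖UnitAddTorus.mFourierCoeff f n‖ ^ 2 by positivity))
    rw [eventually_cofinite] at hfin
    refine horb n hn (hfin.subset ?_)
    rintro _ ⟨g, rfl⟩
    simp only [mem_ofPred_eq, hconst, lt_irrefl, not_false_eq_true]
  have hsum := UnitAddTorus.hasSum_mFourier_series_L2 f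
  have hf0 : f = UnitAddTorus.mFourierCoeff f 0 • UnitAddTorus.mFourierLp 2 0 :=
    hsum.unique (hasSum_single 0 fun n hn => by rw [hzero n hn, zero_smul])
  have hae : ∀ᵐ x ∂(volume : Measure (UnitAddTorus d)),
      B.indicator (fun _ => (1 : ℂ)) x = UnitAddTorus.mFourierCoeff f 0 := by
    have h1 := UnitAddTorus.coeFn_mFourierLp (d := d) 2 0
    have h2 := Lp.coeFn_smul (UnitAddTorus.mFourierCoeff f 0)
      (UnitAddTorus.mFourierLp (d := d) 2 0)
    rw [← hf0] at h2
    filter_upwards [hf, h1, h2] with x hx1 hx2 hx3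
    rw [← hx1, hx3, Pi.smul_apply, hx2, UnitAddTorus.mFourier_zero]
    simp
  by_cases hc : UnitAddTorus.mFourierCoeff f 0 = 1
  · right
    rw [measure_eq_zero_iff_ae_notMem]
    filter_upwards [hae] with x hx hxB
    rw [indicator_of_notMem hxB, hc] at hx
    exact zero_ne_one hx
  · left
    rw [measure_eq_zero_iff_ae_notMem]
    filter_upwards [hae] with x hx hxB
    rw [indicator_of_mem hxB] at hx
    exact hc hx.symm

/-- By ergodicity, almost every orbit meets each member of a countable basis. -/
theorem exists_dense_torus_orbit [Countable G]
    (horb : ∀ n : d → ℤ, n ≠ 0 → (range fun g => Matrix.vecMul n (ρ g)).Infinite)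
    {Z : Set (UnitAddTorus d)} (hZ : torusMeasure d Z = 0) :
    ∃ x ∉ Z, ∀ U : Set (UnitAddTorus d), IsOpen U → U.Nonempty → ∃ g, torusMap (ρ g) x ∈ U := by
  have hfull : ∀ U : Set (UnitAddTorus d), IsOpen U → U.Nonempty →
      ∀ᵐ x ∂torusMeasure d, ∃ g, torusMap (ρ g) x ∈ U := by
    intro U hU hne
    have hopen : IsOpen {x | ∃ g, torusMap (ρ g) x ∈ U} := by
      rw [ofPred_exists]
      exact isOpen_iUnion fun g => hU.preimage (continuous_torusMap _)
    have h := torus_ergodic ρ horb (B := {x | ∃ g, torusMap (ρ g) x ∈ U})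
      hopen.measurableSet.nullMeasurableSet (fun g => by
        refine Eventually.of_forall fun x => propext ⟨?_, ?_⟩
        · rintro ⟨g', hg'⟩
          refine ⟨g' * g, ?_⟩
          rwa [map_mul, torusMap_mul]
        · rintro ⟨g', hg'⟩
          refine ⟨g' * g⁻¹, ?_⟩
          rwa [map_mul, torusMap_mul, ← torusMap_mul (ρ g⁻¹), ← map_mul, inv_mul_cancel, map_one,
            torusMap_one])
    refine h.resolve_left fun h0 => ?_
    have : {x | ∃ g, torusMap (ρ g) x ∈ U}.Nonempty :=
      hne.mono fun x hx => ⟨1, by rwa [map_one, torusMap_one]⟩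
    exact (hopen.measure_pos _ this).ne' h0
  have hb := TopologicalSpace.isBasis_countableBasis (UnitAddTorus d)
  have hall : ∀ᵐ x ∂torusMeasure d, ∀ U ∈ TopologicalSpace.countableBasis (UnitAddTorus d),
      ∃ g, torusMap (ρ g) x ∈ U :=
    (ae_ball_iff (TopologicalSpace.countable_countableBasis _)).2 fun U hU =>
      hfull U (hb.isOpen hU) (TopologicalSpace.nonempty_of_mem_countableBasis hU)
  obtain ⟨x, hx, hxZ⟩ := (hall.and (measure_eq_zero_iff_ae_notMem.1 hZ)).exists
  refine ⟨x, hxZ, fun U hU ⟨y, hy⟩ => ?_⟩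
  obtain ⟨V, hV, -, hVU⟩ := hb.exists_subset_of_mem_open hy hU
  obtain ⟨g, hg⟩ := hx V hV
  exact ⟨g, hVU hg⟩

end

/-- The torus measure is computed on any unit cube. -/
theorem torusMeasure_eq_volume {B : Set (UnitAddTorus d)} (hB : MeasurableSet B) (a : d → ℝ) :
    torusMeasure d B =
      volume {x : d → ℝ |
        (∀ i, x i ∈ Ioc (a i) (a i + 1)) ∧ (fun i => (x i : UnitAddCircle)) ∈ B} := by
  have h := UnitAddTorus.lintegral_preimage (B.indicator 1) a
  rw [lintegral_indicator_one hB] at h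
  change torusMeasure d B = _ at h
  rw [h]
  have hm : Measurable fun x : d → ℝ => (fun i => (x i : UnitAddCircle) : UnitAddTorus d) :=
    measurable_pi_lambda _ fun i => AddCircle.measurable_mk'.comp (measurable_pi_apply i)
  have h2 : (fun x : d → ℝ =>
      B.indicator (1 : UnitAddTorus d → ENNReal) fun i => (x i : UnitAddCircle)) =
      ((fun x : d → ℝ => (fun i => (x i : UnitAddCircle) : UnitAddTorus d)) ⁻¹' B).indicator 1 :=
    rfl
  rw [h2, lintegral_indicator_one (hm hB), Measure.restrict_apply (hm hB)]
  congr 1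
  ext x
  exact and_comm

end TorusErgodic

/-! ### The lattice -/

section Lattice

/-- The first coordinate of a complex number in the real basis `(1, τ)`. -/
def coordX (τ z : ℂ) : ℝ := z.re - τ.re * (z.im / τ.im)

/-- The second coordinate of a complex number in the real basis `(1, τ)`. -/
def coordY (τ z : ℂ) : ℝ := z.im / τ.im

variable {τ : ℂ}

theorem continuous_coordX : Continuous (coordX τ) := by unfold coordX; fun_prop

theorem continuous_coordY : Continuous (coordY τ) := by unfold coordY; fun_prop

theorem coordX_add (z w : ℂ) : coordX τ (z + w) = coordX τ z + coordX τ w := by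
  simp [coordX]; ring

theorem coordY_add (z w : ℂ) : coordY τ (z + w) = coordY τ z + coordY τ w := by
  simp [coordY]; ring

theorem coordX_neg (z : ℂ) : coordX τ (-z) = -coordX τ z := by
  simp [coordX]; ring

theorem coordY_neg (z : ℂ) : coordY τ (-z) = -coordY τ z := by
  simp [coordY]; ring

theorem coord_spec (hτ : τ.im ≠ 0) (z : ℂ) : z = coordX τ z + coordY τ z * τ := by
  apply Complex.ext <;> simp [coordX, coordY] <;> field_simp
  ring

theorem coordX_basis (hτ : τ.im ≠ 0) (x y : ℝ) : coordX τ (x + y * τ) = x := by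
  simp [coordX]; field_simp; ring

theorem coordY_basis (hτ : τ.im ≠ 0) (x y : ℝ) : coordY τ (x + y * τ) = y := by
  simp [coordY]; field_simp

theorem mem_lattice_iff {z : ℂ} : z ∈ lattice τ ↔ ∃ m n : ℤ, z = m + n * τ := by
  rw [lattice, AddSubgroup.mem_closure_pair]
  simp [eq_comm]

theorem mem_lattice_iff_coord (hτ : τ.im ≠ 0) {z : ℂ} :
    z ∈ lattice τ ↔ (∃ m : ℤ, coordX τ z = m) ∧ ∃ n : ℤ, coordY τ z = n := by
  rw [mem_lattice_iff]
  constructor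
  · rintro ⟨m, n, rfl⟩
    exact ⟨⟨m, by exact_mod_cast coordX_basis hτ m n⟩, ⟨n, by exact_mod_cast coordY_basis hτ m n⟩⟩
  · rintro ⟨⟨m, hm⟩, ⟨n, hn⟩⟩
    refine ⟨m, n, ?_⟩
    conv_lhs => rw [coord_spec hτ z, hm, hn]
    simp

theorem mem_latticeSq_iff {z : ℂ × ℂ} : z ∈ latticeSq τ ↔ z.1 ∈ lattice τ ∧ z.2 ∈ lattice τ :=
  AddSubgroup.mem_prod

theorem mem_halfLattice_iff {z : ℂ × ℂ} : z ∈ halfLattice τ ↔ z + z ∈ latticeSq τ := Iff.rfl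

theorem isClosed_lattice (hτ : τ.im ≠ 0) : IsClosed (lattice τ : Set ℂ) := by
  have h : (lattice τ : Set ℂ) = (coordX τ ⁻¹' range ((↑) : ℤ → ℝ)) ∩
      (coordY τ ⁻¹' range ((↑) : ℤ → ℝ)) := by
    ext z
    simp [mem_lattice_iff_coord hτ, eq_comm]
  rw [h]
  exact (Int.isClosedEmbedding_coe_real.isClosed_range.preimage continuous_coordX).inter
    (Int.isClosedEmbedding_coe_real.isClosed_range.preimage continuous_coordY)

theorem isClosed_latticeSq (hτ : τ.im ≠ 0) : IsClosed (latticeSq τ : Set (ℂ × ℂ)) := by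
  rw [latticeSq, AddSubgroup.coe_prod]
  exact (isClosed_lattice hτ).prod (isClosed_lattice hτ)

theorem isClosed_halfLattice (hτ : τ.im ≠ 0) : IsClosed (halfLattice τ) :=
  (isClosed_latticeSq hτ).preimage (f := fun p : ℂ × ℂ => p + p) (by fun_prop)

theorem countable_latticeSq : (latticeSq τ : Set (ℂ × ℂ)).Countable := by
  have h : (lattice τ : Set ℂ).Countable := by
    refine (countable_range fun p : ℤ × ℤ => (p.1 + p.2 * τ : ℂ)).mono ?_
    intro z hz
    obtain ⟨m, n, rfl⟩ := mem_lattice_iff.1 hz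
    exact ⟨(m, n), rfl⟩
  rw [latticeSq, AddSubgroup.coe_prod]
  exact h.prod h

theorem add_self_injective : Function.Injective fun p : ℂ × ℂ => p + p := by
  intro p p' h
  have h1 := congrArg Prod.fst h
  have h2 := congrArg Prod.snd h
  simp only [← two_mul] at h1
  simp only [← two_mul] at h2
  exact Prod.ext (mul_left_cancel₀ two_ne_zero h1) (mul_left_cancel₀ two_ne_zero h2)

theorem countable_halfLattice : (halfLattice τ).Countable :=
  countable_latticeSq.preimage add_self_injective

/-- Lattice points are isolated from each other. -/
theorem exists_latticeSq_separation (hτ : τ.im ≠ 0) :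
    ∃ δ > 0, ∀ l ∈ latticeSq τ, ‖l‖ < δ → l = 0 := by
  have h0 : ∀ᶠ z : ℂ in 𝓝 0, |coordX τ z| < 1 ∧ |coordY τ z| < 1 := by
    have h1 : Tendsto (fun z => |coordX τ z|) (𝓝 0) (𝓝 |coordX τ 0|) :=
      (continuous_coordX.abs).tendsto 0
    have h2 : Tendsto (fun z => |coordY τ z|) (𝓝 0) (𝓝 |coordY τ 0|) :=
      (continuous_coordY.abs).tendsto 0
    rw [show |coordX τ 0| = 0 by simp [coordX]] at h1
    rw [show |coordY τ 0| = 0 by simp [coordY]] at h2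
    exact (h1.eventually_lt_const one_pos).and (h2.eventually_lt_const one_pos)
  obtain ⟨δ, hδ, h⟩ := Metric.eventually_nhds_iff.1 h0
  have key : ∀ z ∈ lattice τ, ‖z‖ < δ → z = 0 := by
    intro z hz hzδ
    obtain ⟨⟨m, hm⟩, ⟨n, hn⟩⟩ := (mem_lattice_iff_coord hτ).1 hz
    obtain ⟨h1, h2⟩ := h (y := z) (by simpa using hzδ)
    rw [hm] at h1
    rw [hn] at h2
    have hm0 : m = 0 := by exact_mod_cast Int.abs_lt_one_iff.1 (by exact_mod_cast h1)
    have hn0 : n = 0 := by exact_mod_cast Int.abs_lt_one_iff.1 (by exact_mod_cast h2)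
    rw [coord_spec hτ z, hm, hn, hm0, hn0]
    simp
  refine ⟨δ, hδ, fun l hl hlδ => ?_⟩
  obtain ⟨h1, h2⟩ := mem_latticeSq_iff.1 hl
  exact Prod.ext (key _ h1 ((norm_fst_le l).trans_lt hlδ)) (key _ h2 ((norm_snd_le l).trans_lt hlδ))

theorem unit_smul_mem_latticeSq (ε : ℤˣ) {z : ℂ × ℂ} :
    (ε : ℤ) • z ∈ latticeSq τ ↔ z ∈ latticeSq τ := by
  rcases Int.units_eq_one_or ε with rfl | rfl <;> simp

theorem unit_smul_add_mem_halfLattice (ε : ℤˣ) {z l : ℂ × ℂ} (hl : l ∈ latticeSq τ) :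
    (ε : ℤ) • z + l ∈ halfLattice τ ↔ z ∈ halfLattice τ := by
  rw [mem_halfLattice_iff, mem_halfLattice_iff,
    show (ε : ℤ) • z + l + ((ε : ℤ) • z + l) = (ε : ℤ) • (z + z) + (l + l) by
      rw [smul_add]; abel, AddSubgroup.add_mem_cancel_right _ (add_mem hl hl),
    unit_smul_mem_latticeSq]

end Lattice

/-! ### Surfaces uniformized by the plane -/

/-- The common features of the projections of `ℂ²` onto the abelian surface and, away from the
centres of the blow-up, onto the Kummer surface: `q` is a local isomorphism off the set `N` of
centres, and its fibres are the orbits of `Λ² ⋊ E`. -/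
structure Uniformized (τ : ℂ) {Y : Type*} [TopologicalSpace Y] [HolomorphicGerms Y]
    (N : Set (ℂ × ℂ)) (E : Set ℤˣ) (q : ℂ × ℂ → Y) : Prop where
  im_ne : τ.im ≠ 0
  cases : (N = ∅ ∧ E = {1}) ∨ (N = halfLattice τ ∧ E = univ)
  continuousOn : ContinuousOn q Nᶜ
  isOpen_image : ∀ U, IsOpen U → U ⊆ Nᶜ → IsOpen (q '' U)
  eq_iff : ∀ z z', z ∉ N → z' ∉ N →
    (q z = q z' ↔ ∃ ε ∈ E, ∃ l ∈ latticeSq τ, z' = (ε : ℤ) • z + l)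
  holAt_iff : ∀ z, z ∉ N → ∀ f, HolomorphicGerms.HolAt f (q z) ↔
    AnalyticAt ℂ (fun w => f (q w)) z
  dense : Dense (q '' Nᶜ)

/-- A parametrization compatible with holomorphic functions gives a holomorphic chart. -/
theorem exists_holChart {Y : Type*} [TopologicalSpace Y] [HolomorphicGerms Y]
    (ψ : ℂ × ℂ → Y) {V : Set (ℂ × ℂ)} (hV : IsOpen V) (hc : ContinuousOn ψ V)
    (ho : ∀ U ⊆ V, IsOpen U → IsOpen (ψ '' U)) (hi : InjOn ψ V)
    (hh : ∀ w ∈ V, ∀ f, HolomorphicGerms.HolAt f (ψ w) ↔ AnalyticAt ℂ (fun w => f (ψ w)) w) :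
    ∃ φ : OpenPartialHomeomorph Y (ℂ × ℂ), IsHolChart φ ∧ φ.target = V ∧ φ.source = ψ '' V ∧
      (∀ w ∈ V, φ.symm w = ψ w) ∧ ∀ w ∈ V, φ (ψ w) = w := by
  let e : PartialEquiv (ℂ × ℂ) Y := hi.toPartialEquiv
  let Φ : OpenPartialHomeomorph (ℂ × ℂ) Y := OpenPartialHomeomorph.ofContinuousOpenRestrict e hc
    (by
      intro U hU
      have h1 : V.domRestrict ψ '' U = ψ '' (Subtype.val '' U) := by
        rw [image_image]; rfl
      change IsOpen (V.domRestrict ψ '' U)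
      rw [h1]
      exact ho _ (by rintro _ ⟨x, -, rfl⟩; exact x.2) (hV.isOpenMap_subtype_val _ hU)) hV
  refine ⟨Φ.symm, ?_, rfl, rfl, fun w _ => rfl, fun w hw => Φ.left_inv hw⟩
  intro x hx f
  obtain ⟨w, hw, rfl⟩ : x ∈ ψ '' V := hx
  have h2 : Φ.symm (ψ w) = w := Φ.left_inv hw
  rw [h2, hh w hw]
  rfl

namespace Uniformized

variable {τ : ℂ} {Y : Type*} [TopologicalSpace Y] [HolomorphicGerms Y]
  {N : Set (ℂ × ℂ)} {E : Set ℤˣ} {q : ℂ × ℂ → Y}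

theorem subset_halfLattice (hq : Uniformized τ N E q) : N ⊆ halfLattice τ := by
  rcases hq.cases with h | h <;> simp [h.1]

theorem isClosed (hq : Uniformized τ N E q) : IsClosed N := by
  rcases hq.cases with h | h
  · simp [h.1]
  · rw [h.1]; exact isClosed_halfLattice hq.im_ne

theorem one_mem (hq : Uniformized τ N E q) : (1 : ℤˣ) ∈ E := by
  rcases hq.cases with h | h <;> simp [h.2]

theorem add_mem_iff (hq : Uniformized τ N E q) {z l : ℂ × ℂ} (hl : l ∈ latticeSq τ) :
    z + l ∈ N ↔ z ∈ N := by
  rcases hq.cases with h | h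
  · simp [h.1]
  · rw [h.1]; simpa using unit_smul_add_mem_halfLattice 1 hl

theorem apply_add (hq : Uniformized τ N E q) {z l : ℂ × ℂ} (hz : z ∉ N) (hl : l ∈ latticeSq τ) :
    q (z + l) = q z :=
  ((hq.eq_iff z (z + l) hz (fun h => hz ((hq.add_mem_iff hl).1 h))).2
    ⟨1, hq.one_mem, l, hl, by simp⟩).symm

theorem continuousAt (hq : Uniformized τ N E q) {z : ℂ × ℂ} (hz : z ∉ N) : ContinuousAt q z :=
  hq.continuousOn.continuousAt (hq.isClosed.isOpen_compl.mem_nhds hz)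

theorem exists_injOn_ball (hq : Uniformized τ N E q) {z : ℂ × ℂ} (hz : z ∉ N) :
    ∃ r > 0, ball z r ⊆ Nᶜ ∧ InjOn q (ball z r) := by
  obtain ⟨δ, hδ, hsep⟩ := exists_latticeSq_separation hq.im_ne
  obtain ⟨r₁, hr₁, hsub₁⟩ := Metric.isOpen_iff.1 hq.isClosed.isOpen_compl z hz
  -- near a point which is not fixed up to translation, `w` and `-w'` are not congruent
  obtain ⟨r₂, hr₂, hsub₂⟩ : ∃ r > 0, -1 ∈ E → ∀ w ∈ ball z r, ∀ w' ∈ ball z r,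
      w + w' ∉ latticeSq τ := by
    by_cases hE : (-1 : ℤˣ) ∈ E
    · have hN : N = halfLattice τ := by
        rcases hq.cases with h | h
        · rw [h.2] at hE
          exact absurd hE (by decide)
        · exact h.1
      have h1 : z + z ∉ latticeSq τ := by rw [hN] at hz; exact hz
      have h2 : ∀ᶠ p : (ℂ × ℂ) × (ℂ × ℂ) in 𝓝 (z, z), p.1 + p.2 ∉ latticeSq τ :=
        (continuous_add.tendsto (z, z)).eventually
          ((isClosed_latticeSq hq.im_ne).isOpen_compl.mem_nhds h1)
      rw [nhds_prod_eq, Filter.eventually_prod_self_iff (r := fun a b => a + b ∉ latticeSq τ)] at h2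
      obtain ⟨t, ht, h3⟩ := h2
      obtain ⟨r, hr, hrt⟩ := Metric.mem_nhds_iff.1 ht
      exact ⟨r, hr, fun _ w hw w' hw' => h3 w (hrt hw) w' (hrt hw')⟩
    · exact ⟨1, one_pos, fun h => absurd h hE⟩
  refine ⟨min (min r₁ r₂) (δ / 2), by positivity, ?_, ?_⟩
  · exact (ball_subset_ball ((min_le_left _ _).trans (min_le_left _ _))).trans hsub₁
  · intro w hw w' hw' hww
    have hb : ball z (min (min r₁ r₂) (δ / 2)) ⊆ ball z r₁ :=
      ball_subset_ball ((min_le_left _ _).trans (min_le_left _ _))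
    have hb2 : ball z (min (min r₁ r₂) (δ / 2)) ⊆ ball z r₂ :=
      ball_subset_ball ((min_le_left _ _).trans (min_le_right _ _))
    have hb3 : ball z (min (min r₁ r₂) (δ / 2)) ⊆ ball z (δ / 2) :=
      ball_subset_ball (min_le_right _ _)
    obtain ⟨ε, hε, l, hl, h⟩ := (hq.eq_iff w w' (hsub₁ (hb hw)) (hsub₁ (hb hw'))).1 hww
    rcases Int.units_eq_one_or ε with rfl | rfl
    · have : l = 0 := by
        refine hsep l hl ?_
        have h1 := mem_ball.1 (hb3 hw)
        have h2 := mem_ball.1 (hb3 hw')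
        have h3 : l = w' - w := by rw [h]; simp
        rw [h3, ← dist_eq_norm]
        calc dist w' w ≤ dist w' z + dist w z := dist_triangle_right _ _ _
          _ < δ := by linarith
      rw [h, this]; simp
    · exfalso
      refine hsub₂ hε w (hb2 hw) w' (hb2 hw') ?_
      rw [h]
      simpa using hl

/-- **Rigidity**: an antiholomorphic map that is the identity on the image of the real plane
`τℝ²` is induced by `z ↦ (τ / τ̄) z̄`, by the identity theorem; hence the latter preserves the
lattice. -/
theorem conj_smul_mem_latticeSq (hq : Uniformized τ N E q) [T2Space Y] {s : Y → Y}
    (hs : IsAntiHolMap s)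
    (hfix : ∀ x y : ℝ, ((τ * x, τ * y) : ℂ × ℂ) ∉ N → s (q (τ * x, τ * y)) = q (τ * x, τ * y))
    {l : ℂ × ℂ} (hl : l ∈ latticeSq τ) :
    (τ / (starRingEnd ℂ) τ) • conj2 l ∈ latticeSq τ := by
  have hτ0 : τ ≠ 0 := by rintro rfl; exact hq.im_ne rfl
  have hτ1 : (starRingEnd ℂ) τ ≠ 0 := by simpa using hτ0
  set u : ℂ := τ / (starRingEnd ℂ) τ with hu
  have hu0 : u ≠ 0 := div_ne_zero hτ0 hτ1
  have huu : u * (starRingEnd ℂ) u = 1 := by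
    rw [hu, map_div₀, Complex.conj_conj]; field_simp
  let R : ℂ × ℂ → ℂ × ℂ := fun z => u • conj2 z
  have hRc : Continuous R := continuous_conj2.const_smul u
  have hR : ∀ z, R (R z) = z := by
    intro z
    have h1 : ∀ a : ℂ, u * ((starRingEnd ℂ) u * a) = a := fun a => by
      rw [← mul_assoc, huu, one_mul]
    apply Prod.ext <;> simp [R, conj2, h1]
  have hRinj : Function.Injective R := (Function.LeftInverse.injective hR)
  have hRadd : ∀ z w, R (z + w) = R z + R w := by
    intro z w
    apply Prod.ext <;> simp [R, conj2, mul_add]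
  have hRτ : ∀ x y : ℝ, R (τ * x, τ * y) = (τ * x, τ * y) := by
    intro x y
    apply Prod.ext <;> simp [R, conj2, hu] <;> field_simp
  let bad : Set (ℂ × ℂ) := halfLattice τ ∪ R ⁻¹' halfLattice τ
  have hbad : bad.Countable := countable_halfLattice.union (countable_halfLattice.preimage hRinj)
  have hbadN : ∀ z, z ∉ bad → z ∉ N ∧ R z ∉ N := fun z hz =>
    ⟨fun h => hz (Or.inl (hq.subset_halfLattice h)),
      fun h => hz (Or.inr (hq.subset_halfLattice h))⟩
  have hW : IsPreconnected badᶜ := by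
    refine (hbad.isPathConnected_compl_of_one_lt_rank ?_).isConnected.isPreconnected
    rw [← Module.finrank_eq_rank, Module.finrank_prod, Complex.finrank_real_complex]
    norm_num
  let O : Set (ℂ × ℂ) := {z | ∀ᶠ w in 𝓝 z, s (q w) = q (R w)}
  have hO : IsOpen O := isOpen_setOfPred_eventually_nhds
  -- agreement near a point of agreement is the vanishing of an analytic map
  have hlocal : ∀ z, z ∉ bad → s (q z) = q (R z) → ∃ g : ℂ × ℂ → ℂ × ℂ, AnalyticAt ℂ g z ∧
      ∀ᶠ w in 𝓝 z, s (q w) = q (R w) ↔ g w = 0 := by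
    intro z hz hzs
    obtain ⟨hzN, hRN⟩ := hbadN z hz
    obtain ⟨r, hr, hrN, hinj⟩ := hq.exists_injOn_ball hRN
    let inv : Y → ℂ × ℂ := Function.invFunOn q (ball (R z) r)
    have hinv : ∀ w ∈ ball (R z) r, inv (q w) = w := fun w hw => hinj.leftInvOn_invFunOn hw
    have hana : ∀ p : (ℂ × ℂ) →L[ℂ] ℂ,
        AnalyticAt ℂ (fun w => (starRingEnd ℂ) (p (inv (s (q w))))) z := by
      intro p
      have h1 : HolomorphicGerms.HolAt (fun y => p (inv y)) (q (R z)) := by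
        rw [hq.holAt_iff _ hRN]
        refine (p.analyticAt (R z)).congr ?_
        filter_upwards [ball_mem_nhds (R z) hr] with w hw
        rw [hinv w hw]
      rw [← hzs] at h1
      exact (hq.holAt_iff z hzN _).1 (hs.2 _ _ h1)
    let g : ℂ × ℂ → ℂ × ℂ := fun w =>
      ((starRingEnd ℂ) (inv (s (q w))).1 - (starRingEnd ℂ) u * w.1,
        (starRingEnd ℂ) (inv (s (q w))).2 - (starRingEnd ℂ) u * w.2)
    refine ⟨g, ?_, ?_⟩
    · exact ((hana (ContinuousLinearMap.fst ℂ ℂ ℂ)).sub (analyticAt_const.mul analyticAt_fst)).prod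
        ((hana (ContinuousLinearMap.snd ℂ ℂ ℂ)).sub (analyticAt_const.mul analyticAt_snd))
    · have h1 : ∀ᶠ w in 𝓝 z, s (q w) ∈ q '' ball (R z) r := by
        have hc : ContinuousAt (fun w => s (q w)) z := hs.1.continuousAt.comp (hq.continuousAt hzN)
        refine hc.eventually ((hq.isOpen_image _ isOpen_ball hrN).mem_nhds ?_)
        change s (q z) ∈ _
        rw [hzs]
        exact ⟨_, mem_ball_self hr, rfl⟩
      have h2 : ∀ᶠ w in 𝓝 z, R w ∈ ball (R z) r :=
        hRc.continuousAt.eventually (ball_mem_nhds _ hr)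
      filter_upwards [h1, h2] with w ⟨p, hp, hpw⟩ hw2
      have h3 : g w = 0 ↔ p = R w := by
        have h4 : inv (s (q w)) = p := by rw [← hpw, hinv p hp]
        have h5 : ∀ a b : ℂ, (starRingEnd ℂ) a - (starRingEnd ℂ) u * b = 0 ↔
            a = u * (starRingEnd ℂ) b := by
          intro a b
          rw [sub_eq_zero]
          constructor
          · intro h
            rw [← Complex.conj_conj a, h, map_mul, Complex.conj_conj]
          · rintro rfl
            rw [map_mul, Complex.conj_conj]
        simp only [g, h4, Prod.ext_iff, R, conj2, Prod.smul_fst, Prod.smul_snd, smul_eq_mul,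
          Prod.fst_zero, Prod.snd_zero, h5]
      rw [h3, ← hpw]
      constructor
      · intro h
        exact hinj hp hw2 h
      · rintro rfl
        rfl
  have hne : (badᶜ ∩ O).Nonempty := by
    -- a real point off the bad set
    obtain ⟨x, hx⟩ : ∃ x : ℝ, ((τ * x, τ * x) : ℂ × ℂ) ∉ bad := by
      have hinj : Function.Injective fun x : ℝ => ((τ * x, τ * x) : ℂ × ℂ) := by
        intro x y h
        have := congrArg Prod.fst h
        simpa [hτ0] using this
      by_contra! hall
      exact Cardinal.not_countable_real ((hbad.preimage hinj).mono fun x _ => hall x)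
    refine ⟨_, hx, ?_⟩
    have hxN := (hbadN _ hx).1
    obtain ⟨g, hg, hev⟩ := hlocal _ hx (by rw [hRτ]; exact hfix x x hxN)
    have hsc : AnalyticAt ℂ (fun w : ℂ × ℂ => τ • w) ((x : ℂ), (x : ℂ)) :=
      (τ • ContinuousLinearMap.id ℂ (ℂ × ℂ)).analyticAt _
    have hg' : AnalyticAt ℂ (fun w : ℂ × ℂ => g (τ • w)) ((x : ℂ), (x : ℂ)) :=
      AnalyticAt.fun_comp (f := fun w : ℂ × ℂ => τ • w) hg hsc
    have hev' : ∀ᶠ w : ℂ × ℂ in 𝓝 ((x : ℂ), (x : ℂ)), (s (q (τ • w)) = q (R (τ • w)) ↔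
        g (τ • w) = 0) ∧ τ • w ∉ N :=
      (hsc.continuousAt.eventually (hev.and (hq.isClosed.isOpen_compl.mem_nhds hxN)))
    obtain ⟨r, hr, hball⟩ := nhds_basis_ball.mem_iff.1 (hg'.eventually_analyticAt.and hev')
    rw [← ball_prod_same] at hball
    have hreal : ∀ a b : ℝ, (a : ℂ) ∈ ball (x : ℂ) r → (b : ℂ) ∈ ball (x : ℂ) r →
        g (τ • ((a : ℂ), (b : ℂ))) = 0 := by
      intro a b ha hb
      obtain ⟨-, h1, h2⟩ := hball (mk_mem_prod ha hb)
      rw [← h1]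
      rw [show τ • ((a : ℂ), (b : ℂ)) = (τ * a, τ * b) from rfl] at h2 ⊢
      rw [hRτ]
      exact hfix a b h2
    have hzero : ∀ w ∈ ball (x : ℂ) r ×ˢ ball (x : ℂ) r, g (τ • w) = 0 := by
      intro w hw
      refine Prod.ext ?_ ?_
      · exact eqOn_zero_of_real (f := fun w => (g (τ • w)).1) hr
          (fun w hw => AnalyticAt.fun_comp (g := Prod.fst) analyticAt_fst (hball hw).1)
          (fun a b ha hb => by simp only [hreal a b ha hb, Prod.fst_zero]) w hw
      · exact eqOn_zero_of_real (f := fun w => (g (τ • w)).2) hr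
          (fun w hw => AnalyticAt.fun_comp (g := Prod.snd) analyticAt_snd (hball hw).1)
          (fun a b ha hb => by simp only [hreal a b ha hb, Prod.snd_zero]) w hw
    have hcont : Tendsto (fun z : ℂ × ℂ => τ⁻¹ • z) (𝓝 (τ * x, τ * x)) (𝓝 ((x : ℂ), (x : ℂ))) := by
      have h1 : Tendsto (fun z : ℂ × ℂ => τ⁻¹ • z) (𝓝 (τ * x, τ * x))
        (𝓝 (τ⁻¹ • ((τ * x, τ * x) : ℂ × ℂ))) := (continuous_const_smul τ⁻¹).tendsto _
      have h2 : τ⁻¹ • ((τ * x, τ * x) : ℂ × ℂ) = ((x : ℂ), (x : ℂ)) := by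
        apply Prod.ext <;> simp [hτ0]
      rwa [h2] at h1
    change ∀ᶠ w in 𝓝 ((τ * x, τ * x) : ℂ × ℂ), s (q w) = q (R w)
    filter_upwards [hev, hcont.eventually
      (prod_mem_nhds (ball_mem_nhds (x : ℂ) hr) (ball_mem_nhds (x : ℂ) hr))] with w h1 h2
    rw [h1]
    have := hzero _ h2
    rwa [smul_inv_smul₀ hτ0] at this
  have hclosed : closure O ∩ badᶜ ⊆ O := by
    rintro z ⟨hzO, hz⟩
    obtain ⟨hzN, hRN⟩ := hbadN z hz
    have hagree : s (q z) = q (R z) := by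
      have h1 : Tendsto (fun w => s (q w)) (𝓝[O] z) (𝓝 (s (q z))) :=
        (hs.1.continuousAt.comp (hq.continuousAt hzN)).continuousWithinAt
      have h2 : Tendsto (fun w => q (R w)) (𝓝[O] z) (𝓝 (q (R z))) :=
        (ContinuousAt.comp (f := R) (hq.continuousAt hRN) hRc.continuousAt).continuousWithinAt
      have : (𝓝[O] z).NeBot := mem_closure_iff_nhdsWithin_neBot.1 hzO
      refine tendsto_nhds_unique (h1.congr' ?_) h2
      filter_upwards [self_mem_nhdsWithin] with w hw using hw.self_of_nhds
    obtain ⟨g, hg, hev⟩ := hlocal z hz hagree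
    obtain ⟨r, hr, hball⟩ := nhds_basis_ball.mem_iff.1 (hg.eventually_analyticAt.and hev)
    obtain ⟨z', hz'O, hz'⟩ := mem_closure_iff_nhds.1 hzO _ (ball_mem_nhds z hr) |>.imp
      fun _ h => And.symm h
    have hz'0 : g =ᶠ[𝓝 z'] 0 := by
      have h1 : ∀ᶠ w in 𝓝 z', w ∈ ball z r := isOpen_ball.mem_nhds hz'
      have h2 : ∀ᶠ w in 𝓝 z', s (q w) = q (R w) := hz'O
      filter_upwards [h1, h2] with w h3 h4
      exact (hball h3).2.1 h4
    have hzero := AnalyticOnNhd.eqOn_zero_of_preconnected_of_eventuallyEq_zero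
      (fun w hw => (hball hw).1) (convex_ball z r).isPreconnected hz' hz'0
    change ∀ᶠ w in 𝓝 z, s (q w) = q (R w)
    filter_upwards [ball_mem_nhds z hr] with w hw
    exact (hball hw).2.2 (hzero hw)
  have hWO : badᶜ ⊆ O := hW.subset_of_closure_inter_subset hO hne hclosed
  have hall : ∀ z, z ∉ bad → s (q z) = q (R z) := fun z hz => (hWO hz).self_of_nhds
  -- compare at `z` and `z + l`, for a generic `z`
  have hbad2 : (bad ∪ (fun z => z + l) ⁻¹' bad ∪
      (fun z => R z + R z + R l) ⁻¹' (latticeSq τ : Set (ℂ × ℂ))).Countable := by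
    refine (hbad.union (hbad.preimage (add_left_injective l))).union
      (countable_latticeSq.preimage fun z w h => ?_)
    exact hRinj (add_self_injective (add_right_cancel h))
  obtain ⟨z, hz⟩ : ∃ z, z ∉ (bad ∪ (fun z => z + l) ⁻¹' bad ∪
      (fun z => R z + R z + R l) ⁻¹' (latticeSq τ : Set (ℂ × ℂ))) :=
    (hbad2.dense_compl ℝ).nonempty
  simp only [mem_union, not_or, mem_preimage] at hz
  obtain ⟨⟨hz1, hz2⟩, hz3⟩ := hz
  have h1 : q (R z) = q (R (z + l)) := by
    rw [← hall _ hz1, ← hall _ hz2, hq.apply_add (hbadN z hz1).1 hl]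
  obtain ⟨ε, -, l', hl', h2⟩ := (hq.eq_iff _ _ (hbadN z hz1).2 (hbadN _ hz2).2).1 h1
  rw [hRadd] at h2
  rcases Int.units_eq_one_or ε with rfl | rfl
  · have : R l = l' := by simpa using h2
    change R l ∈ latticeSq τ
    rwa [this]
  · exfalso
    apply hz3
    have : R z + R z + R l = l' := by
      rw [add_assoc, h2]; simp
    rw [this]
    exact hl'

end Uniformized

/-! ### The action of `SL₂(ℤ)` on the plane and on tori -/

/-- The group `SL₂(ℤ)`. -/
abbrev SL2Z : Type := Matrix.SpecialLinearGroup (Fin 2) ℤ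

instance : Countable SL2Z :=
  haveI : Countable (Matrix (Fin 2) (Fin 2) ℤ) := inferInstanceAs (Countable (Fin 2 → Fin 2 → ℤ))
  inferInstanceAs (Countable {A : Matrix (Fin 2) (Fin 2) ℤ // A.det = 1})

/-- The linear action of `SL₂(ℤ)` on `ℂ²`. -/
def slFun (g : SL2Z) (z : ℂ × ℂ) : ℂ × ℂ :=
  (g 0 0 * z.1 + g 0 1 * z.2, g 1 0 * z.1 + g 1 1 * z.2)

theorem slFun_mul (g h : SL2Z) (z : ℂ × ℂ) : slFun (g * h) z = slFun g (slFun h z) := by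
  apply Prod.ext <;> simp [slFun, Matrix.mul_apply, Fin.sum_univ_two] <;> ring

@[simp] theorem slFun_one (z : ℂ × ℂ) : slFun 1 z = z := by
  apply Prod.ext <;> simp [slFun]

@[simp] theorem slFun_inv_slFun (g : SL2Z) (z : ℂ × ℂ) : slFun g⁻¹ (slFun g z) = z := by
  rw [← slFun_mul]; simp

@[simp] theorem slFun_slFun_inv (g : SL2Z) (z : ℂ × ℂ) : slFun g (slFun g⁻¹ z) = z := by
  rw [← slFun_mul]; simp

theorem slFun_add (g : SL2Z) (z w : ℂ × ℂ) : slFun g (z + w) = slFun g z + slFun g w := by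
  apply Prod.ext <;> simp [slFun] <;> ring

theorem slFun_smul (g : SL2Z) (c : ℂ) (z : ℂ × ℂ) : slFun g (c • z) = c • slFun g z := by
  apply Prod.ext <;> simp [slFun] <;> ring

/-- The linear automorphism of `ℂ²` given by an element of `SL₂(ℤ)`. -/
def slEquiv (g : SL2Z) : (ℂ × ℂ) ≃L[ℂ] (ℂ × ℂ) :=
  LinearEquiv.toContinuousLinearEquiv
    { toFun := slFun g
      invFun := slFun g⁻¹
      map_add' := slFun_add g
      map_smul' := slFun_smul g
      left_inv := slFun_inv_slFun g
      right_inv := slFun_slFun_inv g }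

@[simp] theorem slEquiv_apply (g : SL2Z) (z : ℂ × ℂ) : slEquiv g z = slFun g z := rfl

theorem slFun_mem_latticeSq {τ : ℂ} (g : SL2Z) {z : ℂ × ℂ} :
    slFun g z ∈ latticeSq τ ↔ z ∈ latticeSq τ := by
  have key : ∀ (g : SL2Z) (z : ℂ × ℂ), z ∈ latticeSq τ → slFun g z ∈ latticeSq τ := by
    intro g z hz
    obtain ⟨h1, h2⟩ := mem_latticeSq_iff.1 hz
    refine mem_latticeSq_iff.2 ⟨?_, ?_⟩
    · simpa [slFun] using add_mem (zsmul_mem h1 (g 0 0)) (zsmul_mem h2 (g 0 1))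
    · simpa [slFun] using add_mem (zsmul_mem h1 (g 1 0)) (zsmul_mem h2 (g 1 1))
  exact ⟨fun h => by simpa using key g⁻¹ _ h, key g z⟩

theorem slFun_mem_halfLattice {τ : ℂ} (g : SL2Z) {z : ℂ × ℂ} :
    slFun g z ∈ halfLattice τ ↔ z ∈ halfLattice τ := by
  rw [mem_halfLattice_iff, mem_halfLattice_iff, ← slFun_add, slFun_mem_latticeSq]

/-- Upper unipotent matrices. -/
def upperShear (k : ℤ) : SL2Z := ⟨!![1, k; 0, 1], by simp [Matrix.det_fin_two]⟩

/-- Lower unipotent matrices. -/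
def lowerShear (k : ℤ) : SL2Z := ⟨!![1, 0; k, 1], by simp [Matrix.det_fin_two]⟩

/-- The projection of a real vector space onto the torus. -/
def torusMk {d : Type*} (p : d → ℝ) : UnitAddTorus d := fun i => (p i : UnitAddCircle)

theorem isOpenQuotientMap_torusMk {d : Type*} :
    IsOpenQuotientMap (torusMk : (d → ℝ) → UnitAddTorus d) :=
  IsOpenQuotientMap.piMap (fun _ => QuotientAddGroup.isOpenQuotientMap_mk)

theorem torusMk_eq_iff {d : Type*} {p p' : d → ℝ} :
    torusMk p = torusMk p' ↔ ∀ i, ∃ n : ℤ, p' i = p i + n := by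
  rw [funext_iff]
  refine forall_congr' fun i => ?_
  change ((p i : ℝ) : UnitAddCircle) = (p' i : ℝ) ↔ _
  rw [QuotientAddGroup.eq, AddSubgroup.mem_zmultiples_iff]
  refine exists_congr fun n => ?_
  rw [zsmul_one]
  constructor
  · intro h; linarith
  · intro h; linarith

theorem torusMap_torusMk {d : Type*} [Fintype d] (A : Matrix d d ℤ) (p : d → ℝ) :
    torusMap A (torusMk p) = torusMk fun i => ∑ j, (A i j : ℝ) * p j := by
  funext i
  rw [torusMap_apply]
  change ∑ j, A i j • ((p j : ℝ) : UnitAddCircle) = ((∑ j, (A i j : ℝ) * p j : ℝ) : UnitAddCircle)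
  have h : ∀ s : Finset d, ((∑ j ∈ s, (A i j : ℝ) * p j : ℝ) : UnitAddCircle) =
      ∑ j ∈ s, A i j • ((p j : ℝ) : UnitAddCircle) := by
    intro s
    classical
    induction s using Finset.induction_on with
    | empty => simp
    | insert a s ha ih =>
      rw [Finset.sum_insert ha, Finset.sum_insert ha, AddCircle.coe_add, ih, ← zsmul_eq_mul,
        AddCircle.coe_zsmul]
  exact (h _).symm

/-- The points of order two of a torus. -/
def torusTwoTorsion (d : Type*) : Set (UnitAddTorus d) := {x | x + x = 0}

theorem isClosed_torusTwoTorsion (d : Type*) : IsClosed (torusTwoTorsion d) :=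
  isClosed_eq (by fun_prop) continuous_const

theorem torusMk_mem_twoTorsion {d : Type*} {p : d → ℝ} :
    torusMk p ∈ torusTwoTorsion d ↔ ∀ i, ∃ n : ℤ, p i + p i = n := by
  have h1 : torusMk p + torusMk p = torusMk (p + p) := rfl
  have h2 : (0 : UnitAddTorus d) = torusMk 0 := rfl
  change torusMk p + torusMk p = 0 ↔ _
  rw [h1, h2, eq_comm, torusMk_eq_iff]
  simp

theorem torusMeasure_twoTorsion (d : Type*) [Fintype d] [Nonempty d] :
    torusMeasure d (torusTwoTorsion d) = 0 := by
  rw [torusMeasure_eq_volume (isClosed_torusTwoTorsion d).measurableSet 0]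
  refine measure_mono_null (t := {p : d → ℝ | torusMk p ∈ torusTwoTorsion d}) (fun p hp => hp.2) ?_
  have hc : {p : d → ℝ | torusMk p ∈ torusTwoTorsion d}.Countable := by
    refine (countable_range fun (n : d → ℤ) (i : d) => (n i : ℝ) / 2).mono ?_
    intro p hp
    choose n hn using torusMk_mem_twoTorsion.1 hp
    refine ⟨n, funext fun i => ?_⟩
    have := hn i
    simp only
    linarith
  exact hc.measure_zero volume

/-- Real tori in the plane on which `SL₂(ℤ)` acts by integer matrices with infinite dual orbits:
`pt` is a parametrization by `ℝᵈ` that sends points congruent modulo `ℤᵈ` to points congruent modulo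
`Λ²`, in which `g` acts by the matrix `ρ g`, and only the two-torsion of `(ℝ/ℤ)ᵈ` is sent to the
half lattice. -/
structure TorusParam (τ : ℂ) {d : Type*} [Fintype d] [DecidableEq d] (ρ : SL2Z →* Matrix d d ℤ)
    (pt : (d → ℝ) → ℂ × ℂ) : Prop where
  continuous : Continuous pt
  half : ∀ p, pt p ∈ halfLattice τ → torusMk p ∈ torusTwoTorsion d
  sub_mem : ∀ p p', torusMk p = torusMk p' → pt p' - pt p ∈ latticeSq τ
  equiv : ∀ g p, slFun g (pt p) = pt fun i => ∑ j, (ρ g i j : ℝ) * p j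
  orbit : ∀ n : d → ℤ, n ≠ 0 → (range fun g => Matrix.vecMul n (ρ g)).Infinite

/-- The standard action of `SL₂(ℤ)` on the two-dimensional torus. -/
def rhoTwo : SL2Z →* Matrix (Fin 2) (Fin 2) ℤ where
  toFun g := g.1
  map_one' := rfl
  map_mul' _ _ := rfl

open Kronecker in
/-- The diagonal action of `SL₂(ℤ)` on two copies of the two-dimensional torus. -/
def rhoFour : SL2Z →* Matrix (Fin 2 × Fin 2) (Fin 2 × Fin 2) ℤ where
  toFun g := g.1 ⊗ₖ (1 : Matrix (Fin 2) (Fin 2) ℤ)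
  map_one' := Matrix.one_kronecker_one
  map_mul' g h := by
    rw [← Matrix.mul_kronecker_mul, one_mul]
    rfl

theorem measurePreserving_neg_torusMeasure :
    MeasurePreserving (fun x => -x) (torusMeasure (Fin 2)) (torusMeasure (Fin 2)) := by
  have h := measurePreserving_torusMap rhoTwo (-1)
  have h2 : ⇑(torusMap (rhoTwo (-1))) = fun x => -x := by
    funext x i
    rw [torusMap_apply]
    fin_cases i <;> simp [rhoTwo, Fin.sum_univ_two]
  rwa [h2] at h

/-- The point `τ p` of the plane. -/
def tauPoint (τ : ℂ) (p : Fin 2 → ℝ) : ℂ × ℂ := (τ * p 0, τ * p 1)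

/-- The point of the plane with given coordinates in the basis `(1, τ)`. -/
def basisPoint (τ : ℂ) (p : Fin 2 × Fin 2 → ℝ) : ℂ × ℂ :=
  (p (0, 0) + p (0, 1) * τ, p (1, 0) + p (1, 1) * τ)

theorem torusParam_tauPoint {τ : ℂ} (hτ : τ.im ≠ 0) : TorusParam τ rhoTwo (tauPoint τ) where
  continuous := by unfold tauPoint; fun_prop
  half p hp := by
    rw [torusMk_mem_twoTorsion]
    have h := mem_latticeSq_iff.1 hp
    have key : ∀ a : ℝ, τ * a + τ * a ∈ lattice τ → ∃ n : ℤ, a + a = n := by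
      intro a ha
      obtain ⟨n, hn⟩ := ((mem_lattice_iff_coord hτ).1 ha).2
      refine ⟨n, ?_⟩
      rw [← hn, show τ * a + τ * a = ((0 : ℝ) : ℂ) + ((a + a : ℝ) : ℂ) * τ by push_cast; ring,
        coordY_basis hτ]
    intro i
    fin_cases i
    · exact key _ h.1
    · exact key _ h.2
  sub_mem p p' h := by
    rw [torusMk_eq_iff] at h
    obtain ⟨m, hm⟩ := h 0
    obtain ⟨n, hn⟩ := h 1
    refine mem_latticeSq_iff.2 ⟨mem_lattice_iff.2 ⟨0, m, ?_⟩, mem_lattice_iff.2 ⟨0, n, ?_⟩⟩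
    · simp [tauPoint, hm]; ring
    · simp [tauPoint, hn]; ring
  equiv g p := by
    apply Prod.ext <;> simp [slFun, tauPoint, rhoTwo, Fin.sum_univ_two] <;> ring
  orbit n hn := by
    by_cases h0 : n 0 = 0
    · have h1 : n 1 ≠ 0 := fun h1 => hn (funext fun i => by fin_cases i <;> assumption)
      refine infinite_of_injective_forall_mem (f := fun k : ℤ =>
        Matrix.vecMul n (rhoTwo (lowerShear k))) (fun k k' h => ?_) (fun k => ⟨_, rfl⟩)
      have := congrFun h 0
      simpa [rhoTwo, lowerShear, Matrix.vecMul, dotProduct, Fin.sum_univ_two, h1] using this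
    · refine infinite_of_injective_forall_mem (f := fun k : ℤ =>
        Matrix.vecMul n (rhoTwo (upperShear k))) (fun k k' h => ?_) (fun k => ⟨_, rfl⟩)
      have := congrFun h 1
      simpa [rhoTwo, upperShear, Matrix.vecMul, dotProduct, Fin.sum_univ_two, h0] using this

theorem torusParam_basisPoint {τ : ℂ} (hτ : τ.im ≠ 0) : TorusParam τ rhoFour (basisPoint τ) where
  continuous := by unfold basisPoint; fun_prop
  half p hp := by
    rw [torusMk_mem_twoTorsion]
    have h := mem_latticeSq_iff.1 hp
    have key : ∀ a b : ℝ, (a + b * τ : ℂ) + (a + b * τ) ∈ lattice τ →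
        (∃ n : ℤ, a + a = n) ∧ ∃ n : ℤ, b + b = n := by
      intro a b hab
      obtain ⟨⟨m, hm⟩, n, hn⟩ := (mem_lattice_iff_coord hτ).1 hab
      rw [show (a + b * τ : ℂ) + (a + b * τ) = ((a + a : ℝ) : ℂ) + ((b + b : ℝ) : ℂ) * τ by
        push_cast; ring] at hm hn
      rw [coordX_basis hτ] at hm
      rw [coordY_basis hτ] at hn
      exact ⟨⟨m, hm⟩, n, hn⟩
    rintro ⟨i, k⟩
    fin_cases i <;> fin_cases k
    · exact (key _ _ h.1).1
    · exact (key _ _ h.1).2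
    · exact (key _ _ h.2).1
    · exact (key _ _ h.2).2
  sub_mem p p' h := by
    rw [torusMk_eq_iff] at h
    choose n hn using h
    refine mem_latticeSq_iff.2 ⟨mem_lattice_iff.2 ⟨n (0, 0), n (0, 1), ?_⟩,
      mem_lattice_iff.2 ⟨n (1, 0), n (1, 1), ?_⟩⟩
    · simp [basisPoint, hn]; ring
    · simp [basisPoint, hn]; ring
  equiv g p := by
    apply Prod.ext <;> simp [slFun, basisPoint, rhoFour, Fin.sum_univ_two, Fintype.sum_prod_type,
      Matrix.kroneckerMap_apply, Matrix.one_apply] <;> ring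
  orbit n hn := by
    obtain ⟨⟨i, k⟩, hik⟩ := Function.ne_iff.1 hn
    have hik' : n (i, k) ≠ 0 := hik
    by_cases hi : i = 1
    · subst hi
      refine infinite_of_injective_forall_mem (f := fun m : ℤ =>
        Matrix.vecMul n (rhoFour (lowerShear m))) (fun m m' h => ?_) (fun m => ⟨_, rfl⟩)
      have := congrFun h (0, k)
      simpa [rhoFour, lowerShear, Matrix.vecMul, dotProduct, Fin.sum_univ_two,
        Fintype.sum_prod_type, Matrix.kroneckerMap_apply, Matrix.one_apply, hik'] using this
    · obtain rfl : i = 0 := by omega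
      refine infinite_of_injective_forall_mem (f := fun m : ℤ =>
        Matrix.vecMul n (rhoFour (upperShear m))) (fun m m' h => ?_) (fun m => ⟨_, rfl⟩)
      have := congrFun h (1, k)
      simpa [rhoFour, upperShear, Matrix.vecMul, dotProduct, Fin.sum_univ_two,
        Fintype.sum_prod_type, Matrix.kroneckerMap_apply, Matrix.one_apply, hik'] using this

theorem basisPoint_surjective {τ : ℂ} (hτ : τ.im ≠ 0) : Function.Surjective (basisPoint τ) := by
  intro z
  refine ⟨fun i => if i.2 = 0 then coordX τ (if i.1 = 0 then z.1 else z.2) else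
    coordY τ (if i.1 = 0 then z.1 else z.2), ?_⟩
  apply Prod.ext <;> simp [basisPoint, ← coord_spec hτ]

/-! ### Ergodic measures on uniformized surfaces -/

namespace Uniformized

variable {τ : ℂ} {Y : Type*} [TopologicalSpace Y] [HolomorphicGerms Y]
  {N : Set (ℂ × ℂ)} {E : Set ℤˣ} {q : ℂ × ℂ → Y}

theorem slFun_mem_iff (hq : Uniformized τ N E q) (g : SL2Z) {z : ℂ × ℂ} :
    slFun g z ∈ N ↔ z ∈ N := by
  rcases hq.cases with h | h
  · simp [h.1]
  · rw [h.1, slFun_mem_halfLattice]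

end Uniformized

open scoped Classical in
/-- The map from a torus to `Y` induced by `q` (with an arbitrary value at the points of order
two). -/
def torusToSurface {d Y : Type*} (q : ℂ × ℂ → Y) (pt : (d → ℝ) → ℂ × ℂ) : UnitAddTorus d → Y :=
  fun x => if x ∈ torusTwoTorsion d then q 0 else q (pt fun i => (x i).out)

section TorusToSurface

variable {τ : ℂ} {Y : Type*} [TopologicalSpace Y] [HolomorphicGerms Y]
  {N : Set (ℂ × ℂ)} {E : Set ℤˣ} {q : ℂ × ℂ → Y} {d : Type*} [Fintype d] [DecidableEq d]
  {ρ : SL2Z →* Matrix d d ℤ} {pt : (d → ℝ) → ℂ × ℂ}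

theorem TorusParam.notMem (hq : Uniformized τ N E q) (hp : TorusParam τ ρ pt) {p : d → ℝ}
    (h : torusMk p ∉ torusTwoTorsion d) : pt p ∉ N :=
  fun h' => h (hp.half p (hq.subset_halfLattice h'))

theorem torusToSurface_torusMk (hq : Uniformized τ N E q) (hp : TorusParam τ ρ pt) {p : d → ℝ}
    (h : torusMk p ∉ torusTwoTorsion d) : torusToSurface q pt (torusMk p) = q (pt p) := by
  rw [torusToSurface, if_neg h]
  have h1 : torusMk (fun i => (torusMk p i).out) = torusMk p :=
    funext fun i => QuotientAddGroup.out_eq' _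
  have h2 := hp.sub_mem _ _ h1.symm
  rw [← hq.apply_add (hp.notMem hq h) h2, add_sub_cancel]

theorem continuousOn_torusToSurface (hq : Uniformized τ N E q) (hp : TorusParam τ ρ pt) :
    ContinuousOn (torusToSurface q pt) (torusTwoTorsion d)ᶜ := by
  rw [isOpenQuotientMap_torusMk.isQuotientMap.continuousOn_isOpen_iff
    (isClosed_torusTwoTorsion d).isOpen_compl]
  have h1 : ContinuousOn (q ∘ pt) (torusMk ⁻¹' (torusTwoTorsion d)ᶜ) :=
    hq.continuousOn.comp hp.continuous.continuousOn (fun p h => hp.notMem hq h)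
  exact h1.congr fun p h => torusToSurface_torusMk hq hp h

theorem measurable_torusToSurface [MeasurableSpace Y] [BorelSpace Y] (hq : Uniformized τ N E q)
    (hp : TorusParam τ ρ pt) : Measurable (torusToSurface q pt) := by
  classical
  have h1 : torusToSurface q pt = (torusTwoTorsion d).piecewise (fun _ => q 0)
      (torusToSurface q pt) := by
    funext x
    by_cases hx : x ∈ torusTwoTorsion d
    · rw [piecewise_eq_of_mem _ _ _ hx, torusToSurface, if_pos hx]
    · rw [piecewise_eq_of_notMem _ _ _ hx]
  rw [h1]
  exact ContinuousOn.measurable_piecewise continuousOn_const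
    (continuousOn_torusToSurface hq hp) (isClosed_torusTwoTorsion d).measurableSet

theorem torusMap_mem_twoTorsion_iff (g : SL2Z) {x : UnitAddTorus d} :
    torusMap (ρ g) x ∈ torusTwoTorsion d ↔ x ∈ torusTwoTorsion d := by
  have key : ∀ g x, x ∈ torusTwoTorsion d → torusMap (ρ g) x ∈ torusTwoTorsion d := by
    intro g x hx
    change torusMap (ρ g) x + torusMap (ρ g) x = 0
    rw [← map_add, show x + x = 0 from hx, map_zero]
  refine ⟨fun h => ?_, key g x⟩
  have := key g⁻¹ _ h
  rwa [← torusMap_mul, ← map_mul, inv_mul_cancel, map_one, torusMap_one] at this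

theorem torusToSurface_torusMap (hq : Uniformized τ N E q) (hp : TorusParam τ ρ pt)
    {act : SL2Z →* (Y ≃ₜ Y)} (hact : ∀ g z, z ∉ N → act g (q z) = q (slFun g z)) (g : SL2Z)
    {x : UnitAddTorus d} (hx : x ∉ torusTwoTorsion d) :
    torusToSurface q pt (torusMap (ρ g) x) = act g (torusToSurface q pt x) := by
  obtain ⟨p, rfl⟩ := isOpenQuotientMap_torusMk.surjective x
  have h1 : torusMap (ρ g) (torusMk p) ∉ torusTwoTorsion d :=
    fun h => hx ((torusMap_mem_twoTorsion_iff g).1 h)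
  rw [torusToSurface_torusMk hq hp hx, hact g _ (hp.notMem hq hx), hp.equiv]
  rw [torusMap_torusMk] at h1 ⊢
  exact torusToSurface_torusMk hq hp h1

/-- A nonempty open condition on the surface has a nonempty open preimage in the torus. -/
theorem exists_open_torus_preimage [Nonempty d] (hq : Uniformized τ N E q)
    (hp : TorusParam τ ρ pt) {U : Set Y} (hU : IsOpen U) {p : d → ℝ} (hpN : pt p ∉ N)
    (hpU : q (pt p) ∈ U) : ∃ O : Set (UnitAddTorus d), IsOpen O ∧ O.Nonempty ∧
      ∀ x ∈ O, x ∉ torusTwoTorsion d ∧ torusToSurface q pt x ∈ U := by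
  have h1 : IsOpen (Nᶜ ∩ q ⁻¹' U) :=
    hq.continuousOn.isOpen_inter_preimage hq.isClosed.isOpen_compl hU
  have h2 : IsOpen (torusMk '' (pt ⁻¹' (Nᶜ ∩ q ⁻¹' U))) :=
    isOpenQuotientMap_torusMk.isOpenMap _ (h1.preimage hp.continuous)
  refine ⟨torusMk '' (pt ⁻¹' (Nᶜ ∩ q ⁻¹' U)) ∩ (torusTwoTorsion d)ᶜ,
    h2.inter (isClosed_torusTwoTorsion d).isOpen_compl, ?_, ?_⟩
  · by_contra hempty
    have h3 : torusMk '' (pt ⁻¹' (Nᶜ ∩ q ⁻¹' U)) ⊆ torusTwoTorsion d := fun x hx => by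
      by_contra hx'
      exact hempty ⟨x, hx, hx'⟩
    exact (h2.measure_pos (torusMeasure d) ⟨_, p, ⟨hpN, hpU⟩, rfl⟩).ne'
      (measure_mono_null h3 (torusMeasure_twoTorsion d))
  · rintro _ ⟨⟨p', hp', rfl⟩, hx⟩
    exact ⟨hx, by rw [torusToSurface_torusMk hq hp hx]; exact hp'.2⟩

/-- Some orbit is dense in the closure of the image of the torus. -/
theorem exists_dense_orbit [Nonempty d] (hq : Uniformized τ N E q) (hp : TorusParam τ ρ pt)
    {act : SL2Z →* (Y ≃ₜ Y)} (hact : ∀ g z, z ∉ N → act g (q z) = q (slFun g z)) :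
    ∃ p, pt p ∉ N ∧
      closure (q '' (range pt \ N)) ⊆ closure {y | ∃ g ∈ act.range, g (q (pt p)) = y} := by
  obtain ⟨x, hx, hdense⟩ := exists_dense_torus_orbit ρ hp.orbit (torusMeasure_twoTorsion d)
  obtain ⟨p, rfl⟩ := isOpenQuotientMap_torusMk.surjective x
  refine ⟨p, hp.notMem hq hx, closure_minimal ?_ isClosed_closure⟩
  rintro _ ⟨_, ⟨⟨p', rfl⟩, hp'⟩, rfl⟩
  rw [_root_.mem_closure_iff]
  intro U hU hpU
  obtain ⟨O, hO, hOne, hOU⟩ := exists_open_torus_preimage hq hp hU hp' hpU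
  obtain ⟨g, hg⟩ := hdense O hO hOne
  refine ⟨_, (hOU _ hg).2, act g, ⟨g, rfl⟩, ?_⟩
  rw [torusToSurface_torusMap hq hp hact g hx, torusToSurface_torusMk hq hp hx]

end TorusToSurface

/-- The closed surface `S` is the closure of the image of `τℝ²` and does not contain other points
off the centres. -/
structure IsRealImage (τ : ℂ) {Y : Type*} [TopologicalSpace Y] (N : Set (ℂ × ℂ)) (q : ℂ × ℂ → Y)
    (S : Set Y) : Prop where
  eq_closure : S = closure (q '' (range (tauPoint τ) \ N))
  coord_int : ∀ z, z ∉ N → q z ∈ S → (∃ m : ℤ, coordX τ z.1 = m) ∧ ∃ n : ℤ, coordX τ z.2 = n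

theorem IsRealImage.isClosed {τ : ℂ} {Y : Type*} [TopologicalSpace Y]
    {N : Set (ℂ × ℂ)} {q : ℂ × ℂ → Y} {S : Set Y} (hS : IsRealImage τ N q S) : IsClosed S := by
  rw [hS.eq_closure]; exact isClosed_closure

theorem IsRealImage.mem {τ : ℂ} {Y : Type*} [TopologicalSpace Y]
    {N : Set (ℂ × ℂ)} {q : ℂ × ℂ → Y} {S : Set Y} (hS : IsRealImage τ N q S)
    {p : Fin 2 → ℝ} (hp : tauPoint τ p ∉ N) : q (tauPoint τ p) ∈ S := by
  rw [hS.eq_closure]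
  exact subset_closure ⟨_, ⟨⟨p, rfl⟩, hp⟩, rfl⟩

section Measure

variable {τ : ℂ} {Y : Type*} [TopologicalSpace Y] [HolomorphicGerms Y] [MeasurableSpace Y]
  {N : Set (ℂ × ℂ)} {E : Set ℤˣ} {q : ℂ × ℂ → Y} {S : Set Y}

/-- The image of the Haar measure of the torus `ℝ² / ℤ²` on the image of `τℝ²`. -/
def surfaceMeasure (τ : ℂ) {Y : Type*} [MeasurableSpace Y] (q : ℂ × ℂ → Y) : Measure Y :=
  (torusMeasure (Fin 2)).map (torusToSurface q (tauPoint τ))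

variable [BorelSpace Y]

theorem surfaceMeasure_apply (hq : Uniformized τ N E q) {B : Set Y} (hB : MeasurableSet B) :
    surfaceMeasure τ q B = torusMeasure (Fin 2) (torusToSurface q (tauPoint τ) ⁻¹' B) :=
  Measure.map_apply (measurable_torusToSurface hq (torusParam_tauPoint hq.im_ne)) hB

theorem isProbabilityMeasure_surfaceMeasure (hq : Uniformized τ N E q) :
    IsProbabilityMeasure (surfaceMeasure τ q) :=
  Measure.isProbabilityMeasure_map
    (measurable_torusToSurface hq (torusParam_tauPoint hq.im_ne)).aemeasurable

/-- The measure charges nonempty open subsets of `S`, since Haar measure charges nonempty open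
subsets of the torus. -/
theorem support_surfaceMeasure (hq : Uniformized τ N E q) (hS : IsRealImage τ N q S) :
    (surfaceMeasure τ q).support = S := by
  have hp := torusParam_tauPoint hq.im_ne
  refine Subset.antisymm (Measure.support_subset_of_isClosed hS.isClosed ?_) ?_
  · rw [mem_ae_iff, surfaceMeasure_apply hq hS.isClosed.measurableSet.compl]
    refine measure_mono_null ?_ (torusMeasure_twoTorsion (Fin 2))
    intro x hx
    by_contra hx2
    obtain ⟨p, rfl⟩ := isOpenQuotientMap_torusMk.surjective x
    rw [mem_preimage, torusToSurface_torusMk hq hp hx2] at hx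
    exact hx (hS.mem (hp.notMem hq hx2))
  · intro y hy
    rw [Measure.mem_support_iff_forall]
    intro U hU
    obtain ⟨V, hVU, hV, hyV⟩ := mem_nhds_iff.1 hU
    rw [hS.eq_closure] at hy
    obtain ⟨_, hzV, _, ⟨⟨p, rfl⟩, hpN⟩, rfl⟩ := _root_.mem_closure_iff.1 hy V hV hyV
    obtain ⟨O, hO, hOne, hOV⟩ := exists_open_torus_preimage hq hp hV hpN hzV
    refine lt_of_lt_of_le (hO.measure_pos (torusMeasure (Fin 2)) hOne) ?_
    calc torusMeasure (Fin 2) O ≤ torusMeasure (Fin 2) (torusToSurface q (tauPoint τ) ⁻¹' V) :=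
          measure_mono fun x hx => (hOV x hx).2
      _ = surfaceMeasure τ q V := (surfaceMeasure_apply hq hV.measurableSet).symm
      _ ≤ surfaceMeasure τ q U := measure_mono hVU

theorem map_surfaceMeasure (hq : Uniformized τ N E q)
    {act : SL2Z →* (Y ≃ₜ Y)} (hact : ∀ g z, z ∉ N → act g (q z) = q (slFun g z)) (g : SL2Z) :
    (surfaceMeasure τ q).map (act g) = surfaceMeasure τ q := by
  have hp := torusParam_tauPoint hq.im_ne
  have hm := measurable_torusToSurface hq hp
  have hmp := measurePreserving_torusMap rhoTwo g
  rw [surfaceMeasure, Measure.map_map (act g).continuous.measurable hm]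
  conv_rhs => rw [← hmp.map_eq, Measure.map_map hm hmp.measurable]
  refine Measure.map_congr ?_
  filter_upwards [measure_eq_zero_iff_ae_notMem.1 (torusMeasure_twoTorsion (Fin 2))] with x hx
  exact (torusToSurface_torusMap hq hp hact g hx).symm

/-- Ergodicity passes from the torus to its image. -/
theorem ergodic_surfaceMeasure (hq : Uniformized τ N E q)
    {act : SL2Z →* (Y ≃ₜ Y)} (hact : ∀ g z, z ∉ N → act g (q z) = q (slFun g z)) {B : Set Y}
    (hB : MeasurableSet B) (hinv : ∀ g ∈ act.range, g ⁻¹' B =ᵐ[surfaceMeasure τ q] B) :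
    surfaceMeasure τ q B = 0 ∨ surfaceMeasure τ q Bᶜ = 0 := by
  have hp := torusParam_tauPoint hq.im_ne
  have hm := measurable_torusToSurface hq hp
  rw [surfaceMeasure_apply hq hB, surfaceMeasure_apply hq hB.compl]
  refine torus_ergodic rhoTwo hp.orbit (hm hB).nullMeasurableSet fun g => ?_
  have h1 : ∀ᵐ y ∂surfaceMeasure τ q, (act g y ∈ B) = (y ∈ B) := hinv (act g) ⟨g, rfl⟩
  have h2 := ae_of_ae_map hm.aemeasurable h1
  filter_upwards [h2, measure_eq_zero_iff_ae_notMem.1 (torusMeasure_twoTorsion (Fin 2))]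
    with x h3 hx
  change (torusToSurface q (tauPoint τ) (torusMap (rhoTwo g) x) ∈ B) = _
  rw [torusToSurface_torusMap hq hp hact g hx]
  exact h3

/-- The measure of a set covered by a small real piece, as an area in the plane. -/
theorem surfaceMeasure_eq_volume (hq : Uniformized τ N E q) {V : Set (Fin 2 → ℝ)} (hV : IsOpen V)
    {a : Fin 2 → ℝ} (hVa : ∀ p ∈ V, ∀ i, p i ∈ Ioc (a i) (a i + 1))
    (hVN : ∀ p ∈ V, tauPoint τ p ∉ N) (hinj : InjOn (fun p => q (tauPoint τ p)) V) {B : Set Y}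
    (hB : MeasurableSet B)
    (hcov : ∀ p, tauPoint τ p ∉ N → q (tauPoint τ p) ∈ B →
      ∃ p' ∈ V, q (tauPoint τ p') = q (tauPoint τ p)) :
    surfaceMeasure τ q B = (E.ncard : ENNReal) * volume {p | p ∈ V ∧ q (tauPoint τ p) ∈ B} := by
  have hp := torusParam_tauPoint hq.im_ne
  have hm := measurable_torusToSurface hq hp
  set μ := torusMeasure (Fin 2)
  set θ := torusToSurface q (tauPoint τ) with hθdef
  set Z := torusTwoTorsion (Fin 2)
  have hθmk : ∀ p, torusMk p ∉ Z → θ (torusMk p) = q (tauPoint τ p) := fun p h =>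
    torusToSurface_torusMk hq hp h
  have hZ : ∀ᵐ x ∂μ, x ∉ Z := measure_eq_zero_iff_ae_notMem.1 (torusMeasure_twoTorsion (Fin 2))
  let A : Set (UnitAddTorus (Fin 2)) := torusMk '' V
  have hA : IsOpen A := isOpenQuotientMap_torusMk.isOpenMap _ hV
  have hZvol : volume {p : Fin 2 → ℝ | (∀ i, p i ∈ Ioc (a i) (a i + 1)) ∧ torusMk p ∈ Z} = 0 := by
    have := torusMeasure_eq_volume (isClosed_torusTwoTorsion (Fin 2)).measurableSet a
    rw [torusMeasure_twoTorsion] at this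
    exact this.symm
  -- the part of the preimage of `B` lying in the piece itself
  have hplus : μ (A ∩ θ ⁻¹' B) = volume {p | p ∈ V ∧ q (tauPoint τ p) ∈ B} := by
    rw [torusMeasure_eq_volume (hA.measurableSet.inter (hm hB)) a]
    refine measure_congr ?_
    filter_upwards [measure_eq_zero_iff_ae_notMem.1 hZvol] with p hpZ
    refine propext ⟨?_, ?_⟩
    · rintro ⟨hpa, ⟨p', hp', hpp'⟩, hpB⟩
      have hpZ' : torusMk p ∉ Z := fun h => hpZ ⟨hpa, h⟩
      have : p' = p := by
        funext i
        obtain ⟨n, hn⟩ := torusMk_eq_iff.1 hpp' i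
        have h1 := hVa p' hp' i
        have h2 := hpa i
        have h3 : (-1 : ℝ) < n := by linarith [h1.2, h2.1]
        have h4 : (n : ℝ) < 1 := by linarith [h1.1, h2.2]
        have h5 : -1 < n := by exact_mod_cast h3
        have h6 : n < 1 := by exact_mod_cast h4
        have h7 : n = 0 := by omega
        rw [hn, h7]; simp
      subst this
      refine ⟨hp', ?_⟩
      change θ (torusMk p') ∈ B at hpB
      rwa [hθmk _ hpZ'] at hpB
    · rintro ⟨hpV, hpB⟩
      have hpZ' : torusMk p ∉ Z := fun h => hpZ ⟨hVa p hpV, h⟩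
      refine ⟨hVa p hpV, ⟨p, hpV, rfl⟩, ?_⟩
      change θ (torusMk p) ∈ B
      rwa [hθmk _ hpZ']
  rw [surfaceMeasure_apply hq hB, ← hplus]
  have hrep : ∀ x ∉ Z, x ∈ θ ⁻¹' B → ∃ ε ∈ E, (ε : ℤ) • x ∈ A := by
    intro x hx hxB
    obtain ⟨p, rfl⟩ := isOpenQuotientMap_torusMk.surjective x
    rw [mem_preimage, hθmk _ hx] at hxB
    obtain ⟨p', hp', hqq⟩ := hcov p (hp.notMem hq hx) hxB
    obtain ⟨ε, hε, l, hl, h⟩ := (hq.eq_iff _ _ (hp.notMem hq hx) (hVN p' hp')).1 hqq.symm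
    refine ⟨ε, hε, p', hp', ?_⟩
    have h1 : tauPoint τ p' - (ε : ℤ) • tauPoint τ p ∈ latticeSq τ := by
      rw [h, add_sub_cancel_left]; exact hl
    have h2 : tauPoint τ p' - (ε : ℤ) • tauPoint τ p = tauPoint τ (p' - (ε : ℤ) • p) := by
      apply Prod.ext <;> simp [tauPoint] <;> ring
    rw [h2] at h1
    have h3 : torusMk ((ε : ℤ) • p) = torusMk p' := by
      rw [torusMk_eq_iff]
      have key : ∀ b : ℝ, τ * b ∈ lattice τ → ∃ n : ℤ, b = n := by
        intro b hb
        obtain ⟨n, hn⟩ := ((mem_lattice_iff_coord hq.im_ne).1 hb).2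
        refine ⟨n, ?_⟩
        rw [← hn, show τ * b = ((0 : ℝ) : ℂ) + (b : ℂ) * τ by push_cast; ring,
          coordY_basis hq.im_ne]
      obtain ⟨h4, h5⟩ := mem_latticeSq_iff.1 h1
      intro i
      have h6 : ∃ n : ℤ, (p' - (ε : ℤ) • p) i = n := by
        fin_cases i
        · exact key _ h4
        · exact key _ h5
      obtain ⟨n, hn⟩ := h6
      exact ⟨n, by rw [← hn]; simp⟩
    rw [← h3]
    rfl
  -- up to a null set the preimage of `B` is its part in the piece, together with the negative of
  -- that part if `E = {±1}`
  rcases hq.cases with ⟨-, hE⟩ | ⟨hN, hE⟩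
  · rw [hE, ncard_singleton, Nat.cast_one, one_mul]
    refine measure_congr ?_
    filter_upwards [hZ] with x hx
    refine propext ⟨fun hxB => ⟨?_, hxB⟩, fun h => h.2⟩
    obtain ⟨ε, hε, h⟩ := hrep x hx hxB
    rw [hE] at hε
    rw [mem_singleton_iff.1 hε] at h
    simpa using h
  · have hθ : ∀ x ∉ Z, θ (-x) = θ x := by
      intro x hx
      obtain ⟨p, rfl⟩ := isOpenQuotientMap_torusMk.surjective x
      have h1 : -torusMk p = torusMk (-p) := rfl
      have hx' : torusMk (-p) ∉ Z := by
        rw [← h1]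
        intro h
        apply hx
        change torusMk p + torusMk p = 0
        have : -torusMk p + -torusMk p = 0 := h
        rw [← neg_add, neg_eq_zero] at this
        exact this
      rw [h1]
      rw [hθmk _ hx, hθmk _ hx',
        hq.eq_iff _ _ (hp.notMem hq hx') (hp.notMem hq hx)]
      refine ⟨-1, by rw [hE]; trivial, 0, zero_mem _, ?_⟩
      apply Prod.ext <;> simp [tauPoint]
    have hminus : μ ((fun x => -x) ⁻¹' (A ∩ θ ⁻¹' B)) = μ (A ∩ θ ⁻¹' B) :=
      measurePreserving_neg_torusMeasure.measure_preimage
        (hA.measurableSet.inter (hm hB)).nullMeasurableSet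
    have hunion : θ ⁻¹' B =ᵐ[μ]
        ((A ∩ θ ⁻¹' B) ∪ (fun x => -x) ⁻¹' (A ∩ θ ⁻¹' B) : Set (UnitAddTorus (Fin 2))) := by
      filter_upwards [hZ] with x hx
      refine propext ⟨fun hxB => ?_, ?_⟩
      · obtain ⟨ε, -, h⟩ := hrep x hx hxB
        rcases Int.units_eq_one_or ε with rfl | rfl
        · exact Or.inl ⟨by simpa using h, hxB⟩
        · refine Or.inr ⟨by simpa using h, ?_⟩
          change θ (-x) ∈ B
          rw [hθ x hx]; exact hxB
      · rintro (h | h)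
        · exact h.2
        · have : θ (-x) ∈ B := h.2
          rw [hθ x hx] at this
          exact this
    have hdisj : AEDisjoint μ (A ∩ θ ⁻¹' B) ((fun x => -x) ⁻¹' (A ∩ θ ⁻¹' B)) := by
      refine measure_mono_null ?_ (torusMeasure_twoTorsion (Fin 2))
      rintro x ⟨⟨⟨p, hpV, hpx⟩, -⟩, ⟨p', hpV', hpx'⟩, -⟩
      by_contra hx
      change torusMk p' = -x at hpx'
      have h1 : q (tauPoint τ p) = q (tauPoint τ p') := by
        have hx' : -x ∉ Z := fun h => hx (by
          have : -x + -x = 0 := h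
          rw [← neg_add, neg_eq_zero] at this
          exact this)
        rw [← hθmk p (by rw [hpx]; exact hx), ← hθmk p' (by rw [hpx']; exact hx'), hpx, hpx']
        exact (hθ x hx).symm
      have h2 : p = p' := hinj hpV hpV' h1
      apply hx
      rw [← h2, hpx] at hpx'
      change x + x = 0
      nth_rewrite 1 [hpx']
      simp
    rw [measure_congr hunion, measure_union₀ (((hA.measurableSet.inter (hm hB)).preimage
      measurable_neg).nullMeasurableSet) hdisj, hminus, hE, ncard_univ, Nat.card_eq_fintype_card,
      Fintype.card_units_int]
    push_cast
    ring

end Measure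

/-! ### The real surface in a uniformized surface -/

theorem continuous_complexify : Continuous complexify := by unfold complexify; fun_prop

theorem complexify_injective : Function.Injective complexify := by
  intro p p' h
  have h1 := congrArg Prod.fst h
  have h2 := congrArg Prod.snd h
  exact Prod.ext (Complex.ofReal_injective h1) (Complex.ofReal_injective h2)

theorem IsRealImage.mem_complexify {τ : ℂ} {Y : Type*} [TopologicalSpace Y]
    {N : Set (ℂ × ℂ)} {q : ℂ × ℂ → Y} {S : Set Y} (hS : IsRealImage τ N q S) {p : ℝ × ℝ}
    (hp : τ • complexify p ∉ N) : q (τ • complexify p) ∈ S :=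
  hS.mem (p := ![p.1, p.2]) hp

section RealCharts

variable {τ : ℂ} {Y : Type*} [TopologicalSpace Y] [HolomorphicGerms Y]
  {N : Set (ℂ × ℂ)} {E : Set ℤˣ} {q : ℂ × ℂ → Y} {S : Set Y}

theorem coordX_mul_ofReal (hτ : τ.im ≠ 0) (x : ℝ) : coordX τ (τ * x) = 0 := by
  rw [show τ * (x : ℂ) = ((0 : ℝ) : ℂ) + (x : ℂ) * τ by push_cast; ring, coordX_basis hτ]

theorem eq_ofReal_of_coordX_eq_zero (hτ : τ.im ≠ 0) {w : ℂ} (h : coordX τ (τ * w) = 0) :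
    w = (coordY τ (τ * w) : ℝ) := by
  have hτ0 : τ ≠ 0 := by rintro rfl; exact hτ rfl
  have h1 := coord_spec hτ (τ * w)
  rw [h, Complex.ofReal_zero, zero_add, mul_comm _ τ] at h1
  exact mul_left_cancel₀ hτ0 h1

/-- Off the centres, the points of the real surface are the images of those of `τℝ²`. -/
theorem IsRealImage.exists_param (hS : IsRealImage τ N q S) (hq : Uniformized τ N E q)
    {z : ℂ × ℂ} (hz : z ∉ N) (hzS : q z ∈ S) :
    ∃ p : ℝ × ℝ, τ • complexify p ∉ N ∧ q (τ • complexify p) = q z := by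
  obtain ⟨⟨m, hm⟩, n, hn⟩ := hS.coord_int z hz hzS
  let l : ℂ × ℂ := (((-m : ℤ) : ℂ), ((-n : ℤ) : ℂ))
  have hl : l ∈ latticeSq τ := mem_latticeSq_iff.2
    ⟨mem_lattice_iff.2 ⟨-m, 0, by simp [l]⟩, mem_lattice_iff.2 ⟨-n, 0, by simp [l]⟩⟩
  have h : τ • complexify (coordY τ z.1, coordY τ z.2) = z + l := by
    have h1 := coord_spec hq.im_ne z.1
    have h2 := coord_spec hq.im_ne z.2
    rw [hm] at h1
    rw [hn] at h2
    apply Prod.ext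
    · simp only [complexify, Prod.smul_fst, smul_eq_mul, Prod.fst_add, l]
      conv_rhs => rw [h1]
      push_cast; ring
    · simp only [complexify, Prod.smul_snd, smul_eq_mul, Prod.snd_add, l]
      conv_rhs => rw [h2]
      push_cast; ring
  refine ⟨(coordY τ z.1, coordY τ z.2), ?_, ?_⟩
  · rw [h, hq.add_mem_iff hl]; exact hz
  · rw [h, hq.apply_add hz hl]

/-- Around a point of the real surface off the centres, `w ↦ q (τ w)` is the inverse of a
holomorphic chart in which the surface is the real plane. -/
theorem IsRealImage.exists_chart (hS : IsRealImage τ N q S) (hq : Uniformized τ N E q)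
    {p₀ : ℝ × ℝ} (hp₀ : τ • complexify p₀ ∉ N) :
    ∃ φ : OpenPartialHomeomorph Y (ℂ × ℂ), IsHolChart φ ∧ q (τ • complexify p₀) ∈ φ.source ∧
      IsAdapted φ S univ ∧ (∀ w ∈ φ.target, τ • w ∉ N ∧ φ.symm w = q (τ • w)) ∧
      ∀ p, complexify p ∈ φ.target → |p.1 - p₀.1| < 1 / 2 ∧ |p.2 - p₀.2| < 1 / 2 := by
  have hτ := hq.im_ne
  have hτ0 : τ ≠ 0 := by rintro rfl; exact hτ rfl
  obtain ⟨r, hr, hrN, hinj⟩ := hq.exists_injOn_ball hp₀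
  let V : Set (ℂ × ℂ) := ((fun w => τ • w) ⁻¹' ball (τ • complexify p₀) r) ∩
    ({w | |coordX τ (τ * w.1)| < 1 ∧ |coordX τ (τ * w.2)| < 1} ∩ ball (complexify p₀) (1 / 2))
  have hτc : Continuous fun w : ℂ × ℂ => τ • w := continuous_const_smul τ
  have hV : IsOpen V := by
    refine (isOpen_ball.preimage hτc).inter (IsOpen.inter ?_ isOpen_ball)
    have h1 : Continuous fun w : ℂ × ℂ => |coordX τ (τ * w.1)| :=
      (continuous_coordX.comp (continuous_const.mul continuous_fst)).abs
    have h2 : Continuous fun w : ℂ × ℂ => |coordX τ (τ * w.2)| :=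
      (continuous_coordX.comp (continuous_const.mul continuous_snd)).abs
    exact (isOpen_lt h1 continuous_const).inter (isOpen_lt h2 continuous_const)
  have hVN : ∀ w ∈ V, τ • w ∉ N := fun w hw => hrN hw.1
  have hτopen : IsOpenMap fun w : ℂ × ℂ => τ • w := isOpenMap_smul₀ hτ0
  obtain ⟨φ, hφ, htarget, hsource, hsymm, hinv⟩ := exists_holChart (fun w => q (τ • w)) hV
    (hq.continuousOn.comp hτc.continuousOn hVN)
    (by
      intro U hU hUo
      rw [← image_image q]
      exact hq.isOpen_image _ (hτopen _ hUo) (by rintro _ ⟨w, hw, rfl⟩; exact hVN w (hU hw)))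
    (by
      intro w hw w' hw' h
      exact smul_right_injective _ hτ0 (hinj hw.1 hw'.1 h))
    (by
      intro w hw f
      rw [hq.holAt_iff _ (hVN w hw)]
      constructor
      · intro h
        exact AnalyticAt.fun_comp (f := fun w : ℂ × ℂ => τ • w) (g := fun w => f (q w)) h
          ((τ • ContinuousLinearMap.id ℂ (ℂ × ℂ)).analyticAt w)
      · intro h
        have h1 := AnalyticAt.fun_comp_of_eq (f := fun w : ℂ × ℂ => τ⁻¹ • w)
          (g := fun w => f (q (τ • w))) h
          ((τ⁻¹ • ContinuousLinearMap.id ℂ (ℂ × ℂ)).analyticAt (τ • w)) (inv_smul_smul₀ hτ0 w)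
        simpa only [smul_inv_smul₀ hτ0] using h1)
  refine ⟨φ, hφ, ?_, ?_, ?_, ?_⟩
  · rw [hsource]
    refine ⟨complexify p₀, ⟨mem_ball_self hr, ?_, mem_ball_self (by norm_num)⟩, rfl⟩
    simp [complexify, coordX_mul_ofReal hτ]
  · intro y hy
    rw [hsource] at hy
    obtain ⟨w, hw, rfl⟩ := hy
    rw [hinv w hw]
    constructor
    · intro hS'
      obtain ⟨⟨m, hm⟩, n, hn⟩ := hS.coord_int _ (hVN w hw) hS'
      have h1 := hw.2.1.1
      have h2 := hw.2.1.2
      rw [show τ * w.1 = (τ • w).1 from rfl, hm] at h1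
      rw [show τ * w.2 = (τ • w).2 from rfl, hn] at h2
      have hm0 : m = 0 := Int.abs_lt_one_iff.1 (by exact_mod_cast h1)
      have hn0 : n = 0 := Int.abs_lt_one_iff.1 (by exact_mod_cast h2)
      rw [hm0, Int.cast_zero] at hm
      rw [hn0, Int.cast_zero] at hn
      exact ⟨(_, _), trivial, Prod.ext (eq_ofReal_of_coordX_eq_zero hτ hm)
        (eq_ofReal_of_coordX_eq_zero hτ hn)⟩
    · rintro ⟨p, -, rfl⟩
      exact hS.mem_complexify (hVN _ hw)
  · intro w hw
    rw [htarget] at hw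
    exact ⟨hVN w hw, hsymm w hw⟩
  · intro p hp
    rw [htarget] at hp
    have h := hp.2.2
    rw [mem_ball, Prod.dist_eq, max_lt_iff] at h
    simpa [complexify, Complex.dist_of_im_eq, Real.dist_eq] using h

/-- The condition in `HasSmoothDensity` at one point. -/
def HasSmoothDensityAt [MeasurableSpace Y] (μ : Measure Y) (S : Set Y) (x : Y) : Prop :=
  ∃ φ : OpenPartialHomeomorph Y (ℂ × ℂ), IsHolChart φ ∧ x ∈ φ.source ∧
    ∃ H : Set (ℝ × ℝ), (H = Set.univ ∨ H = halfPlane) ∧ IsAdapted φ S H ∧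
    ∃ ρ : ℝ × ℝ → ℝ, ContDiffOn ℝ ∞ ρ (complexify ⁻¹' φ.target) ∧
      (∀ p, complexify p ∈ φ.target → 0 < ρ p) ∧
      ∀ B : Set Y, MeasurableSet B → B ⊆ φ.source →
        μ B = ∫⁻ p in {p | p ∈ H ∧ complexify p ∈ φ.target ∧ φ.symm (complexify p) ∈ B},
          ENNReal.ofReal (ρ p)

variable [MeasurableSpace Y] [BorelSpace Y]

theorem surfaceMeasure_eq_volume_prod (hq : Uniformized τ N E q) {V : Set (ℝ × ℝ)} (hV : IsOpen V)
    {a : ℝ × ℝ} (hVa : ∀ p ∈ V, p.1 ∈ Ioc a.1 (a.1 + 1) ∧ p.2 ∈ Ioc a.2 (a.2 + 1))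
    (hVN : ∀ p ∈ V, τ • complexify p ∉ N) (hinj : InjOn (fun p => q (τ • complexify p)) V)
    {B : Set Y} (hB : MeasurableSet B)
    (hcov : ∀ p, τ • complexify p ∉ N → q (τ • complexify p) ∈ B →
      ∃ p' ∈ V, q (τ • complexify p') = q (τ • complexify p)) :
    surfaceMeasure τ q B =
      (E.ncard : ENNReal) * volume {p | p ∈ V ∧ q (τ • complexify p) ∈ B} := by
  let e := MeasurableEquiv.finTwoArrow (α := ℝ)
  have he : ∀ p : Fin 2 → ℝ, τ • complexify (e p) = tauPoint τ p := fun p => rfl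
  have hec : Continuous e := by
    change Continuous fun p : Fin 2 → ℝ => (p 0, p 1)
    fun_prop
  have h := surfaceMeasure_eq_volume hq (hV.preimage hec) (a := ![a.1, a.2])
    (fun p hp i => by
      have := hVa _ hp
      fin_cases i
      · exact this.1
      · exact this.2)
    (fun p hp => hVN _ hp) (fun p hp p' hp' h => e.injective (hinj hp hp' h)) hB
    (fun p hp hpB => by
      obtain ⟨p', hp', h⟩ := hcov (e p) hp hpB
      refine ⟨e.symm p', ?_, ?_⟩
      · rw [mem_preimage, e.apply_symm_apply]; exact hp'
      · rw [← he, e.apply_symm_apply]; exact h)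
  rw [h, ← (volume_preserving_finTwoArrow ℝ).measure_preimage_equiv]
  rfl

theorem IsRealImage.hasSmoothDensityAt (hS : IsRealImage τ N q S) (hq : Uniformized τ N E q)
    {p₀ : ℝ × ℝ} (hp₀ : τ • complexify p₀ ∉ N) :
    HasSmoothDensityAt (surfaceMeasure τ q) S (q (τ • complexify p₀)) := by
  obtain ⟨φ, hφ, hx, had, hsymm, hbox⟩ := hS.exists_chart hq hp₀
  have hE : 0 < E.ncard := by
    rcases hq.cases with h | h <;> rw [h.2]
    · simp
    · rw [ncard_univ, Nat.card_eq_fintype_card]; decide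
  refine ⟨φ, hφ, hx, univ, Or.inl rfl, had, fun _ => E.ncard, contDiffOn_const,
    fun p _ => Nat.cast_pos.2 hE, fun B hB hBφ => ?_⟩
  rw [setLIntegral_const, ENNReal.ofReal_natCast]
  rw [surfaceMeasure_eq_volume_prod hq (V := complexify ⁻¹' φ.target)
    (φ.open_target.preimage continuous_complexify) (a := (p₀.1 - 1 / 2, p₀.2 - 1 / 2))
    (fun p hp => by
      have h := hbox p hp
      rw [abs_lt, abs_lt] at h
      simp only [mem_Ioc]
      refine ⟨⟨?_, ?_⟩, ?_, ?_⟩ <;> linarith [h.1.1, h.1.2, h.2.1, h.2.2])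
    (fun p hp => (hsymm _ hp).1) ?_ hB ?_]
  · congr 2
    ext p
    simp only [mem_preimage, mem_ofPred_eq, mem_univ, true_and]
    refine and_congr_right fun hp => ?_
    rw [(hsymm _ hp).2]
  · intro p hp p' hp' h
    apply complexify_injective
    apply φ.symm.injOn hp hp'
    rw [(hsymm _ hp).2, (hsymm _ hp').2]
    exact h
  · intro p hp hpB
    obtain ⟨p', -, hp'⟩ := (had _ (hBφ hpB)).1 (hS.mem_complexify hp)
    have hp't : complexify p' ∈ φ.target := by
      rw [← hp']; exact φ.map_source (hBφ hpB)
    refine ⟨p', hp't, ?_⟩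
    rw [← (hsymm _ hp't).2, ← hp', φ.left_inv (hBφ hpB)]

end RealCharts

section Ergodic

variable {τ : ℂ} {Y : Type*} [TopologicalSpace Y] [HolomorphicGerms Y]
  {N : Set (ℂ × ℂ)} {E : Set ℤˣ} {q : ℂ × ℂ → Y} {S : Set Y}

theorem IsRealImage.image_act (hS : IsRealImage τ N q S) (hq : Uniformized τ N E q)
    {act : SL2Z →* (Y ≃ₜ Y)} (hact : ∀ g z, z ∉ N → act g (q z) = q (slFun g z)) (g : SL2Z) :
    act g '' S = S := by
  have key : ∀ g, act g '' S ⊆ S := by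
    intro g
    rw [hS.eq_closure, (act g).image_closure]
    refine closure_mono ?_
    rintro _ ⟨_, ⟨_, ⟨⟨p, rfl⟩, hp⟩, rfl⟩, rfl⟩
    refine ⟨_, ⟨⟨_, ((torusParam_tauPoint hq.im_ne).equiv g p).symm⟩, ?_⟩, (hact g _ hp).symm⟩
    exact fun h => hp ((hq.slFun_mem_iff g).1 h)
  refine Subset.antisymm (key g) fun y hy => ⟨act g⁻¹ y, key g⁻¹ ⟨y, hy, rfl⟩, ?_⟩
  rw [map_inv]
  exact (act g).apply_symm_apply y

/-- An action of `SL₂(ℤ)` covering the linear action on the plane is ergodic on the real surface,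
once the properties that do not depend on `q` alone are known. -/
theorem IsRealImage.actsErgodicallyOn (hS : IsRealImage τ N q S) (hq : Uniformized τ N E q)
    {act : SL2Z →* (Y ≃ₜ Y)} (hact : ∀ g z, z ∉ N → act g (q z) = q (slFun g z))
    (hhol : ∀ g, IsHolMap (act g)) (hne : NonElementary act.range)
    (hexc : ∀ [MeasurableSpace Y] [BorelSpace Y], ∀ x ∈ S, x ∉ q '' Nᶜ →
      HasSmoothDensityAt (surfaceMeasure τ q) S x) :
    ActsErgodicallyOn act.range S := by
  let _ : MeasurableSpace Y := borel Y
  have _ : BorelSpace Y := ⟨rfl⟩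
  have hp := torusParam_tauPoint hq.im_ne
  refine ⟨?_, hne, ?_, ?_, ?_, surfaceMeasure τ q, isProbabilityMeasure_surfaceMeasure hq,
    support_surfaceMeasure hq hS, ?_, ?_, fun B hB hinv => ergodic_surfaceMeasure hq hact hB hinv⟩
  · rintro _ ⟨g, rfl⟩
    exact hhol g
  · rintro _ ⟨g, rfl⟩
    exact hS.image_act hq hact g
  · obtain ⟨p, hpN, h⟩ := exists_dense_orbit hq (torusParam_basisPoint hq.im_ne) hact
    refine ⟨q (basisPoint τ p), ?_⟩
    rw [(basisPoint_surjective hq.im_ne).range_eq, ← compl_eq_univ_sdiff,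
      hq.dense.closure_eq] at h
    exact dense_iff_closure_eq.2 (univ_subset_iff.1 h)
  · obtain ⟨p, hpN, h⟩ := exists_dense_orbit hq hp hact
    exact ⟨q (tauPoint τ p), hS.mem hpN, by rwa [← hS.eq_closure] at h⟩
  · intro x hx
    by_cases hxN : x ∈ q '' Nᶜ
    · obtain ⟨z, hz, rfl⟩ := hxN
      obtain ⟨p, hpN, hpz⟩ := hS.exists_param hq hz hx
      rw [← hpz]
      exact hS.hasSmoothDensityAt hq hpN
    · exact hexc x hx hxN
  · rintro _ ⟨g, rfl⟩
    exact map_surfaceMeasure hq hact g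

end Ergodic

/-! ### An even line family on an elliptic curve -/

section EllipticLine

variable {τ : ℂ}

/-- A term of the series `ellipticSection`: a character times a tent function. -/
def sectionTerm (τ : ℂ) (m : ℤ) (z : ℂ) : ℂ :=
  Complex.exp (2 * Real.pi * Complex.I * m * coordX τ z) *
    (max 0 (1 - 2 * |coordY τ z + m / 2|) : ℝ)

theorem continuous_sectionTerm (m : ℤ) : Continuous (sectionTerm τ m) := by
  have h1 := continuous_coordX (τ := τ)
  have h2 := continuous_coordY (τ := τ)
  unfold sectionTerm
  fun_prop

theorem sectionTerm_neg (m : ℤ) (z : ℂ) : sectionTerm τ m (-z) = sectionTerm τ (-m) z := by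
  unfold sectionTerm
  rw [coordX_neg, coordY_neg, ← abs_neg (-coordY τ z + m / 2)]
  congr 2
  · push_cast; ring
  · push_cast; ring_nf

theorem sectionTerm_add (hτ : τ.im ≠ 0) (m a b : ℤ) (z : ℂ) :
    sectionTerm τ m (z + (a + b * τ)) =
      Complex.exp (-(4 * Real.pi * Complex.I * b * coordX τ z)) * sectionTerm τ (m + 2 * b) z := by
  have h1 : coordX τ (a + b * τ) = a := by exact_mod_cast coordX_basis hτ (a : ℝ) (b : ℝ)
  have h2 : coordY τ (a + b * τ) = b := by exact_mod_cast coordY_basis hτ (a : ℝ) (b : ℝ)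
  unfold sectionTerm
  rw [coordX_add, coordY_add, h1, h2, ← mul_assoc, ← Complex.exp_add]
  congr 1
  · rw [Complex.exp_eq_exp_iff_exists_int]
    exact ⟨m * a, by push_cast; ring⟩
  · push_cast
    ring_nf

theorem sectionTerm_eq_zero {m : ℤ} {z : ℂ} (h : 1 / 2 ≤ |coordY τ z + m / 2|) :
    sectionTerm τ m z = 0 := by
  rw [sectionTerm, max_eq_left (by linarith)]
  simp

theorem locallyFinite_sectionTerm (k : ℤ) :
    LocallyFinite fun n : ℤ => Function.support (sectionTerm τ (2 * n + k)) := by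
  intro z
  refine ⟨{w | |coordY τ w - coordY τ z| < 1},
    (continuous_coordY.sub continuous_const).abs.continuousAt.eventually_lt_const (by simp), ?_⟩
  refine (finite_Icc ⌊-coordY τ z - k / 2 - 2⌋ ⌈-coordY τ z - k / 2 + 2⌉).subset ?_
  rintro n ⟨w, hw, hwz⟩
  have h1 : |coordY τ w + ((2 * n + k : ℤ) : ℝ) / 2| < 1 / 2 := by
    by_contra! h
    exact hw (sectionTerm_eq_zero h)
  have h2 : |coordY τ w - coordY τ z| < 1 := hwz
  rw [abs_lt] at h1 h2
  push_cast at h1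
  constructor
  · have := Int.floor_le (-coordY τ z - k / 2 - 2)
    have h3 : (⌊-coordY τ z - k / 2 - 2⌋ : ℝ) ≤ n := by linarith
    exact_mod_cast h3
  · have := Int.le_ceil (-coordY τ z - k / 2 + 2)
    have h3 : (n : ℝ) ≤ ⌈-coordY τ z - k / 2 + 2⌉ := by linarith
    exact_mod_cast h3

/-- A continuous nowhere vanishing map `ℂ → ℂ²`, even, and multiplied by a factor of automorphy
under translation by the lattice; its direction is a map of degree `2` from `ℂ / (ℤ + ℤ τ)` to the
projective line, invariant under `z ↦ -z`. -/
def ellipticSection (τ : ℂ) (z : ℂ) : ℂ × ℂ :=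
  (∑ᶠ n : ℤ, sectionTerm τ (2 * n + 0) z, ∑ᶠ n : ℤ, sectionTerm τ (2 * n + 1) z)

theorem continuous_ellipticSection : Continuous (ellipticSection τ) :=
  (continuous_finsum (fun _ => continuous_sectionTerm _) (locallyFinite_sectionTerm 0)).prodMk
    (continuous_finsum (fun _ => continuous_sectionTerm _) (locallyFinite_sectionTerm 1))

theorem ellipticSection_neg (z : ℂ) : ellipticSection τ (-z) = ellipticSection τ z := by
  have key : ∀ k : ℤ, ∑ᶠ n : ℤ, sectionTerm τ (2 * n + k) (-z) =
      ∑ᶠ n : ℤ, sectionTerm τ (2 * n + k) z := by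
    intro k
    rw [← finsum_comp_equiv (Equiv.subLeft (-k))]
    refine finsum_congr fun n => ?_
    rw [sectionTerm_neg, Equiv.subLeft_apply]
    congr 1
    ring
  exact Prod.ext (key 0) (key 1)

theorem ellipticSection_add (hτ : τ.im ≠ 0) (a b : ℤ) (z : ℂ) :
    ellipticSection τ (z + (a + b * τ)) =
      Complex.exp (-(4 * Real.pi * Complex.I * b * coordX τ z)) • ellipticSection τ z := by
  have key : ∀ k : ℤ, ∑ᶠ n : ℤ, sectionTerm τ (2 * n + k) (z + (a + b * τ)) =
      Complex.exp (-(4 * Real.pi * Complex.I * b * coordX τ z)) *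
        ∑ᶠ n : ℤ, sectionTerm τ (2 * n + k) z := by
    intro k
    rw [← finsum_comp_equiv (Equiv.addRight b) (f := fun n : ℤ => sectionTerm τ (2 * n + k) z),
      mul_finsum]
    refine finsum_congr fun n => ?_
    rw [sectionTerm_add hτ, Equiv.coe_addRight]
    congr 2
    ring
  exact Prod.ext (key 0) (key 1)

/-- The terms of one parity have disjoint supports, so the component containing the term `n` with
`n` nearest to `-2 * coordY τ z`, which is nonzero, does not vanish. -/
theorem ellipticSection_ne_zero (z : ℂ) : ellipticSection τ z ≠ 0 := by
  have key : ∀ k : ℤ, (∃ n : ℤ, 2 * n + k = -round (2 * coordY τ z)) →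
      ∑ᶠ n : ℤ, sectionTerm τ (2 * n + k) z ≠ 0 := by
    rintro k ⟨n, hn⟩
    have h1 : |coordY τ z + ((2 * n + k : ℤ) : ℝ) / 2| ≤ 1 / 4 := by
      have := abs_sub_round (2 * coordY τ z)
      rw [abs_le] at this ⊢
      rw [hn]
      push_cast
      constructor <;> linarith [this.1, this.2]
    rw [finsum_eq_single _ n]
    · rw [sectionTerm]
      refine mul_ne_zero (Complex.exp_ne_zero _) (Complex.ofReal_ne_zero.2 ?_)
      exact (lt_max_of_lt_right (by linarith)).ne'
    · intro n' hn'
      apply sectionTerm_eq_zero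
      have h2 : (1 : ℝ) ≤ |(n' : ℝ) - n| := by
        exact_mod_cast Int.one_le_abs (sub_ne_zero.2 hn')
      have h3 : coordY τ z + ((2 * n' + k : ℤ) : ℝ) / 2 =
          (n' - n : ℝ) + (coordY τ z + ((2 * n + k : ℤ) : ℝ) / 2) := by
        push_cast; ring
      rw [h3]
      have := abs_sub_abs_le_abs_add ((n' : ℝ) - n) (coordY τ z + ((2 * n + k : ℤ) : ℝ) / 2)
      linarith
  intro h
  rcases Int.even_or_odd (-round (2 * coordY τ z)) with ⟨n, hn⟩ | ⟨n, hn⟩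
  · exact key 0 ⟨n, by rw [hn]; ring⟩ (congrArg Prod.fst h)
  · exact key 1 ⟨n, by rw [hn]⟩ (congrArg Prod.snd h)

/-- The orthogonal projection of `ℂ²` onto the line of a vector. -/
def lineProj (v : ℂ × ℂ) : (ℂ × ℂ) →L[ℂ] (ℂ × ℂ) :=
  ((starRingEnd ℂ) v.1 * v.1 + (starRingEnd ℂ) v.2 * v.2)⁻¹ •
    ((starRingEnd ℂ) v.1 • ContinuousLinearMap.fst ℂ ℂ ℂ +
      (starRingEnd ℂ) v.2 • ContinuousLinearMap.snd ℂ ℂ ℂ).smulRight v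

theorem lineProj_apply (v w : ℂ × ℂ) : lineProj v w = lineRatio v w • v := by
  simp [lineProj, lineRatio, smul_smul, div_eq_inv_mul]

theorem lineProj_self {v : ℂ × ℂ} (hv : v ≠ 0) : lineProj v v = v := by
  have := lineRatio_smul hv 1
  rw [one_smul] at this
  rw [lineProj_apply, this, one_smul]

theorem lineProj_smul {c : ℂ} (hc : c ≠ 0) (v : ℂ × ℂ) : lineProj (c • v) = lineProj v := by
  have hc' : (starRingEnd ℂ) c ≠ 0 := by simpa using hc
  refine ContinuousLinearMap.ext fun w => ?_
  rw [lineProj_apply, lineProj_apply, smul_smul]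
  congr 1
  rw [lineRatio, lineRatio]
  simp only [Prod.smul_fst, Prod.smul_snd, smul_eq_mul, map_mul]
  rw [show (starRingEnd ℂ) c * (starRingEnd ℂ) v.1 * w.1 +
      (starRingEnd ℂ) c * (starRingEnd ℂ) v.2 * w.2 =
        (starRingEnd ℂ) c * ((starRingEnd ℂ) v.1 * w.1 + (starRingEnd ℂ) v.2 * w.2) by ring,
    show (starRingEnd ℂ) c * (starRingEnd ℂ) v.1 * (c * v.1) +
      (starRingEnd ℂ) c * (starRingEnd ℂ) v.2 * (c * v.2) = (starRingEnd ℂ) c *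
        (((starRingEnd ℂ) v.1 * v.1 + (starRingEnd ℂ) v.2 * v.2) * c) by ring,
    mul_div_mul_left _ _ hc', ← div_div, div_mul_cancel₀ _ hc]

theorem continuous_lineProj_comp {K : Type*} [TopologicalSpace K] {f : K → ℂ × ℂ}
    (hf : Continuous f) (h0 : ∀ x, f x ≠ 0) : Continuous fun x => lineProj (f x) := by
  unfold lineProj
  have h1 : Continuous fun x => (starRingEnd ℂ) (f x).1 := Complex.continuous_conj.comp hf.fst
  have h2 : Continuous fun x => (starRingEnd ℂ) (f x).2 := Complex.continuous_conj.comp hf.snd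
  refine Continuous.smul
    (Continuous.inv₀ (by fun_prop) fun x => sum_conj_mul_self_ne_zero (h0 x)) ?_
  exact ((ContinuousLinearMap.smulRightL ℂ (ℂ × ℂ) (ℂ × ℂ)).continuous₂).comp
    (((h1.smul continuous_const).add (h2.smul continuous_const)).prodMk hf)

/-- The projection onto the line of `ellipticSection`; it depends on `z` only up to sign and
translation by the lattice. -/
def ellipticProj (τ z : ℂ) : (ℂ × ℂ) →L[ℂ] (ℂ × ℂ) := lineProj (ellipticSection τ z)

theorem continuous_ellipticProj : Continuous (ellipticProj τ) :=
  continuous_lineProj_comp continuous_ellipticSection ellipticSection_ne_zero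

theorem ellipticProj_neg (z : ℂ) : ellipticProj τ (-z) = ellipticProj τ z := by
  rw [ellipticProj, ellipticSection_neg, ellipticProj]

theorem ellipticProj_add (hτ : τ.im ≠ 0) {z l : ℂ} (hl : l ∈ lattice τ) :
    ellipticProj τ (z + l) = ellipticProj τ z := by
  obtain ⟨a, b, rfl⟩ := mem_lattice_iff.1 hl
  rw [ellipticProj, ellipticSection_add hτ, lineProj_smul (Complex.exp_ne_zero _), ellipticProj]

theorem ellipticProj_units_smul_add (hτ : τ.im ≠ 0) (ε : ℤˣ) {z l : ℂ} (hl : l ∈ lattice τ) :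
    ellipticProj τ ((ε : ℤ) • z + l) = ellipticProj τ z := by
  rw [ellipticProj_add hτ hl]
  rcases Int.units_eq_one_or ε with rfl | rfl
  · simp
  · simp [ellipticProj_neg]

theorem isLineFamily_of_ellipticProj {Y : Type*} [TopologicalSpace Y]
    (P : C(Y, (ℂ × ℂ) →L[ℂ] (ℂ × ℂ))) (h : ∀ y, ∃ w, P y = ellipticProj τ w) : IsLineFamily P where
  idem y v := by
    obtain ⟨w, hw⟩ := h y
    rw [hw, ellipticProj, lineProj_apply _ v, map_smul, lineProj_self (ellipticSection_ne_zero w)]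
  exists_ne y := by
    obtain ⟨w, hw⟩ := h y
    exact ⟨_, ellipticSection_ne_zero w, by
      rw [hw]; exact lineProj_self (ellipticSection_ne_zero w)⟩
  rank_one y v v' hv h1 h2 := by
    obtain ⟨w, hw⟩ := h y
    rw [hw, ellipticProj, lineProj_apply] at h1 h2
    have hr : lineRatio (ellipticSection τ w) v ≠ 0 := by
      intro h0
      rw [h0, zero_smul] at h1
      exact hv h1.symm
    refine ⟨lineRatio (ellipticSection τ w) v' / lineRatio (ellipticSection τ w) v, ?_⟩
    have h3 : (lineRatio (ellipticSection τ w) v' / lineRatio (ellipticSection τ w) v) •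
        lineRatio (ellipticSection τ w) v • ellipticSection τ w =
        (lineRatio (ellipticSection τ w) v' / lineRatio (ellipticSection τ w) v) • v := by rw [h1]
    rw [← h3, smul_smul, div_mul_cancel₀ _ hr, h2]

end EllipticLine

/-! ### Free subgroups of `SL₂(ℤ)` -/

theorem coe_upperShear (k : ℤ) :
    ((upperShear k : SL2Z) : Matrix (Fin 2) (Fin 2) ℤ) = !![1, k; 0, 1] := rfl

theorem coe_lowerShear (k : ℤ) :
    ((lowerShear k : SL2Z) : Matrix (Fin 2) (Fin 2) ℤ) = !![1, 0; k, 1] := rfl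

/-- The shears with entry `3` generate a free group of rank two. -/
theorem lift_shears_injective :
    Function.Injective (FreeGroup.lift ![upperShear 3, lowerShear 3]) := by
  -- ping-pong on the ratio `x / y` of the entries of the first column
  have hdet : ∀ g : SL2Z, g 0 0 * g 1 1 - g 0 1 * g 1 0 = 1 := fun g => by
    rw [← Matrix.det_fin_two]; exact g.2
  have hpos : ∀ g : SL2Z, 0 < g 0 0 * g 0 0 + g 1 0 * g 1 0 := by
    intro g
    by_contra! h
    have h0 : g 0 0 = 0 := by nlinarith [mul_self_nonneg (g 0 0), mul_self_nonneg (g 1 0)]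
    have h1 : g 1 0 = 0 := by nlinarith [mul_self_nonneg (g 0 0), mul_self_nonneg (g 1 0)]
    have := hdet g
    rw [h0, h1] at this
    simp at this
  have hu : ∀ (k : ℤ) (g : SL2Z), (upperShear k * g) 0 0 = g 0 0 + k * g 1 0 ∧
      (upperShear k * g) 1 0 = g 1 0 := by
    intro k g
    rw [Matrix.SpecialLinearGroup.coe_mul, coe_upperShear]
    constructor <;> simp [Matrix.mul_apply, Fin.sum_univ_two]
  have hl : ∀ (k : ℤ) (g : SL2Z), (lowerShear k * g) 0 0 = g 0 0 ∧
      (lowerShear k * g) 1 0 = k * g 0 0 + g 1 0 := by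
    intro k g
    rw [Matrix.SpecialLinearGroup.coe_mul, coe_lowerShear]
    constructor <;> simp [Matrix.mul_apply, Fin.sum_univ_two]
  have huinv : (upperShear 3)⁻¹ = upperShear (-3) := by
    rw [inv_eq_iff_mul_eq_one]
    ext i j
    rw [Matrix.SpecialLinearGroup.coe_mul, coe_upperShear, coe_upperShear]
    fin_cases i <;> fin_cases j <;> simp [Matrix.mul_apply, Fin.sum_univ_two]
  have hlinv : (lowerShear 3)⁻¹ = lowerShear (-3) := by
    rw [inv_eq_iff_mul_eq_one]
    ext i j
    rw [Matrix.SpecialLinearGroup.coe_mul, coe_lowerShear, coe_lowerShear]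
    fin_cases i <;> fin_cases j <;> simp [Matrix.mul_apply, Fin.sum_univ_two]
  let c : Fin 2 → SL2Z → ℤ := ![fun g => g 1 0, fun g => g 0 0]
  let X : Fin 2 → Set SL2Z := fun i => {g | 3 * (c i g * c i g) < 2 * (g 0 0 * g 1 0)}
  let Y : Fin 2 → Set SL2Z := fun i => {g | 2 * (g 0 0 * g 1 0) ≤ -(3 * (c i g * c i g))}
  have hsq : ∀ g : SL2Z, 0 ≤ (g 0 0 + g 1 0) * (g 0 0 + g 1 0) ∧
      0 ≤ (g 0 0 - g 1 0) * (g 0 0 - g 1 0) := fun g => ⟨mul_self_nonneg _, mul_self_nonneg _⟩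
  refine FreeGroup.injective_lift_of_ping_pong _ X Y ?_ ?_ ?_ ?_ ?_ ?_
  · intro i
    fin_cases i
    · refine ⟨upperShear 3 * lowerShear 1, ?_⟩
      have h := hu 3 (lowerShear 1)
      change 3 * ((upperShear 3 * lowerShear 1) 1 0 * (upperShear 3 * lowerShear 1) 1 0) <
        2 * ((upperShear 3 * lowerShear 1) 0 0 * (upperShear 3 * lowerShear 1) 1 0)
      rw [h.1, h.2, coe_lowerShear]
      simp
    · refine ⟨lowerShear 3, ?_⟩
      change 3 * ((lowerShear 3) 0 0 * (lowerShear 3) 0 0) <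
        2 * ((lowerShear 3) 0 0 * (lowerShear 3) 1 0)
      rw [coe_lowerShear]
      simp
  · intro i j hij
    rw [Function.onFun, Set.disjoint_left]
    intro g hi hj
    have h1 := hsq g
    have h2 := hpos g
    fin_cases i <;> fin_cases j <;> simp [X, c] at hij hi hj <;> nlinarith [h1.1, h1.2]
  · intro i j hij
    rw [Function.onFun, Set.disjoint_left]
    intro g hi hj
    have h1 := hsq g
    have h2 := hpos g
    fin_cases i <;> fin_cases j <;> simp [Y, c] at hij hi hj <;> nlinarith [h1.1, h1.2]
  · intro i j
    rw [Set.disjoint_left]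
    intro g hi hj
    have h1 := mul_self_nonneg (c i g)
    have h2 := mul_self_nonneg (c j g)
    simp only [X, Y, mem_ofPred_eq] at hi hj
    linarith
  · intro i
    rintro _ ⟨g, hg, rfl⟩
    fin_cases i
    · have h := hu 3 g
      simp [X, Y, c, h.1, h.2] at hg ⊢
      linarith
    · have h := hl 3 g
      simp [X, Y, c, h.1, h.2] at hg ⊢
      linarith
  · intro i
    rintro _ ⟨g, hg, rfl⟩
    fin_cases i
    · have h := hu (-3) g
      simp [X, Y, c, huinv, h.1, h.2] at hg ⊢
      linarith
    · have h := hl (-3) g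
      simp [X, Y, c, hlinv, h.1, h.2] at hg ⊢
      linarith

/-! ### The action on the second cohomology -/

section NonElementary

variable {τ : ℂ} {Y : Type*} [TopologicalSpace Y] [HolomorphicGerms Y]
  {N : Set (ℂ × ℂ)} {E : Set ℤˣ} {q : ℂ × ℂ → Y}

/-- The coordinates of a point of the plane. -/
def planeCoord (i : Fin 2) (z : ℂ × ℂ) : ℂ := ![z.1, z.2] i

/-- A point on the complex line parallel to a coordinate axis through `(1/4, 1/4)`, which avoids
the half lattice. -/
def axisPoint (τ : ℂ) (j : Fin 2) (p : ℝ × ℝ) : ℂ × ℂ :=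
  (1 / 4 + if j = 0 then p.1 + p.2 * τ else 0, 1 / 4 + if j = 1 then p.1 + p.2 * τ else 0)

theorem continuous_axisPoint (j : Fin 2) : Continuous (axisPoint τ j) := by
  unfold axisPoint
  split_ifs <;> fun_prop

theorem quarter_notMem (hτ : τ.im ≠ 0) : (1 / 4 + 1 / 4 : ℂ) ∉ lattice τ := by
  intro h
  obtain ⟨⟨m, hm⟩, -⟩ := (mem_lattice_iff_coord hτ).1 h
  have h1 : coordX τ (1 / 4 + 1 / 4) = 1 / 2 := by
    have := coordX_basis hτ (1 / 2) 0
    rw [← this]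
    congr 1
    push_cast; ring
  rw [h1] at hm
  have h2 : (1 : ℤ) = 2 * m := by
    have : (1 : ℝ) = 2 * m := by linarith
    exact_mod_cast this
  omega

theorem axisPoint_notMem_halfLattice (hτ : τ.im ≠ 0) (j : Fin 2) (p : ℝ × ℝ) :
    axisPoint τ j p ∉ halfLattice τ := by
  intro h
  obtain ⟨h1, h2⟩ := mem_latticeSq_iff.1 h
  fin_cases j
  · exact quarter_notMem hτ (by simpa [axisPoint] using h2)
  · exact quarter_notMem hτ (by simpa [axisPoint] using h1)

theorem axisPoint_add_sub_mem (j : Fin 2) (p : ℝ × ℝ) (a b : ℤ) :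
    ∃ l ∈ latticeSq τ, axisPoint τ j (p.1 + a, p.2 + b) = axisPoint τ j p + l := by
  refine ⟨(if j = 0 then a + b * τ else 0, if j = 1 then a + b * τ else 0),
    mem_latticeSq_iff.2 ⟨mem_lattice_iff.2 ?_, mem_lattice_iff.2 ?_⟩, ?_⟩
  · by_cases h : j = 0
    · exact ⟨a, b, by simp [h]⟩
    · exact ⟨0, 0, by simp [h]⟩
  · by_cases h : j = 1
    · exact ⟨a, b, by simp [h]⟩
    · exact ⟨0, 0, by simp [h]⟩
  · apply Prod.ext <;> simp only [axisPoint, Prod.mk_add_mk] <;> split_ifs <;> push_cast <;> ring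

theorem planeCoord_slFun_axisPoint (h : SL2Z) (i j : Fin 2) (p : ℝ × ℝ) :
    planeCoord i (slFun h (axisPoint τ j p)) =
      (((h i 0 + h i 1) / 4 + h i j * p.1 : ℝ) : ℂ) + ((h i j * p.2 : ℝ) : ℂ) * τ := by
  fin_cases i <;> fin_cases j <;> simp [planeCoord, slFun, axisPoint] <;> ring

/-- The torus in `Y` given by the elliptic curve parallel to a coordinate axis. -/
def axisTorus (hq : Uniformized τ N E q) (j : Fin 2) : C(ℝ × ℝ, Y) :=
  ⟨fun p => q (axisPoint τ j p), hq.continuousOn.comp_continuous (continuous_axisPoint j)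
    fun p h => axisPoint_notMem_halfLattice hq.im_ne j p (hq.subset_halfLattice h)⟩

theorem isDoublyPeriodic_axisTorus (hq : Uniformized τ N E q) (j : Fin 2) :
    IsDoublyPeriodic (axisTorus hq j) := by
  have hN : ∀ p, axisPoint τ j p ∉ N := fun p h =>
    axisPoint_notMem_halfLattice hq.im_ne j p (hq.subset_halfLattice h)
  intro x y
  constructor
  · obtain ⟨l, hl, h⟩ := axisPoint_add_sub_mem (τ := τ) j (x, y) 1 0
    change q (axisPoint τ j (x + 1, y)) = q (axisPoint τ j (x, y))
    rw [← hq.apply_add (hN (x, y)) hl, ← h]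
    simp
  · obtain ⟨l, hl, h⟩ := axisPoint_add_sub_mem (τ := τ) j (x, y) 0 1
    change q (axisPoint τ j (x, y + 1)) = q (axisPoint τ j (x, y))
    rw [← hq.apply_add (hN (x, y)) hl, ← h]
    simp

/-- The Euler class of the line family pulled back from the `i`-th factor, evaluated on the image
by `h` of the torus parallel to the `j`-th axis: the degree of `w ↦ h i j • w` on the elliptic
curve, multiplied by `2`. -/
theorem evalTorus_axisTorus (hq : Uniformized τ N E q) {act : SL2Z →* (Y ≃ₜ Y)}
    (hact : ∀ g z, z ∉ N → act g (q z) = q (slFun g z)) {i : Fin 2}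
    {P : C(Y, (ℂ × ℂ) →L[ℂ] (ℂ × ℂ))} (hP : IsLineFamily P)
    (hPq : ∀ z, z ∉ N → P (q z) = ellipticProj τ (planeCoord i z)) (h : SL2Z) (j : Fin 2) :
    evalTorus (axisTorus hq j) (isDoublyPeriodic_axisTorus hq j)
      (H2pullback (act h : C(Y, Y)) hP.eulerClass) = 2 * (h i j * h i j) := by
  have hτ := hq.im_ne
  have hN : ∀ p, axisPoint τ j p ∉ N := fun p h =>
    axisPoint_notMem_halfLattice hq.im_ne j p (hq.subset_halfLattice h)
  have hpi : (2 * Real.pi * Complex.I : ℂ) ≠ 0 := by simp [Real.pi_ne_zero]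
  rw [evalTorus_H2pullback]
  let F : C(ℝ × ℝ, ℂ × ℂ) :=
    ⟨fun p => ellipticSection τ ((((h i 0 + h i 1) / 4 + h i j * p.1 : ℝ) : ℂ) +
      ((h i j * p.2 : ℝ) : ℂ) * τ), continuous_ellipticSection.comp (by fun_prop)⟩
  have hF : ∀ p, F p = ellipticSection τ ((((h i 0 + h i 1) / 4 + h i j * p.1 : ℝ) : ℂ) +
      ((h i j * p.2 : ℝ) : ℂ) * τ) := fun p => rfl
  let m : ℝ → ℂ := fun x =>
    -(4 * Real.pi * Complex.I * h i j * (((h i 0 + h i 1) / 4 + h i j * x : ℝ) : ℂ))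
  have key := hP.evalTorus_eulerClass _ ((isDoublyPeriodic_axisTorus hq j).comp (act h : C(Y, Y))) F
    (by
      intro p
      have h1 : ((act h : C(Y, Y)).comp (axisTorus hq j)) p = q (slFun h (axisPoint τ j p)) :=
        hact h _ (hN p)
      rw [h1, hPq _ (fun hh => hN p ((hq.slFun_mem_iff h).1 hh)), planeCoord_slFun_axisPoint]
      exact ⟨lineProj_self (ellipticSection_ne_zero _), ellipticSection_ne_zero _⟩)
    (by
      intro y
      have h1 : ∀ (z : ℂ) (a : ℤ), ellipticSection τ (z + a) = ellipticSection τ z :=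
        fun z a => by simpa using ellipticSection_add hτ a 0 z
      rw [hF, hF]
      refine Eq.trans ?_ (h1 _ (h i j))
      congr 1
      push_cast; ring)
    m (by fun_prop)
    (by
      intro x
      have h1 := ellipticSection_add hτ 0 (h i j)
        ((((h i 0 + h i 1) / 4 + h i j * x : ℝ) : ℂ) + ((h i j * (0 : ℝ) : ℝ) : ℂ) * τ)
      rw [coordX_basis hτ] at h1
      rw [hF, hF]
      convert h1 using 2
      push_cast; ring)
  have h3 : m 0 - m 1 = ((2 * (h i j * h i j) : ℤ) : ℂ) * (2 * Real.pi * Complex.I) := by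
    simp only [m]
    push_cast
    ring
  rw [h3] at key
  exact_mod_cast mul_right_cancel₀ hpi key

/-- The group is non-elementary: an element acting trivially on `H²` has entries equal to those of
`±1`, hence its square is trivial, and free groups have no torsion. -/
theorem Uniformized.nonElementary (hq : Uniformized τ N E q) {act : SL2Z →* (Y ≃ₜ Y)}
    (hact : ∀ g z, z ∉ N → act g (q z) = q (slFun g z))
    (P : Fin 2 → C(Y, (ℂ × ℂ) →L[ℂ] (ℂ × ℂ)))
    (hPq : ∀ i z, z ∉ N → P i (q z) = ellipticProj τ (planeCoord i z))
    (hP : ∀ i y, ∃ w, P i y = ellipticProj τ w) : NonElementary act.range := by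
  have hL := fun i => isLineFamily_of_ellipticProj (P i) (hP i)
  let ρ := FreeGroup.lift ![upperShear 3, lowerShear 3]
  refine ⟨((H2action Y).comp act).comp ρ, ?_, ?_⟩
  · rw [injective_iff_map_eq_one]
    intro w hw
    set h := ρ w⁻¹ with hh
    have h1 : ∀ c, H2pullback (act h : C(Y, Y)) c = H2pullback (act 1 : C(Y, Y)) c := by
      intro c
      have e1 : H2action Y (act (ρ w)) c = H2pullback ((act (ρ w)).symm : C(Y, Y)) c := rfl
      have e2 : H2action Y (act 1) c = H2pullback ((act 1).symm : C(Y, Y)) c := rfl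
      have e3 : (act (ρ w)).symm = act h := by
        rw [hh, map_inv, map_inv]; rfl
      have e4 : (act 1).symm = act 1 := by
        rw [map_one]; rfl
      rw [e3] at e1
      rw [e4] at e2
      rw [← e1, ← e2, map_one, map_one]
      exact congrArg (fun φ => φ c) hw
    have h2 : ∀ i j, h i j * h i j = (1 : SL2Z) i j * (1 : SL2Z) i j := by
      intro i j
      have e1 := evalTorus_axisTorus hq hact (hL i) (hPq i) h j
      have e2 := evalTorus_axisTorus hq hact (hL i) (hPq i) 1 j
      rw [h1, e2] at e1
      linarith
    have h00 := h2 0 0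
    have h01 := h2 0 1
    have h10 := h2 1 0
    have h11 := h2 1 1
    simp only [Matrix.SpecialLinearGroup.coe_one, Matrix.one_apply_eq, mul_one, ne_eq, zero_ne_one,
      one_ne_zero, not_false_eq_true, Matrix.one_apply_ne, mul_zero, mul_self_eq_zero]
      at h00 h01 h10 h11
    have h3 : h * h = 1 := by
      ext i j
      fin_cases i <;> fin_cases j <;>
        simp [Matrix.mul_apply, Fin.sum_univ_two, h00, h01, h10, h11]
    have h4 : (w⁻¹) ^ 2 = 1 := by
      apply lift_shears_injective
      rw [map_pow, map_one, pow_two]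
      exact h3
    have h5 : w⁻¹ = 1 := by
      rwa [pow_eq_one_iff_left two_ne_zero] at h4
    exact inv_eq_one.1 h5
  · rintro _ ⟨w, rfl⟩
    exact ⟨act (ρ w), ⟨ρ w, rfl⟩, rfl⟩

end NonElementary

/-! ### The abelian surface -/

/-- The homomorphism to the group of homeomorphisms given by a continuous action. -/
def homeoHom {G Y : Type*} [Group G] [TopologicalSpace Y] (f : G → Y → Y)
    (hc : ∀ g, Continuous (f g)) (h1 : ∀ y, f 1 y = y) (hmul : ∀ g h y, f (g * h) y = f g (f h y)) :
    G →* (Y ≃ₜ Y) where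
  toFun g :=
    { toFun := f g
      invFun := f g⁻¹
      left_inv := fun y => by rw [← hmul, inv_mul_cancel, h1]
      right_inv := fun y => by rw [← hmul, mul_inv_cancel, h1]
      continuous_toFun := hc g
      continuous_invFun := hc g⁻¹ }
  map_one' := Homeomorph.ext h1
  map_mul' g h := Homeomorph.ext (hmul g h)

theorem conj2_add (z w : ℂ × ℂ) : conj2 (z + w) = conj2 z + conj2 w := by
  apply Prod.ext <;> simp [conj2]

theorem conj2_smul (c : ℂ) (z : ℂ × ℂ) : conj2 (c • z) = (starRingEnd ℂ) c • conj2 z := by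
  apply Prod.ext <;> simp [conj2]

theorem conj2_sub (z w : ℂ × ℂ) : conj2 (z - w) = conj2 z - conj2 w := by
  apply Prod.ext <;> simp [conj2]

/-- A number of modulus one such that `l ↦ u l̄` preserves the lattice. -/
structure IsConjMultiplier (τ u : ℂ) : Prop where
  mul_conj : u * (starRingEnd ℂ) u = 1
  mem : ∀ l ∈ lattice τ, u * (starRingEnd ℂ) l ∈ lattice τ

theorem continuous_slFun (g : SL2Z) : Continuous (slFun g) := (slEquiv g).continuous

section Torus

variable {τ : ℂ}

theorem analyticAt_smul_const (u : ℂ) (z : ℂ × ℂ) : AnalyticAt ℂ (fun w : ℂ × ℂ => u • w) z :=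
  (u • ContinuousLinearMap.id ℂ (ℂ × ℂ)).analyticAt z

theorem IsConjMultiplier.smul_conj2_mem {u : ℂ} (hu : IsConjMultiplier τ u) {l : ℂ × ℂ}
    (hl : l ∈ latticeSq τ) : u • conj2 l ∈ latticeSq τ :=
  mem_latticeSq_iff.2 ⟨hu.mem _ (mem_latticeSq_iff.1 hl).1, hu.mem _ (mem_latticeSq_iff.1 hl).2⟩

theorem IsConjMultiplier.involutive {u : ℂ} (hu : IsConjMultiplier τ u) (z : ℂ × ℂ) :
    u • conj2 (u • conj2 z) = z := by
  rw [conj2_smul, conj2_conj2, smul_smul, hu.mul_conj, one_smul]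

/-- The projection of the plane onto the abelian surface. -/
def abelianMk (τ : ℂ) (z : ℂ × ℂ) : AbelianSurface τ := (z : AbelianSurface τ)

theorem isOpenQuotientMap_abelianMk : IsOpenQuotientMap (abelianMk τ) :=
  QuotientAddGroup.isOpenQuotientMap_mk

theorem abelianMk_eq_iff {z z' : ℂ × ℂ} :
    abelianMk τ z = abelianMk τ z' ↔ ∃ l ∈ latticeSq τ, z' = z + l := by
  rw [abelianMk, abelianMk, QuotientAddGroup.eq]
  constructor
  · intro h
    exact ⟨_, h, by abel⟩
  · rintro ⟨l, hl, rfl⟩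
    simpa using hl

theorem holAt_abelianMk_iff {f : AbelianSurface τ → ℂ} {z : ℂ × ℂ} :
    HolomorphicGerms.HolAt f (abelianMk τ z) ↔ AnalyticAt ℂ (fun w => f (abelianMk τ w)) z := by
  constructor
  · intro h
    exact h z rfl
  · intro h z' hz'
    obtain ⟨l, hl, rfl⟩ := abelianMk_eq_iff.1 hz'
    have h1 := AnalyticAt.fun_comp (f := fun w : ℂ × ℂ => w + l)
      (g := fun w => f (abelianMk τ w)) h (analyticAt_id.add analyticAt_const)
    have h2 : (fun w => f (abelianMk τ (w + l))) = fun w => f (abelianMk τ w) := by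
      funext w
      exact congrArg f (abelianMk_eq_iff.2 ⟨l, hl, rfl⟩).symm
    rw [h2] at h1
    exact h1

/-- The abelian surface is uniformized without centres and without involution. -/
theorem uniformized_abelian (hτ : τ.im ≠ 0) : Uniformized τ ∅ {1} (abelianMk τ) where
  im_ne := hτ
  cases := Or.inl ⟨rfl, rfl⟩
  continuousOn := isOpenQuotientMap_abelianMk.continuous.continuousOn
  isOpen_image U hU _ := isOpenQuotientMap_abelianMk.isOpenMap U hU
  eq_iff z z' _ _ := by simp [abelianMk_eq_iff]
  holAt_iff z _ f := holAt_abelianMk_iff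
  dense := by
    rw [compl_empty, image_univ, isOpenQuotientMap_abelianMk.surjective.range_eq]
    exact dense_univ

theorem t2Space_abelian (hτ : τ.im ≠ 0) : T2Space (AbelianSurface τ) :=
  haveI : IsClosed (latticeSq τ : Set (ℂ × ℂ)) := isClosed_latticeSq hτ
  inferInstance

theorem mem_span_tau_iff {z : ℂ × ℂ} :
    z ∈ (Submodule.span ℝ {((τ, 0) : ℂ × ℂ), (0, τ)} : Set (ℂ × ℂ)) ↔ z ∈ range (tauPoint τ) := by
  rw [SetLike.mem_coe, Submodule.mem_span_pair]
  constructor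
  · rintro ⟨a, b, rfl⟩
    refine ⟨![a, b], ?_⟩
    apply Prod.ext <;> simp [tauPoint, mul_comm]
  · rintro ⟨p, rfl⟩
    refine ⟨p 0, p 1, ?_⟩
    apply Prod.ext <;> simp [tauPoint, mul_comm]

theorem abelianMk_mem_SigmaA_iff (hτ : τ.im ≠ 0) {z : ℂ × ℂ} : abelianMk τ z ∈ SigmaA τ ↔
    (∃ m : ℤ, coordX τ z.1 = m) ∧ ∃ n : ℤ, coordX τ z.2 = n := by
  constructor
  · rintro ⟨w, hw, hwz⟩
    obtain ⟨p, rfl⟩ := mem_span_tau_iff.1 hw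
    obtain ⟨l, hl, rfl⟩ := abelianMk_eq_iff.1 hwz
    obtain ⟨h1, h2⟩ := mem_latticeSq_iff.1 hl
    obtain ⟨⟨m, hm⟩, -⟩ := (mem_lattice_iff_coord hτ).1 h1
    obtain ⟨⟨n, hn⟩, -⟩ := (mem_lattice_iff_coord hτ).1 h2
    refine ⟨⟨m, ?_⟩, n, ?_⟩
    · rw [Prod.fst_add, coordX_add, hm, tauPoint, coordX_mul_ofReal hτ, zero_add]
    · rw [Prod.snd_add, coordX_add, hn, tauPoint, coordX_mul_ofReal hτ, zero_add]
  · rintro ⟨⟨m, hm⟩, n, hn⟩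
    refine ⟨tauPoint τ ![coordY τ z.1, coordY τ z.2], mem_span_tau_iff.2 ⟨_, rfl⟩, ?_⟩
    refine abelianMk_eq_iff.2 ⟨((m : ℂ), (n : ℂ)), mem_latticeSq_iff.2
      ⟨mem_lattice_iff.2 ⟨m, 0, by simp⟩, mem_lattice_iff.2 ⟨n, 0, by simp⟩⟩, ?_⟩
    have h1 := coord_spec hτ z.1
    have h2 := coord_spec hτ z.2
    rw [hm] at h1
    rw [hn] at h2
    apply Prod.ext
    · conv_lhs => rw [h1]
      simp [tauPoint]; ring
    · conv_lhs => rw [h2]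
      simp [tauPoint]; ring

theorem isClosed_SigmaA (hτ : τ.im ≠ 0) : IsClosed (SigmaA τ) := by
  rw [← isOpenQuotientMap_abelianMk.isQuotientMap.isClosed_preimage]
  have h : abelianMk τ ⁻¹' SigmaA τ = ((fun z : ℂ × ℂ => coordX τ z.1) ⁻¹' range ((↑) : ℤ → ℝ)) ∩
      ((fun z : ℂ × ℂ => coordX τ z.2) ⁻¹' range ((↑) : ℤ → ℝ)) := by
    ext z
    simp [abelianMk_mem_SigmaA_iff hτ, eq_comm]
  rw [h]
  exact (Int.isClosedEmbedding_coe_real.isClosed_range.preimage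
      (continuous_coordX.comp continuous_fst)).inter
    (Int.isClosedEmbedding_coe_real.isClosed_range.preimage (continuous_coordX.comp continuous_snd))

theorem isRealImage_SigmaA (hτ : τ.im ≠ 0) : IsRealImage τ ∅ (abelianMk τ) (SigmaA τ) where
  eq_closure := by
    have h : abelianMk τ '' (range (tauPoint τ) \ ∅) = SigmaA τ := by
      rw [sdiff_empty, SigmaA]
      congr 1
      ext z
      exact mem_span_tau_iff.symm
    rw [h, (isClosed_SigmaA hτ).closure_eq]
  coord_int z _ hz := (abelianMk_mem_SigmaA_iff hτ).1 hz

/-- The map of the abelian surface induced by a map of the plane. -/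
def abelianMap (φ : ℂ × ℂ → ℂ × ℂ)
    (hφ : ∀ z, ∀ l ∈ latticeSq τ, abelianMk τ (φ (z + l)) = abelianMk τ (φ z)) :
    AbelianSurface τ → AbelianSurface τ :=
  Quotient.lift (fun z => abelianMk τ (φ z)) fun z z' h => by
    obtain ⟨l, hl, rfl⟩ := abelianMk_eq_iff.1 (Quotient.sound h : abelianMk τ z = abelianMk τ z')
    exact (hφ z l hl).symm

theorem continuous_abelianMap {φ : ℂ × ℂ → ℂ × ℂ} (hφ) (hc : Continuous φ) :
    Continuous (abelianMap (τ := τ) φ hφ) :=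
  (isOpenQuotientMap_abelianMk.continuous.comp hc).quotient_lift _

/-- The action of `SL₂(ℤ)` on the abelian surface. -/
def abelianAct (τ : ℂ) : SL2Z →* (AbelianSurface τ ≃ₜ AbelianSurface τ) :=
  homeoHom (fun g => abelianMap (slFun g) (fun z l hl => by
      rw [slFun_add]
      exact (abelianMk_eq_iff.2 ⟨_, (slFun_mem_latticeSq g).2 hl, rfl⟩).symm))
    (fun g => continuous_abelianMap _ (continuous_slFun g))
    (fun y => by
      obtain ⟨z, rfl⟩ := isOpenQuotientMap_abelianMk.surjective y
      exact congrArg (abelianMk τ) (slFun_one z))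
    (fun g h y => by
      obtain ⟨z, rfl⟩ := isOpenQuotientMap_abelianMk.surjective y
      exact congrArg (abelianMk τ) (slFun_mul g h z))

theorem abelianAct_mk (g : SL2Z) (z : ℂ × ℂ) :
    abelianAct τ g (abelianMk τ z) = abelianMk τ (slFun g z) := rfl

theorem isHolMap_abelianAct (g : SL2Z) : IsHolMap (abelianAct τ g) := by
  refine ⟨(abelianAct τ g).continuous, fun y f hf => ?_⟩
  obtain ⟨z, rfl⟩ := isOpenQuotientMap_abelianMk.surjective y
  rw [abelianAct_mk, holAt_abelianMk_iff] at hf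
  rw [holAt_abelianMk_iff]
  exact AnalyticAt.fun_comp (f := slFun g) hf ((slEquiv g : (ℂ × ℂ) →L[ℂ] (ℂ × ℂ)).analyticAt z)

/-- The line family on the abelian surface pulled back from a factor. -/
def abelianProj (hτ : τ.im ≠ 0) (i : Fin 2) :
    C(AbelianSurface τ, (ℂ × ℂ) →L[ℂ] (ℂ × ℂ)) where
  toFun := Quotient.lift (fun z => ellipticProj τ (planeCoord i z)) fun z z' h => by
    obtain ⟨l, hl, rfl⟩ := abelianMk_eq_iff.1 (Quotient.sound h : abelianMk τ z = abelianMk τ z')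
    have h1 := mem_latticeSq_iff.1 hl
    fin_cases i
    · exact (ellipticProj_add hτ h1.1).symm
    · exact (ellipticProj_add hτ h1.2).symm
  continuous_toFun := by
    refine Continuous.quotient_lift (continuous_ellipticProj.comp ?_) _
    fin_cases i
    · exact continuous_fst
    · exact continuous_snd

theorem actsErgodicallyOn_SigmaA (hτ : τ.im ≠ 0) :
    ActsErgodicallyOn (abelianAct τ).range (SigmaA τ) := by
  have hq := uniformized_abelian hτ
  refine (isRealImage_SigmaA hτ).actsErgodicallyOn hq (fun g z _ => abelianAct_mk g z)
    isHolMap_abelianAct ?_ ?_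
  · refine hq.nonElementary (fun g z _ => abelianAct_mk g z) (abelianProj hτ)
      (fun i z _ => rfl) fun i y => ?_
    obtain ⟨z, rfl⟩ := isOpenQuotientMap_abelianMk.surjective y
    exact ⟨_, rfl⟩
  · intro _ _ x _ hx
    obtain ⟨z, rfl⟩ := isOpenQuotientMap_abelianMk.surjective x
    exact absurd ⟨z, by simp, rfl⟩ hx

theorem isTotallyRealSurface_SigmaA (hτ : τ.im ≠ 0) : IsTotallyRealSurface (SigmaA τ) ∅ := by
  refine ⟨empty_subset _, fun x hx => ?_⟩
  obtain ⟨z, rfl⟩ := isOpenQuotientMap_abelianMk.surjective x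
  have hq := uniformized_abelian hτ
  have hS := isRealImage_SigmaA hτ
  obtain ⟨p, hp, hpz⟩ := hS.exists_param hq (notMem_empty z) hx
  rw [← hpz]
  obtain ⟨φ, h1, h2, h3, -⟩ := hS.exists_chart hq hp
  exact ⟨φ, h1, h2, fun _ => h3, fun h => absurd h (notMem_empty _)⟩

theorem div_conj_mem_lattice_of_abelian (hτ : τ.im ≠ 0) {s : AbelianSurface τ → AbelianSurface τ}
    (hs : IsRealStructure s) (hfix : SigmaA τ ⊆ realPart s) :
    τ / (starRingEnd ℂ) τ ∈ lattice τ := by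
  have := t2Space_abelian hτ
  have h := (uniformized_abelian hτ).conj_smul_mem_latticeSq hs.1 (fun x y _ => hfix
    ((abelianMk_mem_SigmaA_iff hτ).2 ⟨⟨0, by simp [coordX_mul_ofReal hτ]⟩,
      ⟨0, by simp [coordX_mul_ofReal hτ]⟩⟩)) (l := (1, 0))
    (mem_latticeSq_iff.2 ⟨mem_lattice_iff.2 ⟨1, 0, by simp⟩, zero_mem _⟩)
  simpa [conj2] using (mem_latticeSq_iff.1 h).1

/-- The map `z ↦ u z̄` with `u = τ / τ̄` descends to the abelian surface and fixes `τℝ²`. -/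
theorem exists_realStructure_abelian (hτ : τ.im ≠ 0)
    (hu : IsConjMultiplier τ (τ / (starRingEnd ℂ) τ)) :
    ∃ s : AbelianSurface τ → AbelianSurface τ, IsRealStructure s ∧ SigmaA τ ⊆ realPart s := by
  have hτ0 : τ ≠ 0 := by rintro rfl; exact hτ rfl
  have hτ1 : (starRingEnd ℂ) τ ≠ 0 := by simpa using hτ0
  set u := τ / (starRingEnd ℂ) τ with hudef
  let s : AbelianSurface τ → AbelianSurface τ := abelianMap (fun z => u • conj2 z)
    (fun z l hl => by
      rw [conj2_add, smul_add]
      exact (abelianMk_eq_iff.2 ⟨_, hu.smul_conj2_mem hl, rfl⟩).symm)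
  have hs : ∀ z, s (abelianMk τ z) = abelianMk τ (u • conj2 z) := fun z => rfl
  refine ⟨s, ⟨⟨continuous_abelianMap _ (continuous_conj2.const_smul u), fun y f hf => ?_⟩,
    fun y => ?_⟩, ?_⟩
  · obtain ⟨z, rfl⟩ := isOpenQuotientMap_abelianMk.surjective y
    rw [hs, holAt_abelianMk_iff] at hf
    rw [holAt_abelianMk_iff]
    exact analyticAt_conj_comp_conj2 (f := fun w => f (abelianMk τ (u • w)))
      (AnalyticAt.fun_comp (f := fun w => u • w) hf (analyticAt_smul_const u _))
  · obtain ⟨z, rfl⟩ := isOpenQuotientMap_abelianMk.surjective y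
    rw [hs, hs, hu.involutive]
  · rintro _ ⟨w, hw, rfl⟩
    obtain ⟨p, rfl⟩ := mem_span_tau_iff.1 hw
    change s (abelianMk τ (tauPoint τ p)) = abelianMk τ (tauPoint τ p)
    rw [hs]
    congr 1
    apply Prod.ext <;> simp [tauPoint, conj2, hudef] <;> field_simp

end Torus

/-! ### The projective line -/

section ProjectiveLine

open Projectivization

/-- The line of a nonzero vector. -/
def projMk (v : {v : ℂ × ℂ // v ≠ 0}) : ℙ ℂ (ℂ × ℂ) := mk ℂ v.1 v.2

theorem isOpenQuotientMap_projMk : IsOpenQuotientMap projMk where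
  surjective ℓ := by
    induction ℓ with
    | h v hv => exact ⟨⟨v, hv⟩, rfl⟩
  continuous := continuous_quotient_mk'
  isOpenMap := by
    intro U hU
    change IsOpen (projMk ⁻¹' (projMk '' U))
    let m : ℂˣ → {v : ℂ × ℂ // v ≠ 0} → {v : ℂ × ℂ // v ≠ 0} := fun c v =>
      ⟨(c : ℂ) • v.1, smul_ne_zero c.ne_zero v.2⟩
    have h : projMk ⁻¹' (projMk '' U) = ⋃ c : ℂˣ, m c ⁻¹' U := by
      ext v
      simp only [mem_preimage, mem_image, mem_iUnion, projMk, mk_eq_mk_iff]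
      constructor
      · rintro ⟨w, hw, c, hc⟩
        exact ⟨c, by rwa [show m c v = w from Subtype.ext hc]⟩
      · rintro ⟨c, hc⟩
        exact ⟨_, hc, c, rfl⟩
    rw [h]
    exact isOpen_iUnion fun c => hU.preimage
      ((continuous_subtype_val.const_smul (c : ℂ)).subtype_mk _)

theorem mk_eq_mk_iff_det {v w : ℂ × ℂ} (hv : v ≠ 0) (hw : w ≠ 0) :
    mk ℂ v hv = mk ℂ w hw ↔ v.1 * w.2 = v.2 * w.1 := by
  rw [mk_eq_mk_iff']
  constructor
  · rintro ⟨a, rfl⟩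
    simp; ring
  · intro h
    by_cases h1 : w.1 = 0
    · have h2 : w.2 ≠ 0 := fun h2 => hw (Prod.ext h1 h2)
      refine ⟨v.2 / w.2, Prod.ext ?_ ?_⟩
      · rw [h1, mul_zero] at h
        simp [h1, (mul_eq_zero.1 h).resolve_right h2]
      · simp [h2]
    · refine ⟨v.1 / w.1, Prod.ext ?_ ?_⟩
      · simp [h1]
      · simp only [Prod.smul_snd, smul_eq_mul]
        rw [div_mul_eq_mul_div, div_eq_iff h1, h]

instance : T2Space (ℙ ℂ (ℂ × ℂ)) := by
  rw [t2Space_iff_of_isOpenQuotientMap isOpenQuotientMap_projMk]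
  have h : {q : {v : ℂ × ℂ // v ≠ 0} × {v : ℂ × ℂ // v ≠ 0} | projMk q.1 = projMk q.2} =
      {q | q.1.1.1 * q.2.1.2 = q.1.1.2 * q.2.1.1} := by
    ext q
    exact mk_eq_mk_iff_det q.1.2 q.2.2
  rw [h]
  exact isClosed_eq (by fun_prop) (by fun_prop)

theorem continuousOn_projMk_comp {K : Type*} [TopologicalSpace K] {s : Set K} {f : K → ℂ × ℂ}
    {F : K → ℙ ℂ (ℂ × ℂ)} (hf : ContinuousOn f s)
    (hF : ∀ x ∈ s, ∃ h : f x ≠ 0, F x = mk ℂ (f x) h) : ContinuousOn F s := by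
  rw [continuousOn_iff_continuous_domRestrict]
  have h1 : Continuous fun x : s => (⟨f x, (hF x x.2).1⟩ : {v : ℂ × ℂ // v ≠ 0}) :=
    (continuousOn_iff_continuous_domRestrict.1 hf).subtype_mk _
  have h2 : s.domRestrict F = projMk ∘ fun x : s => ⟨f x, (hF x x.2).1⟩ := by
    funext x
    exact (hF x x.2).2
  rw [h2]
  exact isOpenQuotientMap_projMk.continuous.comp h1

/-- The coordinate of a vector that equals one on `direction b s`. -/
def lead (b : Bool) (v : ℂ × ℂ) : ℂ := if b then v.1 else v.2

/-- The coordinate of a vector that equals `s` on `direction b s`. -/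
def trail (b : Bool) (v : ℂ × ℂ) : ℂ := if b then v.2 else v.1

@[simp] theorem lead_smul_direction (b : Bool) (c s : ℂ) : lead b (c • direction b s) = c := by
  cases b <;> simp [lead, direction]

@[simp] theorem lead_direction (b : Bool) (s : ℂ) : lead b (direction b s) = 1 := by
  cases b <;> simp [lead, direction]

@[simp] theorem trail_direction (b : Bool) (s : ℂ) : trail b (direction b s) = s := by
  cases b <;> simp [trail, direction]

theorem lead_smul_direction_div (b : Bool) {v : ℂ × ℂ} (h : lead b v ≠ 0) :
    lead b v • direction b (trail b v / lead b v) = v := by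
  cases b <;> simp [lead, trail, direction] at h ⊢ <;> field_simp

theorem exists_lead_ne_zero {v : ℂ × ℂ} (hv : v ≠ 0) : ∃ b, lead b v ≠ 0 := by
  by_contra! h
  exact hv (Prod.ext (by simpa [lead] using h true) (by simpa [lead] using h false))

theorem lead_smul (b : Bool) (c : ℂ) (v : ℂ × ℂ) : lead b (c • v) = c * lead b v := by
  cases b <;> simp [lead]

theorem trail_smul (b : Bool) (c : ℂ) (v : ℂ × ℂ) : trail b (c • v) = c * trail b v := by
  cases b <;> simp [trail]

theorem analyticAt_lead (b : Bool) (v : ℂ × ℂ) : AnalyticAt ℂ (lead b) v := by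
  cases b
  · exact analyticAt_snd
  · exact analyticAt_fst

theorem analyticAt_trail (b : Bool) (v : ℂ × ℂ) : AnalyticAt ℂ (trail b) v := by
  cases b
  · exact analyticAt_fst
  · exact analyticAt_snd

theorem continuous_lead (b : Bool) : Continuous (lead b) := by
  cases b
  · exact continuous_snd
  · exact continuous_fst

theorem continuous_trail (b : Bool) : Continuous (trail b) := by
  cases b
  · exact continuous_fst
  · exact continuous_snd

theorem analyticAt_direction (b : Bool) (s : ℂ) : AnalyticAt ℂ (direction b) s := by
  cases b
  · exact analyticAt_id.prod analyticAt_const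
  · exact analyticAt_const.prod analyticAt_id

theorem continuous_direction (b : Bool) : Continuous (direction b) := by
  cases b
  · exact continuous_id.prodMk continuous_const
  · exact continuous_const.prodMk continuous_id

/-- The affine coordinate of a line. -/
def projSlope (b : Bool) (ℓ : ℙ ℂ (ℂ × ℂ)) : ℂ := trail b ℓ.rep / lead b ℓ.rep

/-- The domain of the affine coordinate. -/
def affinePart (b : Bool) : Set (ℙ ℂ (ℂ × ℂ)) := {ℓ | lead b ℓ.rep ≠ 0}

theorem projSlope_mk (b : Bool) {v : ℂ × ℂ} (hv : v ≠ 0) :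
    projSlope b (mk ℂ v hv) = trail b v / lead b v := by
  obtain ⟨a, ha⟩ := exists_smul_eq_mk_rep ℂ v hv
  rw [projSlope, ← ha, Units.smul_def, trail_smul, lead_smul, mul_div_mul_left _ _ a.ne_zero]

theorem mk_mem_affinePart (b : Bool) {v : ℂ × ℂ} (hv : v ≠ 0) :
    mk ℂ v hv ∈ affinePart b ↔ lead b v ≠ 0 := by
  obtain ⟨a, ha⟩ := exists_smul_eq_mk_rep ℂ v hv
  rw [affinePart, mem_ofPred_eq, ← ha, Units.smul_def, lead_smul]
  simp

theorem isOpen_affinePart (b : Bool) : IsOpen (affinePart b) := by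
  rw [← isOpenQuotientMap_projMk.isQuotientMap.isOpen_preimage]
  have h : projMk ⁻¹' affinePart b = {v | lead b v.1 ≠ 0} := by
    ext v
    exact mk_mem_affinePart b v.2
  rw [h]
  exact isOpen_ne_fun ((continuous_lead b).comp continuous_subtype_val) continuous_const

theorem continuousOn_projSlope (b : Bool) : ContinuousOn (projSlope b) (affinePart b) := by
  rw [isOpenQuotientMap_projMk.isQuotientMap.continuousOn_isOpen_iff (isOpen_affinePart b)]
  refine ContinuousOn.congr (f := fun v : {v : ℂ × ℂ // v ≠ 0} => trail b v.1 / lead b v.1) ?_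
    fun v hv => projSlope_mk b v.2
  exact ((continuous_trail b).comp continuous_subtype_val).continuousOn.div
    ((continuous_lead b).comp continuous_subtype_val).continuousOn
    fun v hv => (mk_mem_affinePart b v.2).1 hv

theorem mk_direction_projSlope {b : Bool} {ℓ : ℙ ℂ (ℂ × ℂ)} (h : ℓ ∈ affinePart b) :
    mk ℂ (direction b (projSlope b ℓ)) (direction_ne_zero b _) = ℓ := by
  induction ℓ with
  | h v hv =>
    rw [mk_mem_affinePart] at h
    rw [mk_eq_mk_iff', projSlope_mk]
    exact ⟨(lead b v)⁻¹, (inv_smul_eq_iff₀ h).2 (lead_smul_direction_div b h).symm⟩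

/-- A line containing a nonzero vector is the line of this vector. -/
theorem eq_mk_of_mem_submodule {ℓ : ℙ ℂ (ℂ × ℂ)} {v : ℂ × ℂ} (hv : v ≠ 0) (h : v ∈ ℓ.submodule) :
    ℓ = mk ℂ v hv := by
  induction ℓ with
  | h w hw =>
    rw [submodule_mk, Submodule.mem_span_singleton] at h
    obtain ⟨a, ha⟩ := h
    exact ((mk_eq_mk_iff' ℂ v w hv hw).2 ⟨a, ha⟩).symm

theorem continuous_projMap {σ : ℂ →+* ℂ} (A : ℂ × ℂ →ₛₗ[σ] ℂ × ℂ) (hA : Function.Injective A)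
    (hc : Continuous A) : Continuous (Projectivization.map A hA) := by
  rw [isOpenQuotientMap_projMk.isQuotientMap.continuous_iff]
  have h : Projectivization.map A hA ∘ projMk =
      projMk ∘ fun v => ⟨A v.1, fun h0 => v.2 (hA (by rw [h0, map_zero]))⟩ := rfl
  rw [h]
  exact isOpenQuotientMap_projMk.continuous.comp ((hc.comp continuous_subtype_val).subtype_mk _)

end ProjectiveLine

/-! ### The blown-up plane -/

section BlowUp

variable {τ : ℂ}

/-- A point of the blow-up is determined by its projection, and by its line at this projection if
it is a centre. -/
theorem BlownUpPlane.ext' {y y' : BlownUpPlane τ} (h : y.1.1 = y'.1.1)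
    (h' : ∀ p : halfLattice τ, (p : ℂ × ℂ) = y.1.1 → y.1.2 p = y'.1.2 p) : y = y' := by
  refine Subtype.ext (Prod.ext h (funext fun p => ?_))
  by_cases hp : (p : ℂ × ℂ) = y.1.1
  · exact h' p hp
  · have h0 : y.1.1 - (p : ℂ × ℂ) ≠ 0 := sub_ne_zero.2 (Ne.symm hp)
    exact (eq_mk_of_mem_submodule h0 (y.2 p)).trans
      (eq_mk_of_mem_submodule h0 (by rw [h]; exact y'.2 p)).symm

theorem continuousOn_blownUpPlane {K : Type*} [TopologicalSpace K] {s : Set K}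
    {f : K → BlownUpPlane τ} (h1 : ContinuousOn (fun x => (f x).1.1) s)
    (h2 : ∀ p, ContinuousOn (fun x => (f x).1.2 p) s) : ContinuousOn f s :=
  (Topology.IsInducing.mk rfl : IsInducing fun y : BlownUpPlane τ => y.1).continuousOn_iff.2
    (h1.prodMk (continuousOn_pi.2 h2))

/-- The points of the parameter plane at which no centre other than `p` is hit. -/
def chartSource (p : halfLattice τ) (b : Bool) : Set (ℂ × ℂ) :=
  {w | ∀ p' : halfLattice τ, blowPoint p b w = p' → p' = p}

theorem continuous_blowPoint (p : ℂ × ℂ) (b : Bool) : Continuous (blowPoint p b) :=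
  continuous_const.add (continuous_fst.smul ((continuous_direction b).comp continuous_snd))

theorem isClosed_otherCentres (hτ : τ.im ≠ 0) (p : halfLattice τ) :
    IsClosed {z | z ∈ halfLattice τ ∧ z ≠ p} := by
  obtain ⟨δ, hδ, hsep⟩ := exists_latticeSq_separation hτ
  have h : {z | z ∈ halfLattice τ ∧ z ≠ p} = halfLattice τ ∩ (ball (p : ℂ × ℂ) (δ / 2))ᶜ := by
    ext z
    refine and_congr_right fun hz => ?_
    rw [mem_compl_iff, mem_ball, not_lt]
    constructor
    · intro hne
      by_contra! hd
      apply hne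
      have h1 : (z + z) - (p + p) ∈ latticeSq τ := sub_mem hz p.2
      have h2 : ‖(z + z) - ((p : ℂ × ℂ) + p)‖ < δ := by
        rw [add_sub_add_comm]
        rw [dist_eq_norm] at hd
        calc _ ≤ ‖z - (p : ℂ × ℂ)‖ + ‖z - (p : ℂ × ℂ)‖ := norm_add_le _ _
          _ < δ := by linarith
      exact add_self_injective (sub_eq_zero.1 (hsep _ h1 h2))
    · rintro hd rfl
      rw [dist_self] at hd
      linarith
  rw [h]
  exact (isClosed_halfLattice hτ).inter isOpen_ball.isClosed_compl

theorem isOpen_chartSource (hτ : τ.im ≠ 0) (p : halfLattice τ) (b : Bool) :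
    IsOpen (chartSource p b) := by
  have h : chartSource p b = blowPoint p b ⁻¹' {z | z ∈ halfLattice τ ∧ z ≠ p}ᶜ := by
    ext w
    simp only [chartSource, mem_ofPred_eq, mem_preimage, mem_compl_iff, not_and, not_not]
    constructor
    · intro h hw
      exact congrArg Subtype.val (h ⟨_, hw⟩ rfl)
    · intro h p' hp'
      exact Subtype.ext (by rw [← hp']; exact h (hp' ▸ p'.2))
  rw [h]
  exact ((isClosed_otherCentres hτ p).isOpen_compl).preimage (continuous_blowPoint p b)

open scoped Classical in
/-- A vector spanning the line at `p'` of the point of parameter `w`. -/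
def slopeVec (p : halfLattice τ) (b : Bool) (p' : halfLattice τ) (w : ℂ × ℂ) : ℂ × ℂ :=
  if p' = p then direction b w.2 else blowPoint p b w - p'

theorem analyticAt_blowPoint (p : ℂ × ℂ) (b : Bool) (w : ℂ × ℂ) : AnalyticAt ℂ (blowPoint p b) w :=
  analyticAt_const.add (analyticAt_fst.smul
    (AnalyticAt.fun_comp (f := Prod.snd) (analyticAt_direction b _) analyticAt_snd))

theorem analyticAt_slopeVec (p : halfLattice τ) (b : Bool) (p' : halfLattice τ) (w : ℂ × ℂ) :
    AnalyticAt ℂ (slopeVec p b p') w := by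
  by_cases h : p' = p
  · have h1 : slopeVec p b p' = fun w => direction b w.2 := funext fun w => if_pos h
    rw [h1]
    exact AnalyticAt.fun_comp (f := Prod.snd) (analyticAt_direction b _) analyticAt_snd
  · have h1 : slopeVec p b p' = fun w => blowPoint p b w - p' := funext fun w => if_neg h
    rw [h1]
    exact (analyticAt_blowPoint _ b w).sub analyticAt_const

theorem blowChart_fst (p : halfLattice τ) (b : Bool) (w : ℂ × ℂ) :
    (blowChart τ p b w).1.1 = blowPoint p b w := rfl

theorem blowChart_slope_self (p : halfLattice τ) (b : Bool) (w : ℂ × ℂ) :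
    (blowChart τ p b w).1.2 p = Projectivization.mk ℂ (direction b w.2) (direction_ne_zero b _) :=
  dif_neg (by simp)

theorem blowChart_slope {p : halfLattice τ} {b : Bool} {w : ℂ × ℂ} (hw : w ∈ chartSource p b)
    (p' : halfLattice τ) : ∃ h : slopeVec p b p' w ≠ 0,
      (blowChart τ p b w).1.2 p' = Projectivization.mk ℂ (slopeVec p b p' w) h := by
  by_cases hp : p' = p
  · subst hp
    have h1 : slopeVec p' b p' w = direction b w.2 := if_pos rfl
    refine ⟨h1 ▸ direction_ne_zero b w.2, ?_⟩
    rw [blowChart_slope_self]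
    congr 1
    exact h1.symm
  · have h1 : slopeVec p b p' w = blowPoint p b w - p' := if_neg hp
    have h0 : blowPoint p b w - (p' : ℂ × ℂ) ≠ 0 := sub_ne_zero.2 fun h => hp (hw p' h)
    refine ⟨h1 ▸ h0, ?_⟩
    rw [eq_mk_of_mem_submodule h0 ((blowChart τ p b w).2 p')]
    congr 1
    exact h1.symm

theorem continuousOn_blowChart (p : halfLattice τ) (b : Bool) :
    ContinuousOn (blowChart τ p b) (chartSource p b) := by
  refine continuousOn_blownUpPlane (continuous_blowPoint p b).continuousOn fun p' => ?_
  exact continuousOn_projMk_comp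
    (fun w _ => (analyticAt_slopeVec p b p' w).continuousAt.continuousWithinAt)
    fun w hw => blowChart_slope hw p'

/-- The image of a standard parametrization. -/
def chartTarget (p : halfLattice τ) (b : Bool) : Set (BlownUpPlane τ) :=
  {y | (∀ p' : halfLattice τ, y.1.1 = p' → p' = p) ∧ y.1.2 p ∈ affinePart b}

/-- The inverse of a standard parametrization. -/
def invChart (p : halfLattice τ) (b : Bool) (y : BlownUpPlane τ) : ℂ × ℂ :=
  (lead b (y.1.1 - p), projSlope b (y.1.2 p))

theorem continuous_blowDown : Continuous fun y : BlownUpPlane τ => y.1.1 :=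
  continuous_fst.comp continuous_subtype_val

theorem continuous_line (p : halfLattice τ) : Continuous fun y : BlownUpPlane τ => y.1.2 p :=
  (continuous_apply p).comp (continuous_snd.comp continuous_subtype_val)

theorem isOpen_chartTarget (hτ : τ.im ≠ 0) (p : halfLattice τ) (b : Bool) :
    IsOpen (chartTarget p b) := by
  have h : {y : BlownUpPlane τ | ∀ p' : halfLattice τ, y.1.1 = p' → p' = p} =
      (fun y : BlownUpPlane τ => y.1.1) ⁻¹' {z | z ∈ halfLattice τ ∧ z ≠ p}ᶜ := by
    ext y
    simp only [mem_ofPred_eq, mem_preimage, mem_compl_iff, not_and, not_not]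
    constructor
    · intro h hw
      exact congrArg Subtype.val (h ⟨_, hw⟩ rfl)
    · intro h p' hp'
      exact Subtype.ext (by rw [← hp']; exact h (hp' ▸ p'.2))
  have h2 : IsOpen {y : BlownUpPlane τ | ∀ p' : halfLattice τ, y.1.1 = p' → p' = p} := by
    rw [h]
    exact ((isClosed_otherCentres hτ p).isOpen_compl).preimage continuous_blowDown
  exact h2.inter ((isOpen_affinePart b).preimage (continuous_line p))

theorem continuousOn_invChart (p : halfLattice τ) (b : Bool) :
    ContinuousOn (invChart p b) (chartTarget p b) :=
  ((continuous_lead b).comp (continuous_blowDown.sub continuous_const)).continuousOn.prodMk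
    ((continuousOn_projSlope b).comp (continuous_line p).continuousOn fun _ hy => hy.2)

theorem invChart_blowChart (p : halfLattice τ) (b : Bool) (w : ℂ × ℂ) :
    invChart p b (blowChart τ p b w) = w := by
  rw [invChart, blowChart_slope_self, projSlope_mk, blowChart_fst, blowPoint, add_sub_cancel_left]
  simp

theorem blowPoint_invChart {p : halfLattice τ} {b : Bool} {y : BlownUpPlane τ}
    (hy : y ∈ chartTarget p b) : blowPoint p b (invChart p b y) = y.1.1 := by
  have h1 := y.2 p
  rw [← mk_direction_projSlope hy.2, Projectivization.submodule_mk,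
    Submodule.mem_span_singleton] at h1
  obtain ⟨c, hc⟩ := h1
  rw [blowPoint, invChart]
  simp only
  rw [← hc, lead_smul_direction, hc, add_sub_cancel]

theorem invChart_mem {p : halfLattice τ} {b : Bool} {y : BlownUpPlane τ}
    (hy : y ∈ chartTarget p b) : invChart p b y ∈ chartSource p b := by
  intro p' hp'
  rw [blowPoint_invChart hy] at hp'
  exact hy.1 p' hp'

theorem blowChart_invChart {p : halfLattice τ} {b : Bool} {y : BlownUpPlane τ}
    (hy : y ∈ chartTarget p b) : blowChart τ p b (invChart p b y) = y := by
  refine BlownUpPlane.ext' (blowPoint_invChart hy) fun p' hp' => ?_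
  have h1 : p' = p := invChart_mem hy p' hp'.symm
  subst h1
  rw [blowChart_slope_self]
  exact mk_direction_projSlope hy.2

theorem blowChart_mem {p : halfLattice τ} {b : Bool} {w : ℂ × ℂ} (hw : w ∈ chartSource p b) :
    blowChart τ p b w ∈ chartTarget p b :=
  ⟨hw, by rw [blowChart_slope_self, mk_mem_affinePart]; simp⟩

theorem isOpen_blowChart_image (hτ : τ.im ≠ 0) {p : halfLattice τ} {b : Bool} {V : Set (ℂ × ℂ)}
    (hV : IsOpen V) (hVs : V ⊆ chartSource p b) : IsOpen (blowChart τ p b '' V) := by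
  have h : blowChart τ p b '' V = chartTarget p b ∩ invChart p b ⁻¹' V := by
    ext y
    constructor
    · rintro ⟨w, hw, rfl⟩
      refine ⟨blowChart_mem (hVs hw), ?_⟩
      rw [mem_preimage, invChart_blowChart]
      exact hw
    · rintro ⟨hy, hyV⟩
      exact ⟨_, hyV, blowChart_invChart hy⟩
  rw [h]
  exact (continuousOn_invChart p b).isOpen_inter_preimage (isOpen_chartTarget hτ p b) hV

/-- Every point belongs to the image of a standard parametrization; the centre may be chosen
freely if the point lies over no centre. -/
theorem exists_mem_chartTarget (y : BlownUpPlane τ) {p : halfLattice τ}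
    (hp : ∀ p' : halfLattice τ, y.1.1 = p' → p' = p) : ∃ b, y ∈ chartTarget p b := by
  generalize hℓ : y.1.2 p = ℓ
  induction ℓ with
  | h v hv =>
    obtain ⟨b, hb⟩ := exists_lead_ne_zero hv
    exact ⟨b, hp, by rw [hℓ, mk_mem_affinePart]; exact hb⟩

theorem zero_mem_halfLattice : (0 : ℂ × ℂ) ∈ halfLattice τ := by
  simp [halfLattice, zero_mem]

theorem exists_chart_eq (y : BlownUpPlane τ) :
    ∃ (p : halfLattice τ) (b : Bool) (w : ℂ × ℂ), w ∈ chartSource p b ∧ blowChart τ p b w = y := by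
  have h : ∃ p : halfLattice τ, ∀ p' : halfLattice τ, y.1.1 = p' → p' = p := by
    by_cases hy : y.1.1 ∈ halfLattice τ
    · exact ⟨⟨_, hy⟩, fun p' hp' => Subtype.ext hp'.symm⟩
    · exact ⟨⟨0, zero_mem_halfLattice⟩, fun p' hp' => absurd (hp' ▸ p'.2) hy⟩
  obtain ⟨p, hp⟩ := h
  obtain ⟨b, hb⟩ := exists_mem_chartTarget y hp
  exact ⟨p, b, _, invChart_mem hb, blowChart_invChart hb⟩

open scoped Classical in
/-- The section of the blow-up over the complement of the centres (with arbitrary lines where it is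
not determined). -/
def blowLift (τ : ℂ) (z : ℂ × ℂ) : BlownUpPlane τ :=
  ⟨(z, fun p => if h : z - (p : ℂ × ℂ) ≠ 0 then Projectivization.mk ℂ (z - (p : ℂ × ℂ)) h
      else Projectivization.mk ℂ (direction true 0) (direction_ne_zero true 0)), by
    intro p
    by_cases h : z - (p : ℂ × ℂ) ≠ 0
    · simp only [dif_pos h, Projectivization.submodule_mk]
      exact Submodule.mem_span_singleton_self _
    · rw [not_not.1 h]
      exact Submodule.zero_mem _⟩

theorem eq_blowLift {y : BlownUpPlane τ} (hy : y.1.1 ∉ halfLattice τ) : y = blowLift τ y.1.1 :=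
  BlownUpPlane.ext' rfl fun p hp => absurd (hp ▸ p.2) hy

theorem continuousOn_blowLift : ContinuousOn (blowLift τ) (halfLattice τ)ᶜ := by
  refine continuousOn_blownUpPlane continuousOn_id fun p => ?_
  refine continuousOn_projMk_comp (f := fun z => z - (p : ℂ × ℂ)) (by fun_prop) fun z hz => ?_
  have h : z - (p : ℂ × ℂ) ≠ 0 := sub_ne_zero.2 fun h => hz (h ▸ p.2)
  exact ⟨h, dif_pos h⟩

theorem isOpen_blowLift_image {U : Set (ℂ × ℂ)} (hU : IsOpen U) (hUN : U ⊆ (halfLattice τ)ᶜ) :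
    IsOpen (blowLift τ '' U) := by
  have h : blowLift τ '' U = (fun y : BlownUpPlane τ => y.1.1) ⁻¹' U := by
    ext y
    constructor
    · rintro ⟨z, hz, rfl⟩
      exact hz
    · intro hy
      exact ⟨_, hy, (eq_blowLift (hUN hy)).symm⟩
  rw [h]
  exact hU.preimage continuous_blowDown

theorem blowPoint_notMem {p : halfLattice τ} {b : Bool} {w : ℂ × ℂ} (hw : w ∈ chartSource p b)
    (h : w.1 ≠ 0) : blowPoint p b w ∉ halfLattice τ := by
  intro hp
  have h1 := congrArg Subtype.val (hw ⟨_, hp⟩ rfl)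
  simp only [blowPoint, add_eq_left, smul_eq_zero, h, false_or] at h1
  exact direction_ne_zero b _ h1

theorem blowChart_eq_blowLift {p : halfLattice τ} {b : Bool} {w : ℂ × ℂ}
    (hw : blowPoint p b w ∉ halfLattice τ) :
    blowChart τ p b w = blowLift τ (blowPoint p b w) :=
  eq_blowLift hw

theorem dense_blowLift (hτ : τ.im ≠ 0) : Dense (blowLift τ '' (halfLattice τ)ᶜ) := by
  intro y
  obtain ⟨p, b, w, hw, rfl⟩ := exists_chart_eq y
  have hd : Dense {w : ℂ × ℂ | w.1 ≠ 0} :=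
    (dense_compl_singleton (0 : ℂ)).preimage isOpenMap_fst
  have h1 : w ∈ closure (chartSource p b ∩ {w : ℂ × ℂ | w.1 ≠ 0}) :=
    hd.open_subset_closure_inter (isOpen_chartSource hτ p b) hw
  have h2 : ContinuousWithinAt (blowChart τ p b) (chartSource p b ∩ {w : ℂ × ℂ | w.1 ≠ 0}) w :=
    (continuousOn_blowChart p b w hw).mono inter_subset_left
  refine closure_mono ?_ (h2.mem_closure_image h1)
  rintro _ ⟨w', ⟨hw', hne⟩, rfl⟩
  have := blowPoint_notMem hw' hne
  exact ⟨_, this, (blowChart_eq_blowLift this).symm⟩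

/-- Continuous maps on the blow-up that agree off the exceptional curves are equal. -/
theorem ext_of_blowLift (hτ : τ.im ≠ 0) {Z : Type*} [TopologicalSpace Z] [T2Space Z]
    {F G : BlownUpPlane τ → Z} (hF : Continuous F) (hG : Continuous G)
    (h : ∀ z, z ∉ halfLattice τ → F (blowLift τ z) = G (blowLift τ z)) (y : BlownUpPlane τ) :
    F y = G y := by
  refine congrFun (hF.ext_on (dense_blowLift hτ) hG ?_) y
  rintro _ ⟨z, hz, rfl⟩
  exact h z hz

/-! ### Symmetries of the blown-up plane -/

/-- A semilinear affine map of the plane that preserves the centres and their complement. -/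
structure PlaneSym (τ : ℂ) (σ : ℂ →+* ℂ) where
  lin : ℂ × ℂ →ₛₗ[σ] ℂ × ℂ
  trans : ℂ × ℂ
  injective : Function.Injective lin
  continuous : Continuous lin
  surj : ∀ p : halfLattice τ, ∃ p' : halfLattice τ, lin p' + trans = p
  notMem : ∀ z, z ∉ halfLattice τ → lin z + trans ∉ halfLattice τ

variable {σ : ℂ →+* ℂ}

/-- The affine map. -/
def PlaneSym.fn (K : PlaneSym τ σ) (z : ℂ × ℂ) : ℂ × ℂ := K.lin z + K.trans

/-- The centre mapped to a given centre. -/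
def PlaneSym.pre (K : PlaneSym τ σ) (p : halfLattice τ) : halfLattice τ := (K.surj p).choose

theorem PlaneSym.fn_pre (K : PlaneSym τ σ) (p : halfLattice τ) : K.fn (K.pre p) = p :=
  (K.surj p).choose_spec

theorem PlaneSym.fn_notMem (K : PlaneSym τ σ) {z : ℂ × ℂ} (hz : z ∉ halfLattice τ) :
    K.fn z ∉ halfLattice τ := K.notMem z hz

theorem PlaneSym.fn_sub (K : PlaneSym τ σ) (z w : ℂ × ℂ) : K.fn z - K.fn w = K.lin (z - w) := by
  rw [fn, fn, map_sub]; abel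

/-- The lift of a symmetry to the blow-up. -/
def blowMap (K : PlaneSym τ σ) (y : BlownUpPlane τ) : BlownUpPlane τ :=
  ⟨(K.fn y.1.1, fun p => Projectivization.map K.lin K.injective (y.1.2 (K.pre p))), by
    intro p
    simp only
    rw [← K.fn_pre p, K.fn_sub]
    have h := y.2 (K.pre p)
    generalize y.1.2 (K.pre p) = ℓ at h
    induction ℓ with
    | h v hv =>
      rw [Projectivization.submodule_mk, Submodule.mem_span_singleton] at h
      obtain ⟨c, hc⟩ := h
      rw [Projectivization.map_mk, Projectivization.submodule_mk, Submodule.mem_span_singleton]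
      exact ⟨σ c, by rw [← hc, LinearMap.map_smulₛₗ]⟩⟩

theorem blowMap_fst (K : PlaneSym τ σ) (y : BlownUpPlane τ) : (blowMap K y).1.1 = K.fn y.1.1 := rfl

theorem continuous_blowMap (K : PlaneSym τ σ) : Continuous (blowMap K) := by
  refine Continuous.subtype_mk (Continuous.prodMk ?_ (continuous_pi fun p => ?_)) _
  · exact (K.continuous.comp continuous_blowDown).add continuous_const
  · exact (continuous_projMap K.lin K.injective K.continuous).comp (continuous_line _)

theorem blowMap_blowLift (K : PlaneSym τ σ) {z : ℂ × ℂ} (hz : z ∉ halfLattice τ) :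
    blowMap K (blowLift τ z) = blowLift τ (K.fn z) :=
  eq_blowLift (K.notMem z hz)

/-- The expression in standard parametrizations of the lift of a symmetry. -/
def PlaneSym.transition (K : PlaneSym τ σ) (p : halfLattice τ) (b : Bool) (p' : halfLattice τ)
    (b' : Bool) (w : ℂ × ℂ) : ℂ × ℂ :=
  (lead b' (K.fn (blowPoint p b w) - p'),
    trail b' (K.lin (slopeVec p b (K.pre p') w)) / lead b' (K.lin (slopeVec p b (K.pre p') w)))

theorem PlaneSym.transition_spec (K : PlaneSym τ σ) (hτ : τ.im ≠ 0) {p p' : halfLattice τ}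
    {b b' : Bool} {w w' : ℂ × ℂ} (hw : w ∈ chartSource p b) (hw' : w' ∈ chartSource p' b')
    (hww : blowMap K (blowChart τ p b w) = blowChart τ p' b' w') :
    lead b' (K.lin (slopeVec p b (K.pre p') w)) ≠ 0 ∧ K.transition p b p' b' w = w' ∧
      ∀ᶠ w₁ in 𝓝 w, blowMap K (blowChart τ p b w₁) =
        blowChart τ p' b' (K.transition p b p' b' w₁) := by
  have hθ : ∀ w ∈ chartSource p b,
      invChart p' b' (blowMap K (blowChart τ p b w)) = K.transition p b p' b' w := by
    intro w hw
    obtain ⟨h, hs⟩ := blowChart_slope hw (K.pre p')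
    refine Prod.ext rfl ?_
    change projSlope b' (Projectivization.map K.lin K.injective
      ((blowChart τ p b w).1.2 (K.pre p'))) = _
    rw [hs, Projectivization.map_mk, projSlope_mk]
    rfl
  have htarget : blowMap K (blowChart τ p b w) ∈ chartTarget p' b' := by
    rw [hww]; exact blowChart_mem hw'
  refine ⟨?_, by rw [← hθ w hw, hww, invChart_blowChart], ?_⟩
  · obtain ⟨h, hs⟩ := blowChart_slope hw (K.pre p')
    have h1 := htarget.2
    change Projectivization.map K.lin K.injective ((blowChart τ p b w).1.2 (K.pre p')) ∈ _ at h1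
    rw [hs, Projectivization.map_mk, mk_mem_affinePart] at h1
    exact h1
  · have hc : ContinuousAt (fun w => blowMap K (blowChart τ p b w)) w :=
      (continuous_blowMap K).continuousAt.comp ((continuousOn_blowChart p b).continuousAt
        ((isOpen_chartSource hτ p b).mem_nhds hw))
    filter_upwards [hc.eventually ((isOpen_chartTarget hτ p' b').mem_nhds htarget),
      (isOpen_chartSource hτ p b).mem_nhds hw] with w1 h1 h2
    rw [← hθ w1 h2, blowChart_invChart h1]

/-- A holomorphic symmetry of the plane lifts to a holomorphic map of the blow-up. -/
theorem analyticAt_blowMap (hτ : τ.im ≠ 0) (K : PlaneSym τ (RingHom.id ℂ)) {f : BlownUpPlane τ → ℂ}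
    {p p' : halfLattice τ} {b b' : Bool} {w w' : ℂ × ℂ} (hw : w ∈ chartSource p b)
    (hw' : w' ∈ chartSource p' b') (hww : blowMap K (blowChart τ p b w) = blowChart τ p' b' w')
    (hf : AnalyticAt ℂ (fun w => f (blowChart τ p' b' w)) w') :
    AnalyticAt ℂ (fun w => f (blowMap K (blowChart τ p b w))) w := by
  obtain ⟨hlead, hθw, hev⟩ := K.transition_spec hτ hw hw' hww
  let A : (ℂ × ℂ) →L[ℂ] (ℂ × ℂ) := ⟨K.lin, K.continuous⟩
  have hA : AnalyticAt ℂ (fun w => A (slopeVec p b (K.pre p') w)) w :=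
    AnalyticAt.fun_comp (A.analyticAt _) (analyticAt_slopeVec p b (K.pre p') w)
  have hθa : AnalyticAt ℂ (K.transition p b p' b') w := by
    refine AnalyticAt.prod ?_ ?_
    · refine AnalyticAt.fun_comp (g := lead b') (analyticAt_lead b' _) ?_
      exact ((AnalyticAt.fun_comp (A.analyticAt _) (analyticAt_blowPoint p b w)).add
        analyticAt_const).sub analyticAt_const
    · exact (AnalyticAt.fun_comp (analyticAt_trail b' _) hA).div
        (AnalyticAt.fun_comp (analyticAt_lead b' _) hA) hlead
  refine (AnalyticAt.fun_comp_of_eq hf hθa hθw).congr ?_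
  filter_upwards [hev] with w₁ h
  rw [h]

theorem lead_conj2 (b : Bool) (v : ℂ × ℂ) : lead b (conj2 v) = (starRingEnd ℂ) (lead b v) := by
  cases b <;> rfl

theorem trail_conj2 (b : Bool) (v : ℂ × ℂ) : trail b (conj2 v) = (starRingEnd ℂ) (trail b v) := by
  cases b <;> rfl

/-- An antiholomorphic symmetry of the plane lifts to an antiholomorphic map of the blow-up. -/
theorem analyticAt_conj_blowMap (hτ : τ.im ≠ 0) (K : PlaneSym τ (starRingEnd ℂ))
    {f : BlownUpPlane τ → ℂ} {p p' : halfLattice τ} {b b' : Bool} {w w' : ℂ × ℂ}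
    (hw : w ∈ chartSource p b) (hw' : w' ∈ chartSource p' b')
    (hww : blowMap K (blowChart τ p b w) = blowChart τ p' b' w')
    (hf : AnalyticAt ℂ (fun w => f (blowChart τ p' b' w)) w') :
    AnalyticAt ℂ (fun w => (starRingEnd ℂ) (f (blowMap K (blowChart τ p b w)))) w := by
  obtain ⟨hlead, hθw, hev⟩ := K.transition_spec hτ hw hw' hww
  let A : (ℂ × ℂ) →L[ℂ] (ℂ × ℂ) :=
    { toFun := fun z => conj2 (K.lin z)
      map_add' := fun z w => by rw [map_add, conj2_add]
      map_smul' := fun c z => by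
        rw [LinearMap.map_smulₛₗ, conj2_smul, Complex.conj_conj, RingHom.id_apply]
      cont := continuous_conj2.comp K.continuous }
  have hA : AnalyticAt ℂ (fun w => A (slopeVec p b (K.pre p') w)) w :=
    AnalyticAt.fun_comp (A.analyticAt _) (analyticAt_slopeVec p b (K.pre p') w)
  have hAlin : ∀ z, A z = conj2 (K.lin z) := fun z => rfl
  have hθc : ∀ w, conj2 (K.transition p b p' b' w) =
      (lead b' (A (blowPoint p b w) + conj2 K.trans - conj2 p'),
        trail b' (A (slopeVec p b (K.pre p') w)) / lead b' (A (slopeVec p b (K.pre p') w))) := by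
    intro w
    rw [hAlin, hAlin, ← conj2_add, ← conj2_sub, lead_conj2, lead_conj2, trail_conj2, ← map_div₀]
    rfl
  have hθa : AnalyticAt ℂ (fun w => conj2 (K.transition p b p' b' w)) w := by
    simp only [hθc]
    refine AnalyticAt.prod ?_ ?_
    · refine AnalyticAt.fun_comp (g := lead b') (analyticAt_lead b' _) ?_
      exact ((AnalyticAt.fun_comp (A.analyticAt _) (analyticAt_blowPoint p b w)).add
        analyticAt_const).sub analyticAt_const
    · refine (AnalyticAt.fun_comp (analyticAt_trail b' _) hA).div
        (AnalyticAt.fun_comp (analyticAt_lead b' _) hA) ?_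
      rw [hAlin, lead_conj2]
      exact (map_ne_zero _).2 hlead
  have hG := analyticAt_conj_comp_conj2 (f := fun w => f (blowChart τ p' b' w)) (p := conj2 w')
    (by rwa [conj2_conj2])
  refine (AnalyticAt.fun_comp_of_eq hG hθa (by rw [hθw])).congr ?_
  filter_upwards [hev] with w₁ h
  rw [h, conj2_conj2]

/-- The identity of the plane. -/
def PlaneSym.refl (τ : ℂ) : PlaneSym τ (RingHom.id ℂ) where
  lin := LinearMap.id
  trans := 0
  injective := Function.injective_id
  continuous := continuous_id
  surj p := ⟨p, by simp⟩
  notMem z hz := by simpa using hz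

theorem blowMap_refl (hτ : τ.im ≠ 0) (y : BlownUpPlane τ) : blowMap (PlaneSym.refl τ) y = y :=
  ext_of_blowLift hτ (continuous_blowMap _) continuous_id
    (fun z hz => by rw [blowMap_blowLift _ hz]; simp [PlaneSym.fn, PlaneSym.refl]) y

/-- Holomorphy at a point can be checked in one standard parametrization. -/
theorem holAt_blowChart_iff (hτ : τ.im ≠ 0) {f : BlownUpPlane τ → ℂ} {p : halfLattice τ} {b : Bool}
    {w : ℂ × ℂ} (hw : w ∈ chartSource p b) :
    HolomorphicGerms.HolAt f (blowChart τ p b w) ↔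
      AnalyticAt ℂ (fun w => f (blowChart τ p b w)) w := by
  constructor
  · intro h
    exact h p b w hw rfl
  · intro h p' b' w' hw' hww
    have h1 := analyticAt_blowMap hτ (PlaneSym.refl τ) hw' hw
      (by rw [blowMap_refl hτ, hww]) h
    simpa only [blowMap_refl hτ] using h1

theorem isHolMap_blowMap (hτ : τ.im ≠ 0) (K : PlaneSym τ (RingHom.id ℂ)) :
    IsHolMap (blowMap K) := by
  refine ⟨continuous_blowMap K, fun y f hf => ?_⟩
  obtain ⟨p, b, w, hw, rfl⟩ := exists_chart_eq y
  obtain ⟨p', b', w', hw', hww⟩ := exists_chart_eq (blowMap K (blowChart τ p b w))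
  rw [← hww, holAt_blowChart_iff hτ hw'] at hf
  rw [holAt_blowChart_iff hτ hw]
  exact analyticAt_blowMap hτ K hw hw' hww.symm hf

theorem isAntiHolMap_blowMap (hτ : τ.im ≠ 0) (K : PlaneSym τ (starRingEnd ℂ)) :
    IsAntiHolMap (blowMap K) := by
  refine ⟨continuous_blowMap K, fun y f hf => ?_⟩
  obtain ⟨p, b, w, hw, rfl⟩ := exists_chart_eq y
  obtain ⟨p', b', w', hw', hww⟩ := exists_chart_eq (blowMap K (blowChart τ p b w))
  rw [← hww, holAt_blowChart_iff hτ hw'] at hf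
  rw [holAt_blowChart_iff hτ hw]
  exact analyticAt_conj_blowMap hτ K hw hw' hww.symm hf

theorem holAt_blowLift_iff (hτ : τ.im ≠ 0) {f : BlownUpPlane τ → ℂ} {z : ℂ × ℂ}
    (hz : z ∉ halfLattice τ) :
    HolomorphicGerms.HolAt f (blowLift τ z) ↔ AnalyticAt ℂ (fun z => f (blowLift τ z)) z := by
  have hz0 : z ≠ 0 := fun h => hz (h ▸ zero_mem_halfLattice)
  obtain ⟨b, hb⟩ := exists_lead_ne_zero hz0
  let p : halfLattice τ := ⟨0, zero_mem_halfLattice⟩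
  let w : ℂ × ℂ → ℂ × ℂ := fun z => (lead b z, trail b z / lead b z)
  have hpw : ∀ z, lead b z ≠ 0 → blowPoint p b (w z) = z := fun z hz => by
    simp only [blowPoint, p, zero_add, w]
    exact lead_smul_direction_div b hz
  have hw : w z ∈ chartSource p b := by
    intro p' hp'
    rw [hpw z hb] at hp'
    exact absurd (hp' ▸ p'.2) hz
  have hopen := (isClosed_halfLattice hτ).isOpen_compl
  have h1 : blowChart τ p b (w z) = blowLift τ z := by
    rw [blowChart_eq_blowLift (by rw [hpw z hb]; exact hz), hpw z hb]
  rw [← h1, holAt_blowChart_iff hτ hw]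
  constructor
  · intro h
    have hwa : AnalyticAt ℂ w z :=
      (analyticAt_lead b z).prod ((analyticAt_trail b z).div (analyticAt_lead b z) hb)
    refine (AnalyticAt.fun_comp (f := w) h hwa).congr ?_
    filter_upwards [hopen.mem_nhds hz,
      (continuous_lead b).continuousAt.eventually_ne hb] with z' h2 h3
    rw [blowChart_eq_blowLift (by rw [hpw z' h3]; exact h2), hpw z' h3]
  · intro h
    have h2 : AnalyticAt ℂ (fun w' => f (blowLift τ (blowPoint p b w'))) (w z) :=
      AnalyticAt.fun_comp_of_eq (g := fun z => f (blowLift τ z)) h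
        (analyticAt_blowPoint p b (w z)) (hpw z hb)
    refine h2.congr ?_
    have hw0 : (w z).1 ≠ 0 := hb
    filter_upwards [(isOpen_chartSource hτ p b).mem_nhds hw,
      continuous_fst.continuousAt.eventually_ne hw0] with w' h3 h4
    rw [blowChart_eq_blowLift (blowPoint_notMem h3 h4)]

end BlowUp

/-! ### The Kummer surface -/

section Kummer

variable {τ : ℂ}

/-- The transformation `z ↦ ε z + l` of the plane. -/
def unitSym (ε : ℤˣ) {l : ℂ × ℂ} (hl : l ∈ latticeSq τ) : PlaneSym τ (RingHom.id ℂ) where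
  lin :=
    { toFun := fun z => (ε : ℤ) • z
      map_add' := fun z w => smul_add _ z w
      map_smul' := fun c z => smul_comm _ c z }
  trans := l
  injective := by
    intro z w h
    change (ε : ℤ) • z = (ε : ℤ) • w at h
    rcases Int.units_eq_one_or ε with rfl | rfl <;> simpa using h
  continuous := by
    change Continuous fun z : ℂ × ℂ => (ε : ℤ) • z
    exact continuous_zsmul _
  surj p := by
    refine ⟨⟨(ε : ℤ) • (p : ℂ × ℂ) + -((ε : ℤ) • l), (unit_smul_add_mem_halfLattice ε
      (neg_mem ((unit_smul_mem_latticeSq ε).2 hl))).2 p.2⟩, ?_⟩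
    change (ε : ℤ) • ((ε : ℤ) • (p : ℂ × ℂ) + -((ε : ℤ) • l)) + l = p
    rcases Int.units_eq_one_or ε with rfl | rfl <;> simp
  notMem z hz h := hz ((unit_smul_add_mem_halfLattice ε hl).1 h)

theorem unitSym_fn (ε : ℤˣ) {l : ℂ × ℂ} (hl : l ∈ latticeSq τ) (z : ℂ × ℂ) :
    (unitSym ε hl).fn z = (ε : ℤ) • z + l := rfl

theorem blowMap_unitSym_line (ε : ℤˣ) {l : ℂ × ℂ} (hl : l ∈ latticeSq τ) (y : BlownUpPlane τ)
    (p : halfLattice τ) : (blowMap (unitSym ε hl) y).1.2 p = y.1.2 ((unitSym ε hl).pre p) := by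
  change Projectivization.map _ (unitSym ε hl).injective (y.1.2 ((unitSym ε hl).pre p)) = _
  generalize y.1.2 ((unitSym ε hl).pre p) = ℓ
  induction ℓ with
  | h v hv =>
    rw [Projectivization.map_mk, Projectivization.mk_eq_mk_iff']
    exact ⟨((ε : ℤ) : ℂ), by
      change ((ε : ℤ) : ℂ) • v = (ε : ℤ) • v
      rw [Int.cast_smul_eq_zsmul]⟩

/-- The projection of the blow-up onto the Kummer surface. -/
def kummerMk (y : BlownUpPlane τ) : KummerSurface τ := Quotient.mk (kummerSetoid τ) y

theorem kummerMk_eq_iff {y y' : BlownUpPlane τ} : kummerMk y = kummerMk y' ↔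
    ∃ (ε : ℤˣ) (l : ℂ × ℂ) (hl : l ∈ latticeSq τ), y' = blowMap (unitSym ε hl) y := by
  rw [kummerMk, kummerMk, Quotient.eq]
  constructor
  · rintro ⟨ε, l, hl, h1, h2⟩
    refine ⟨ε, l, hl, BlownUpPlane.ext' h1 fun p _ => ?_⟩
    rw [blowMap_unitSym_line]
    exact h2 _ p ((unitSym ε hl).fn_pre p).symm
  · rintro ⟨ε, l, hl, rfl⟩
    refine ⟨ε, l, hl, rfl, fun p p' h => ?_⟩
    have h1 := (unitSym ε hl).fn_pre p'
    rw [h] at h1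
    have hpp : (unitSym ε hl).pre p' = p :=
      Subtype.ext ((unitSym ε hl).injective (add_right_cancel h1))
    rw [blowMap_unitSym_line, hpp]

theorem blowMap_unitSym_mem (ε : ℤˣ) {l : ℂ × ℂ} (hl : l ∈ latticeSq τ) (y : BlownUpPlane τ) :
    kummerMk (blowMap (unitSym ε hl) y) = kummerMk y :=
  (kummerMk_eq_iff.2 ⟨ε, l, hl, rfl⟩).symm

theorem isOpenQuotientMap_kummerMk :
    IsOpenQuotientMap (kummerMk : BlownUpPlane τ → KummerSurface τ) where
  surjective := Quotient.mk_surjective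
  continuous := continuous_quotient_mk'
  isOpenMap := by
    intro U hU
    change IsOpen (kummerMk ⁻¹' (kummerMk '' U))
    have h : (kummerMk ⁻¹' (kummerMk '' U) : Set (BlownUpPlane τ)) =
        ⋃ (ε : ℤˣ) (l : latticeSq τ), blowMap (unitSym ε l.2) ⁻¹' U := by
      ext y
      simp only [mem_preimage, mem_image, mem_iUnion]
      constructor
      · rintro ⟨y', hy', h⟩
        obtain ⟨ε, l, hl, rfl⟩ := kummerMk_eq_iff.1 h.symm
        exact ⟨ε, ⟨l, hl⟩, hy'⟩
      · rintro ⟨ε, l, h⟩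
        exact ⟨_, h, blowMap_unitSym_mem ε l.2 y⟩
    rw [h]
    exact isOpen_iUnion fun ε => isOpen_iUnion fun l => hU.preimage (continuous_blowMap _)

theorem t2Space_kummer (hτ : τ.im ≠ 0) : T2Space (KummerSurface τ) := by
  rw [t2Space_iff_of_isOpenQuotientMap isOpenQuotientMap_kummerMk]
  have h : {q : BlownUpPlane τ × BlownUpPlane τ | kummerMk q.1 = kummerMk q.2} =
      ⋃ ε : ℤˣ, ⋃ l : latticeSq τ, {q | q.2 = blowMap (unitSym ε l.2) q.1} := by
    ext q
    simp only [mem_ofPred_eq, mem_iUnion, kummerMk_eq_iff]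
    exact exists_congr fun ε => ⟨fun ⟨l, hl, h⟩ => ⟨⟨l, hl⟩, h⟩, fun ⟨l, h⟩ => ⟨l, l.2, h⟩⟩
  rw [h]
  obtain ⟨δ, hδ, hsep⟩ := exists_latticeSq_separation hτ
  refine isClosed_iUnion_of_finite fun ε => LocallyFinite.isClosed_iUnion ?_ fun l =>
    isClosed_eq continuous_snd ((continuous_blowMap _).comp continuous_fst)
  -- near a given pair of points, at most one translation occurs
  intro q₀
  let d : BlownUpPlane τ × BlownUpPlane τ → ℂ × ℂ := fun q => q.2.1.1 - (ε : ℤ) • q.1.1.1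
  have hd : Continuous d := (continuous_blowDown.comp continuous_snd).sub
    ((continuous_zsmul _).comp (continuous_blowDown.comp continuous_fst))
  refine ⟨d ⁻¹' ball (d q₀) (δ / 2),
    (isOpen_ball.preimage hd).mem_nhds (mem_ball_self (by positivity)), ?_⟩
  refine Set.Subsingleton.finite ?_
  have hl : ∀ (l : latticeSq τ) (q : BlownUpPlane τ × BlownUpPlane τ),
      q.2 = blowMap (unitSym ε l.2) q.1 → d q = l := by
    intro l q hq
    simp only [d]
    rw [hq, blowMap_fst, unitSym_fn, add_sub_cancel_left]
  rintro l ⟨q, hq, hqb⟩ l' ⟨q', hq', hqb'⟩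
  rw [mem_preimage, hl l q hq] at hqb
  rw [mem_preimage, hl l' q' hq'] at hqb'
  refine Subtype.ext (sub_eq_zero.1 (hsep _ (sub_mem l.2 l'.2) ?_))
  rw [← dist_eq_norm]
  calc dist (l : ℂ × ℂ) l' ≤ dist (l : ℂ × ℂ) (d q₀) + dist (l' : ℂ × ℂ) (d q₀) :=
        dist_triangle_right _ _ _
    _ < δ := by
      rw [mem_ball] at hqb hqb'
      linarith

theorem holAt_kummerMk_iff (hτ : τ.im ≠ 0) {f : KummerSurface τ → ℂ} {y : BlownUpPlane τ} :
    HolomorphicGerms.HolAt f (kummerMk y) ↔ HolomorphicGerms.HolAt (fun y => f (kummerMk y)) y := by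
  constructor
  · intro h
    exact h y rfl
  · intro h y' hy'
    obtain ⟨ε, l, hl, rfl⟩ := kummerMk_eq_iff.1 hy'
    have h1 := (isHolMap_blowMap hτ (unitSym ε hl)).2 y' _ h
    simp only [blowMap_unitSym_mem] at h1
    exact h1

/-- The map from the plane to the Kummer surface, meaningful off the centres. -/
def kummerLift (τ : ℂ) (z : ℂ × ℂ) : KummerSurface τ := kummerMk (blowLift τ z)

theorem kummerMk_eq_kummerLift {y : BlownUpPlane τ} (hy : y.1.1 ∉ halfLattice τ) :
    kummerMk y = kummerLift τ y.1.1 := congrArg kummerMk (eq_blowLift hy)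

/-- Off the exceptional curves the Kummer surface is the quotient of the plane, without the half
lattice, by `Λ² ⋊ {±1}`. -/
theorem uniformized_kummer (hτ : τ.im ≠ 0) :
    Uniformized τ (halfLattice τ) univ (kummerLift τ) where
  im_ne := hτ
  cases := Or.inr ⟨rfl, rfl⟩
  continuousOn := isOpenQuotientMap_kummerMk.continuous.comp_continuousOn continuousOn_blowLift
  isOpen_image U hU hUN := by
    have h : kummerLift τ '' U = kummerMk '' (blowLift τ '' U) := by rw [image_image]; rfl
    rw [h]
    exact isOpenQuotientMap_kummerMk.isOpenMap _ (isOpen_blowLift_image hU hUN)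
  eq_iff z z' hz hz' := by
    rw [kummerLift, kummerLift, kummerMk_eq_iff]
    constructor
    · rintro ⟨ε, l, hl, h⟩
      exact ⟨ε, trivial, l, hl, congrArg (fun y : BlownUpPlane τ => y.1.1) h⟩
    · rintro ⟨ε, -, l, hl, rfl⟩
      exact ⟨ε, l, hl, (blowMap_blowLift (unitSym ε hl) hz).symm⟩
  holAt_iff z hz f := by
    rw [kummerLift, holAt_kummerMk_iff hτ, holAt_blowLift_iff hτ hz]
    rfl
  dense := by
    have h : kummerLift τ '' (halfLattice τ)ᶜ = kummerMk '' (blowLift τ '' (halfLattice τ)ᶜ) := by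
      rw [image_image]; rfl
    rw [h]
    exact isOpenQuotientMap_kummerMk.surjective.denseRange.dense_image
      isOpenQuotientMap_kummerMk.continuous (dense_blowLift hτ)

/-! ### The real surface in the Kummer surface -/

theorem kummerMk_mem_exceptionalLocus_iff {y : BlownUpPlane τ} :
    kummerMk y ∈ exceptionalLocus τ ↔ y.1.1 ∈ halfLattice τ := by
  have h1 : y.1.1 ∈ halfLattice τ ↔ -abelianMk τ y.1.1 = abelianMk τ y.1.1 := by
    rw [mem_halfLattice_iff, show -abelianMk τ y.1.1 = abelianMk τ (-y.1.1) from rfl,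
      abelianMk_eq_iff]
    constructor
    · intro h
      exact ⟨_, h, by abel⟩
    · rintro ⟨l, hl, h⟩
      rwa [show y.1.1 + y.1.1 = l by nth_rewrite 1 [h]; abel]
  rw [h1]
  constructor
  · rintro ⟨a, ha, h⟩
    rcases (Quotient.exact h : abelianMk τ y.1.1 = a ∨ abelianMk τ y.1.1 = -a) with h' | h'
    · exact (congrArg (fun x => -x = x) h').mpr ha
    · exact (congrArg (fun x => -x = x) (h'.trans ha)).mpr ha
  · intro h
    exact ⟨_, h, rfl⟩

theorem neg_mem_SigmaA (hτ : τ.im ≠ 0) {a : AbelianSurface τ} (ha : a ∈ SigmaA τ) :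
    -a ∈ SigmaA τ := by
  obtain ⟨z, rfl⟩ := isOpenQuotientMap_abelianMk.surjective a
  obtain ⟨⟨m, hm⟩, n, hn⟩ := (abelianMk_mem_SigmaA_iff hτ).1 ha
  exact (abelianMk_mem_SigmaA_iff (z := -z) hτ).2 ⟨⟨-m, by simp [coordX_neg, hm]⟩,
    -n, by simp [coordX_neg, hn]⟩

theorem resolution_kummerMk_mem_Sigma0_iff (hτ : τ.im ≠ 0) {y : BlownUpPlane τ} :
    resolution τ (kummerMk y) ∈ Sigma0 τ ↔
      (∃ m : ℤ, coordX τ y.1.1.1 = m) ∧ ∃ n : ℤ, coordX τ y.1.1.2 = n := by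
  rw [← abelianMk_mem_SigmaA_iff hτ]
  constructor
  · rintro ⟨a, ha, h⟩
    rcases (Quotient.exact h : abelianMk τ y.1.1 = a ∨ abelianMk τ y.1.1 = -a) with h' | h'
    · exact (congrArg (· ∈ SigmaA τ) h').mpr ha
    · exact (congrArg (· ∈ SigmaA τ) h').mpr (neg_mem_SigmaA hτ ha)
  · intro h
    exact ⟨_, h, rfl⟩

theorem isClosed_resolution_Sigma0 (hτ : τ.im ≠ 0) : IsClosed (resolution τ ⁻¹' Sigma0 τ) := by
  rw [← isOpenQuotientMap_kummerMk.isQuotientMap.isClosed_preimage]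
  have h : kummerMk ⁻¹' (resolution τ ⁻¹' Sigma0 τ) =
      (fun y : BlownUpPlane τ => y.1.1) ⁻¹' (abelianMk τ ⁻¹' SigmaA τ) := by
    ext y
    exact (resolution_kummerMk_mem_Sigma0_iff hτ).trans (abelianMk_mem_SigmaA_iff hτ).symm
  rw [h]
  exact ((isClosed_SigmaA hτ).preimage isOpenQuotientMap_abelianMk.continuous).preimage
    continuous_blowDown

theorem SigmaX_subset (hτ : τ.im ≠ 0) : SigmaX τ ⊆ resolution τ ⁻¹' Sigma0 τ :=
  closure_minimal (fun _ hx => hx.1) (isClosed_resolution_Sigma0 hτ)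

theorem isRealImage_SigmaX (hτ : τ.im ≠ 0) :
    IsRealImage τ (halfLattice τ) (kummerLift τ) (SigmaX τ) where
  eq_closure := by
    rw [SigmaX]
    congr 1
    ext x
    obtain ⟨y, rfl⟩ := isOpenQuotientMap_kummerMk.surjective x
    constructor
    · rintro ⟨h1, h2⟩
      have hy : y.1.1 ∉ halfLattice τ := fun h => h2 (kummerMk_mem_exceptionalLocus_iff.2 h)
      change resolution τ (kummerMk y) ∈ Sigma0 τ at h1
      rw [resolution_kummerMk_mem_Sigma0_iff hτ, ← abelianMk_mem_SigmaA_iff hτ] at h1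
      obtain ⟨w, hw, hwy⟩ := h1
      obtain ⟨p, rfl⟩ := mem_span_tau_iff.1 hw
      obtain ⟨l, hl, h⟩ := abelianMk_eq_iff.1 hwy
      have hp : tauPoint τ p ∉ halfLattice τ := by
        rw [h, (uniformized_kummer hτ).add_mem_iff hl] at hy
        exact hy
      refine ⟨_, ⟨⟨p, rfl⟩, hp⟩, ?_⟩
      rw [kummerMk_eq_kummerLift hy, h, (uniformized_kummer hτ).apply_add hp hl]
    · rintro ⟨_, ⟨⟨p, rfl⟩, hp⟩, h⟩
      rw [← h]
      refine ⟨(resolution_kummerMk_mem_Sigma0_iff hτ).2 ⟨⟨0, ?_⟩, 0, ?_⟩,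
        fun h => hp (kummerMk_mem_exceptionalLocus_iff.1 h)⟩
      · exact (coordX_mul_ofReal hτ (p 0)).trans (by simp)
      · exact (coordX_mul_ofReal hτ (p 1)).trans (by simp)
  coord_int z _ hz := (resolution_kummerMk_mem_Sigma0_iff hτ).1 (SigmaX_subset hτ hz)

/-! ### Maps of the Kummer surface -/

/-- The map of the Kummer surface induced by a map of the blow-up. -/
def kummerMap (F : BlownUpPlane τ → BlownUpPlane τ)
    (hF : ∀ (ε : ℤˣ) (l : ℂ × ℂ) (hl : l ∈ latticeSq τ) (y : BlownUpPlane τ),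
      kummerMk (F (blowMap (unitSym ε hl) y)) = kummerMk (F y)) :
    KummerSurface τ → KummerSurface τ :=
  Quotient.lift (fun y => kummerMk (F y)) fun y y' h => by
    obtain ⟨ε, l, hl, rfl⟩ := kummerMk_eq_iff.1 (Quotient.sound h : kummerMk y = kummerMk y')
    exact (hF ε l hl y).symm

theorem continuous_kummerMap {F : BlownUpPlane τ → BlownUpPlane τ} (hF) (hc : Continuous F) :
    Continuous (kummerMap F hF) :=
  (isOpenQuotientMap_kummerMk.continuous.comp hc).quotient_lift _

/-- The symmetry of the blow-up given by an element of `SL₂(ℤ)`. -/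
def slSym (τ : ℂ) (g : SL2Z) : PlaneSym τ (RingHom.id ℂ) where
  lin := (slEquiv g).toLinearEquiv.toLinearMap
  trans := 0
  injective := (slEquiv g).injective
  continuous := (slEquiv g).continuous
  surj p := ⟨⟨slFun g⁻¹ p, (slFun_mem_halfLattice g⁻¹).2 p.2⟩, by simp⟩
  notMem z hz h := hz ((slFun_mem_halfLattice g).1 (by simpa using h))

theorem slSym_fn (g : SL2Z) (z : ℂ × ℂ) : (slSym τ g).fn z = slFun g z := add_zero _

/-- The antiholomorphic symmetry `z ↦ u z̄`. -/
def conjSym {u : ℂ} (hu : IsConjMultiplier τ u) : PlaneSym τ (starRingEnd ℂ) where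
  lin :=
    { toFun := fun z => u • conj2 z
      map_add' := fun z w => by rw [conj2_add, smul_add]
      map_smul' := fun c z => by rw [conj2_smul, smul_comm] }
  trans := 0
  injective := Function.LeftInverse.injective (g := fun z => u • conj2 z) hu.involutive
  continuous := continuous_conj2.const_smul u
  surj p := ⟨⟨u • conj2 p, by
      have h := hu.smul_conj2_mem p.2
      rwa [conj2_add, smul_add] at h⟩, by
    change u • conj2 (u • conj2 (p : ℂ × ℂ)) + 0 = p
    rw [hu.involutive, add_zero]⟩
  notMem z hz h := hz (by
    have h1 : u • conj2 z + 0 ∈ halfLattice τ := h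
    rw [add_zero, mem_halfLattice_iff, ← smul_add, ← conj2_add] at h1
    have h2 := hu.smul_conj2_mem h1
    rwa [hu.involutive] at h2)

theorem conjSym_fn {u : ℂ} (hu : IsConjMultiplier τ u) (z : ℂ × ℂ) :
    (conjSym hu).fn z = u • conj2 z := add_zero _

/-- A symmetry of the plane that normalizes the group of the transformations `z ↦ ε z + l`
descends to the Kummer surface. -/
theorem kummerMk_blowMap_unitSym (hτ : τ.im ≠ 0) {σ : ℂ →+* ℂ} (K : PlaneSym τ σ)
    (hK : ∀ l ∈ latticeSq τ, K.lin l ∈ latticeSq τ) (ε : ℤˣ) (l : ℂ × ℂ) (hl : l ∈ latticeSq τ)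
    (ht : K.trans = 0) (y : BlownUpPlane τ) :
    kummerMk (blowMap K (blowMap (unitSym ε hl) y)) = kummerMk (blowMap K y) := by
  have h : blowMap K (blowMap (unitSym ε hl) y) =
      blowMap (unitSym ε (hK l hl)) (blowMap K y) := by
    refine ext_of_blowLift hτ ((continuous_blowMap _).comp (continuous_blowMap _))
      ((continuous_blowMap _).comp (continuous_blowMap _)) (fun z hz => ?_) y
    simp only [Function.comp_apply]
    rw [blowMap_blowLift _ hz, blowMap_blowLift _ hz,
      blowMap_blowLift _ ((unitSym ε hl).fn_notMem hz), blowMap_blowLift _ (K.fn_notMem hz),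
      unitSym_fn, unitSym_fn]
    congr 1
    simp only [PlaneSym.fn, ht, add_zero, map_add]
    rcases Int.units_eq_one_or ε with rfl | rfl <;> simp
  rw [h, blowMap_unitSym_mem]

/-- The action of `SL₂(ℤ)` on the Kummer surface. -/
def kummerAct (hτ : τ.im ≠ 0) : SL2Z →* (KummerSurface τ ≃ₜ KummerSurface τ) :=
  homeoHom (fun g => kummerMap (blowMap (slSym τ g)) (fun ε l hl => kummerMk_blowMap_unitSym hτ _
      (fun _ h => (slFun_mem_latticeSq g).2 h) ε l hl rfl))
    (fun g => continuous_kummerMap _ (continuous_blowMap _))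
    (fun x => by
      obtain ⟨y, rfl⟩ := isOpenQuotientMap_kummerMk.surjective x
      refine congrArg kummerMk (ext_of_blowLift hτ (continuous_blowMap _) continuous_id
        (fun z hz => ?_) y)
      rw [blowMap_blowLift _ hz, slSym_fn, slFun_one]; rfl)
    (fun g h x => by
      obtain ⟨y, rfl⟩ := isOpenQuotientMap_kummerMk.surjective x
      refine congrArg kummerMk (ext_of_blowLift hτ (continuous_blowMap _)
        ((continuous_blowMap (slSym τ g)).comp (continuous_blowMap (slSym τ h))) (fun z hz => ?_) y)
      rw [blowMap_blowLift _ hz, Function.comp_apply, blowMap_blowLift _ hz,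
        blowMap_blowLift _ ((slSym τ h).fn_notMem hz), slSym_fn, slSym_fn, slSym_fn, slFun_mul])

theorem kummerAct_mk (hτ : τ.im ≠ 0) (g : SL2Z) (y : BlownUpPlane τ) :
    kummerAct hτ g (kummerMk y) = kummerMk (blowMap (slSym τ g) y) := rfl

theorem kummerAct_kummerLift (hτ : τ.im ≠ 0) (g : SL2Z) {z : ℂ × ℂ} (hz : z ∉ halfLattice τ) :
    kummerAct hτ g (kummerLift τ z) = kummerLift τ (slFun g z) := by
  rw [kummerLift, kummerAct_mk, blowMap_blowLift _ hz, slSym_fn, kummerLift]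

theorem isHolMap_kummerAct (hτ : τ.im ≠ 0) (g : SL2Z) : IsHolMap (kummerAct hτ g) := by
  refine ⟨(kummerAct hτ g).continuous, fun x f hf => ?_⟩
  obtain ⟨y, rfl⟩ := isOpenQuotientMap_kummerMk.surjective x
  rw [kummerAct_mk, holAt_kummerMk_iff hτ] at hf
  rw [holAt_kummerMk_iff hτ]
  exact (isHolMap_blowMap hτ (slSym τ g)).2 y _ hf

/-- The line family on the Kummer surface pulled back from a factor. -/
def kummerProj (hτ : τ.im ≠ 0) (i : Fin 2) : C(KummerSurface τ, (ℂ × ℂ) →L[ℂ] (ℂ × ℂ)) where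
  toFun := Quotient.lift (fun y : BlownUpPlane τ => ellipticProj τ (planeCoord i y.1.1))
    fun y y' h => by
      obtain ⟨ε, l, hl, rfl⟩ := kummerMk_eq_iff.1 (Quotient.sound h : kummerMk y = kummerMk y')
      have h1 := mem_latticeSq_iff.1 hl
      fin_cases i
      · exact (ellipticProj_units_smul_add hτ ε h1.1).symm
      · exact (ellipticProj_units_smul_add hτ ε h1.2).symm
  continuous_toFun := by
    refine Continuous.quotient_lift (continuous_ellipticProj.comp ?_) _
    fin_cases i
    · exact continuous_fst.comp continuous_blowDown
    · exact continuous_snd.comp continuous_blowDown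

theorem nonElementary_kummerAct (hτ : τ.im ≠ 0) : NonElementary (kummerAct hτ).range := by
  refine (uniformized_kummer hτ).nonElementary (fun g z hz => kummerAct_kummerLift hτ g hz)
    (kummerProj hτ) (fun i z _ => rfl) fun i x => ?_
  obtain ⟨y, rfl⟩ := isOpenQuotientMap_kummerMk.surjective x
  exact ⟨_, rfl⟩

/-! ### Real structures on the Kummer surface -/

theorem div_conj_mem_lattice_of_kummer (hτ : τ.im ≠ 0) {s : KummerSurface τ → KummerSurface τ}
    (hs : IsRealStructure s) (hfix : SigmaX τ ⊆ realPart s) :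
    τ / (starRingEnd ℂ) τ ∈ lattice τ := by
  have := t2Space_kummer hτ
  have h := (uniformized_kummer hτ).conj_smul_mem_latticeSq hs.1 (fun x y hxy => hfix
    ((isRealImage_SigmaX hτ).mem_complexify (p := (x, y)) hxy)) (l := (1, 0))
    (mem_latticeSq_iff.2 ⟨mem_lattice_iff.2 ⟨1, 0, by simp⟩, zero_mem _⟩)
  simpa [conj2] using (mem_latticeSq_iff.1 h).1

/-- The map `z ↦ u z̄` with `u = τ / τ̄` extends to the blow-up and descends to the Kummer surface;
it fixes the image of `τℝ²`, hence its closure. -/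
theorem exists_realStructure_kummer (hτ : τ.im ≠ 0)
    (hu : IsConjMultiplier τ (τ / (starRingEnd ℂ) τ)) :
    ∃ s : KummerSurface τ → KummerSurface τ, IsRealStructure s ∧ SigmaX τ ⊆ realPart s := by
  have hτ0 : τ ≠ 0 := by rintro rfl; exact hτ rfl
  have hτ1 : (starRingEnd ℂ) τ ≠ 0 := by simpa using hτ0
  let K := conjSym hu
  let s : KummerSurface τ → KummerSurface τ := kummerMap (blowMap K)
    (fun ε l hl => kummerMk_blowMap_unitSym hτ _ (fun _ h => hu.smul_conj2_mem h) ε l hl rfl)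
  have hs : ∀ y, s (kummerMk y) = kummerMk (blowMap K y) := fun y => rfl
  have hsc : Continuous s := continuous_kummerMap _ (continuous_blowMap _)
  refine ⟨s, ⟨⟨hsc, fun x f hf => ?_⟩, fun x => ?_⟩, ?_⟩
  · obtain ⟨y, rfl⟩ := isOpenQuotientMap_kummerMk.surjective x
    rw [hs, holAt_kummerMk_iff hτ] at hf
    rw [holAt_kummerMk_iff hτ]
    exact (isAntiHolMap_blowMap hτ K).2 y _ hf
  · obtain ⟨y, rfl⟩ := isOpenQuotientMap_kummerMk.surjective x
    rw [hs, hs]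
    refine congrArg kummerMk (ext_of_blowLift hτ
      ((continuous_blowMap K).comp (continuous_blowMap K)) continuous_id (fun z hz => ?_) y)
    rw [Function.comp_apply, blowMap_blowLift _ hz, blowMap_blowLift _ (K.fn_notMem hz),
      conjSym_fn, conjSym_fn, hu.involutive]
    rfl
  · have := t2Space_kummer hτ
    rw [(isRealImage_SigmaX hτ).eq_closure]
    refine closure_minimal ?_ (isClosed_eq hsc continuous_id)
    rintro _ ⟨_, ⟨⟨p, rfl⟩, hp⟩, rfl⟩
    change s (kummerLift τ (tauPoint τ p)) = kummerLift τ (tauPoint τ p)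
    rw [kummerLift, hs, blowMap_blowLift _ hp, conjSym_fn]
    congr 2
    apply Prod.ext <;> simp [tauPoint, conj2] <;> field_simp

end Kummer

/-! ### The Kummer surface along the exceptional curves -/

section Edge

variable {τ : ℂ}

/-- Two small vectors are not congruent modulo the lattice, and their real coordinates along `1`
are smaller than `1`. -/
theorem exists_small_radius (hτ : τ.im ≠ 0) :
    ∃ κ > 0, κ ≤ 1 / 2 ∧ (∀ d d' : ℂ × ℂ, ‖d‖ < κ → ‖d'‖ < κ →
      τ • d - τ • d' ∈ latticeSq τ → d = d') ∧
      ∀ d : ℂ × ℂ, ‖d‖ < κ → |coordX τ (τ * d.1)| < 1 ∧ |coordX τ (τ * d.2)| < 1 := by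
  have hτ0 : τ ≠ 0 := by rintro rfl; exact hτ rfl
  obtain ⟨δ, hδ, hsep⟩ := exists_latticeSq_separation hτ
  have h1 : Continuous fun d : ℂ × ℂ => ‖τ • d‖ := (continuous_const_smul τ).norm
  have h2 : Continuous fun d : ℂ × ℂ => |coordX τ (τ * d.1)| :=
    (continuous_coordX.comp (continuous_const.mul continuous_fst)).abs
  have h3 : Continuous fun d : ℂ × ℂ => |coordX τ (τ * d.2)| :=
    (continuous_coordX.comp (continuous_const.mul continuous_snd)).abs
  have h0 : coordX τ 0 = 0 := by simp [coordX]
  have hev : ∀ᶠ d : ℂ × ℂ in 𝓝 0,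
      ‖τ • d‖ < δ / 2 ∧ |coordX τ (τ * d.1)| < 1 ∧ |coordX τ (τ * d.2)| < 1 := by
    refine ((h1.tendsto 0).eventually_lt_const ?_).and
      (((h2.tendsto 0).eventually_lt_const ?_).and ((h3.tendsto 0).eventually_lt_const ?_))
    · simpa using hδ
    · simp [h0]
    · simp [h0]
  obtain ⟨r, hr, h⟩ := Metric.eventually_nhds_iff.1 hev
  have hn : ∀ d : ℂ × ℂ, ‖d‖ < min r (1 / 2) → dist d 0 < r := fun d hd => by
    rw [dist_zero_right]; exact hd.trans_le (min_le_left _ _)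
  refine ⟨min r (1 / 2), by positivity, min_le_right _ _, fun d d' hd hd' hl => ?_,
    fun d hd => (h (hn d hd)).2⟩
  have h4 : ‖τ • d - τ • d'‖ < δ := by
    calc _ ≤ ‖τ • d‖ + ‖τ • d'‖ := norm_sub_le _ _
      _ < δ := by linarith [(h (hn d hd)).1, (h (hn d' hd')).1]
  exact smul_right_injective _ hτ0 (sub_eq_zero.1 (hsep _ hl h4))

/-- The data of a standard parametrization of the blow-up around the exceptional curve over a real
centre, restricted to a small polydisc. -/
structure EdgeChart (τ : ℂ) where
  im_ne : τ.im ≠ 0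
  /-- The real coordinates of the centre. -/
  base : ℝ × ℝ
  base_mem : τ • complexify base ∈ halfLattice τ
  /-- The family of directions. -/
  b : Bool
  /-- A bound for the slopes. -/
  R : ℝ
  R_pos : 0 < R
  /-- A bound for the distance to the centre. -/
  κ : ℝ
  κ_pos : 0 < κ
  κ_le : κ ≤ 1 / 2
  sep : ∀ d d' : ℂ × ℂ, ‖d‖ < κ → ‖d'‖ < κ → τ • d - τ • d' ∈ latticeSq τ → d = d'
  coord : ∀ d : ℂ × ℂ, ‖d‖ < κ → |coordX τ (τ * d.1)| < 1 ∧ |coordX τ (τ * d.2)| < 1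

/-- A centre fixed by a symmetry. -/
theorem PlaneSym.pre_eq {σ : ℂ →+* ℂ} (K : PlaneSym τ σ) {p : halfLattice τ}
    (h : K.fn p = p) : K.pre p = p := by
  have h1 := K.fn_pre p
  rw [← h] at h1
  exact Subtype.ext (K.injective (add_right_cancel h1))

namespace EdgeChart

theorem ne_zero (C : EdgeChart τ) : τ ≠ 0 := by
  rintro rfl
  exact C.im_ne rfl

variable (C : EdgeChart τ)

/-- The centre. -/
def centre : halfLattice τ := ⟨τ • complexify C.base, C.base_mem⟩

/-- The polydisc. -/
def disc : Set (ℂ × ℂ) := {w | ‖w.1‖ < C.κ / (C.R + 1) ∧ ‖w.2‖ < C.R}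

/-- The difference between a point and the centre, divided by `τ`. -/
def offset (w : ℂ × ℂ) : ℂ × ℂ := w.1 • direction C.b w.2

/-- The parametrization of the blow-up. -/
def up (w : ℂ × ℂ) : BlownUpPlane τ := blowChart τ C.centre C.b (τ * w.1, w.2)

/-- The parametrization of the Kummer surface, of degree two. -/
def par (w : ℂ × ℂ) : KummerSurface τ := kummerMk (C.up w)

theorem up_fst (w : ℂ × ℂ) : (C.up w).1.1 = (C.centre : ℂ × ℂ) + τ • C.offset w := by
  rw [up, blowChart_fst, blowPoint, offset, mul_smul]

theorem isOpen_disc : IsOpen C.disc :=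
  (isOpen_lt continuous_fst.norm continuous_const).inter
    (isOpen_lt continuous_snd.norm continuous_const)

theorem neg_mem_disc {w : ℂ × ℂ} (hw : w ∈ C.disc) : (-w.1, w.2) ∈ C.disc := by
  simpa [disc] using hw

theorem norm_offset_lt {w : ℂ × ℂ} (hw : w ∈ C.disc) : ‖C.offset w‖ < C.κ := by
  have hR := C.R_pos
  have h1 : ‖direction C.b w.2‖ ≤ C.R + 1 := by
    have h2 : ‖w.2‖ ≤ C.R + 1 := by linarith [hw.2]
    cases C.b <;> simp [direction, Prod.norm_def, h2, hR.le]
  have h3 := hw.1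
  rw [lt_div_iff₀ (by positivity)] at h3
  rw [offset, norm_smul]
  exact (mul_le_mul_of_nonneg_left h1 (norm_nonneg _)).trans_lt h3

theorem lead_offset (w : ℂ × ℂ) : lead C.b (C.offset w) = w.1 := by
  rw [offset, lead_smul, lead_direction, mul_one]

theorem trail_offset (w : ℂ × ℂ) : trail C.b (C.offset w) = w.1 * w.2 := by
  rw [offset, trail_smul, trail_direction]

theorem offset_neg (w : ℂ × ℂ) : C.offset (-w.1, w.2) = -C.offset w := by
  simp [offset]

theorem offset_eq_zero {w : ℂ × ℂ} : C.offset w = 0 ↔ w.1 = 0 := by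
  simp [offset, direction_ne_zero]

theorem up_mem_halfLattice {w : ℂ × ℂ} (hw : w ∈ C.disc) :
    (C.up w).1.1 ∈ halfLattice τ ↔ w.1 = 0 := by
  rw [up_fst]
  constructor
  · intro h
    have h1 : τ • C.offset w - τ • C.offset (-w.1, w.2) ∈ latticeSq τ := by
      have h2 := sub_mem (mem_halfLattice_iff.1 h) (mem_halfLattice_iff.1 C.centre.2)
      rw [offset_neg]
      convert h2 using 1
      rw [smul_neg]
      abel
    have h3 := congrArg (lead C.b) (C.sep _ _ (C.norm_offset_lt hw)
      (C.norm_offset_lt (C.neg_mem_disc hw)) h1)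
    rw [lead_offset, lead_offset] at h3
    exact self_eq_neg.1 h3
  · intro h
    rw [(C.offset_eq_zero).2 h, smul_zero, add_zero]
    exact C.centre.2

theorem mem_chartSource {w : ℂ × ℂ} (hw : w ∈ C.disc) :
    (τ * w.1, w.2) ∈ chartSource C.centre C.b := by
  intro p' hp'
  have h1 : (C.up w).1.1 = p' := hp'
  have h2 := (C.up_mem_halfLattice hw).1 (h1 ▸ p'.2)
  rw [up_fst, (C.offset_eq_zero).2 h2, smul_zero, add_zero] at h1
  exact Subtype.ext h1.symm

theorem par_mem_exceptionalLocus {w : ℂ × ℂ} (hw : w ∈ C.disc) :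
    C.par w ∈ exceptionalLocus τ ↔ w.1 = 0 := by
  rw [par, kummerMk_mem_exceptionalLocus_iff, C.up_mem_halfLattice hw]

theorem up_line (w : ℂ × ℂ) : projSlope C.b ((C.up w).1.2 C.centre) = w.2 :=
  congrArg Prod.snd (invChart_blowChart C.centre C.b (τ * w.1, w.2))

/-- The reflection in the centre. -/
theorem par_neg {w : ℂ × ℂ} (hw : w ∈ C.disc) : C.par (-w.1, w.2) = C.par w := by
  have hl : (C.centre : ℂ × ℂ) + C.centre ∈ latticeSq τ := C.centre.2
  refine (kummerMk_eq_iff.2 ⟨-1, _, hl, ?_⟩).symm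
  have hfn : ∀ z, (unitSym (-1) hl).fn z = -z + ((C.centre : ℂ × ℂ) + C.centre) := fun z => by
    rw [unitSym_fn]; simp
  refine BlownUpPlane.ext' ?_ fun p' hp' => ?_
  · rw [blowMap_fst, up_fst, up_fst, hfn, offset_neg, smul_neg]
    abel
  · have h1 : p' = C.centre := C.mem_chartSource (C.neg_mem_disc hw) p' hp'.symm
    subst h1
    rw [blowMap_unitSym_line, PlaneSym.pre_eq _ (by rw [hfn]; abel), up, up, blowChart_slope_self,
      blowChart_slope_self]

/-- The fibres of the parametrization are the orbits of the reflection. -/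
theorem eq_or_eq_neg_of_par_eq {w w' : ℂ × ℂ} (hw : w ∈ C.disc) (hw' : w' ∈ C.disc)
    (h : C.par w = C.par w') : w' = w ∨ w' = (-w.1, w.2) := by
  obtain ⟨ε, l, hl, h1⟩ := kummerMk_eq_iff.1 h
  have h2 := congrArg (fun y : BlownUpPlane τ => y.1.1) h1
  simp only [blowMap_fst, up_fst, unitSym_fn] at h2
  have key : ∀ w'' ∈ C.disc, C.offset w' = C.offset w'' →
      (ε : ℤ) • (C.centre : ℂ × ℂ) + l = C.centre → w''.2 = w.2 → w' = w'' := by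
    intro w'' _ ho hc h3
    have h4 := congrArg (lead C.b) ho
    rw [lead_offset, lead_offset] at h4
    refine Prod.ext h4 ?_
    rw [h3, ← C.up_line w', h1, blowMap_unitSym_line, (unitSym ε hl).pre_eq hc, up_line]
  rcases Int.units_eq_one_or ε with rfl | rfl
  · left
    simp only [Units.val_one, one_smul] at h2 key
    have h3 : τ • C.offset w' - τ • C.offset w = l := by
      rw [sub_eq_iff_eq_add]
      rw [add_assoc] at h2
      rw [add_left_cancel h2]
      abel
    have ho := C.sep _ _ (C.norm_offset_lt hw') (C.norm_offset_lt hw) (h3 ▸ hl)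
    refine key w hw ho ?_ rfl
    rw [← h3, ho, sub_self, add_zero]
  · right
    simp only [Units.val_neg, Units.val_one, neg_smul, one_smul] at h2 key
    have h3 : τ • C.offset w' - τ • C.offset (-w.1, w.2) =
        l - ((C.centre : ℂ × ℂ) + C.centre) := by
      rw [offset_neg, smul_neg, sub_neg_eq_add, eq_sub_iff_add_eq]
      calc τ • C.offset w' + τ • C.offset w + ((C.centre : ℂ × ℂ) + C.centre)
          = (C.centre + τ • C.offset w') + (C.centre + τ • C.offset w) := by abel
        _ = l := by rw [h2]; abel
    have ho := C.sep _ _ (C.norm_offset_lt hw') (C.norm_offset_lt (C.neg_mem_disc hw))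
      (h3 ▸ sub_mem hl C.centre.2)
    refine key _ (C.neg_mem_disc hw) ho ?_ rfl
    rw [ho, sub_self] at h3
    rw [sub_eq_zero.1 h3.symm]
    abel

theorem continuousOn_par : ContinuousOn C.par C.disc := by
  refine isOpenQuotientMap_kummerMk.continuous.comp_continuousOn
    ((continuousOn_blowChart C.centre C.b).comp (f := fun w : ℂ × ℂ => (τ * w.1, w.2)) ?_
      fun w hw => C.mem_chartSource hw)
  fun_prop

theorem isOpen_par_image {U : Set (ℂ × ℂ)} (hUD : U ⊆ C.disc) (hU : IsOpen U) :
    IsOpen (C.par '' U) := by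
  have h1 : C.par '' U =
      kummerMk '' (blowChart τ C.centre C.b '' ((fun w : ℂ × ℂ => (τ * w.1, w.2)) '' U)) := by
    rw [image_image, image_image]; rfl
  rw [h1]
  refine isOpenQuotientMap_kummerMk.isOpenMap _ (isOpen_blowChart_image C.im_ne ?_ ?_)
  · exact ((isOpenMap_smul₀ C.ne_zero : IsOpenMap fun z : ℂ => τ • z).prodMap IsOpenMap.id) U hU
  · rintro _ ⟨w, hw, rfl⟩
    exact C.mem_chartSource (hUD hw)

theorem holAt_par_iff {w : ℂ × ℂ} (hw : w ∈ C.disc) {f : KummerSurface τ → ℂ} :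
    HolomorphicGerms.HolAt f (C.par w) ↔ AnalyticAt ℂ (fun w => f (C.par w)) w := by
  rw [par, holAt_kummerMk_iff C.im_ne, up, holAt_blowChart_iff C.im_ne (C.mem_chartSource hw)]
  constructor
  · intro h
    exact AnalyticAt.fun_comp (f := fun w : ℂ × ℂ => (τ * w.1, w.2))
      (g := fun w => f (kummerMk (blowChart τ C.centre C.b w))) h
      ((analyticAt_const.mul analyticAt_fst).prod analyticAt_snd)
  · intro h
    have h1 := AnalyticAt.fun_comp_of_eq (f := fun w : ℂ × ℂ => (τ⁻¹ * w.1, w.2))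
      (g := fun w => f (C.par w)) h (x := (τ * w.1, w.2))
      ((analyticAt_const.mul analyticAt_fst).prod analyticAt_snd)
      (by simp [C.ne_zero])
    simpa [par, up, C.ne_zero] using h1

/-- A point of the parametrized neighbourhood off the exceptional curve belongs to the real surface
only if its parameters are real. -/
theorem eq_complexify_of_par_mem {w : ℂ × ℂ} (hw : w ∈ C.disc) (h0 : w.1 ≠ 0)
    (h : C.par w ∈ SigmaX τ) : ∃ p : ℝ × ℝ, p.1 ≠ 0 ∧ w = complexify p := by
  have hτ := C.im_ne
  obtain ⟨⟨m, hm⟩, n, hn⟩ :=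
    (resolution_kummerMk_mem_Sigma0_iff hτ).1 (SigmaX_subset hτ h)
  rw [up_fst] at hm hn
  obtain ⟨h1, h2⟩ := C.coord _ (C.norm_offset_lt hw)
  have hm' : coordX τ (τ * (C.offset w).1) = m := by
    rw [← hm, Prod.fst_add, coordX_add]
    change _ = coordX τ (τ * (C.base.1 : ℂ)) + coordX τ (τ * (C.offset w).1)
    rw [coordX_mul_ofReal hτ, zero_add]
  have hn' : coordX τ (τ * (C.offset w).2) = n := by
    rw [← hn, Prod.snd_add, coordX_add]
    change _ = coordX τ (τ * (C.base.2 : ℂ)) + coordX τ (τ * (C.offset w).2)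
    rw [coordX_mul_ofReal hτ, zero_add]
  rw [hm'] at h1
  rw [hn'] at h2
  have hm0 : m = 0 := Int.abs_lt_one_iff.1 (by exact_mod_cast h1)
  have hn0 : n = 0 := Int.abs_lt_one_iff.1 (by exact_mod_cast h2)
  rw [hm0, Int.cast_zero] at hm'
  rw [hn0, Int.cast_zero] at hn'
  have h3 := eq_ofReal_of_coordX_eq_zero hτ hm'
  have h4 := eq_ofReal_of_coordX_eq_zero hτ hn'
  obtain ⟨u, hu⟩ : ∃ u : ℝ, w.1 = u := by
    rw [← C.lead_offset w]
    cases C.b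
    · exact ⟨_, h4⟩
    · exact ⟨_, h3⟩
  obtain ⟨s, hs⟩ : ∃ s : ℝ, w.1 * w.2 = s := by
    rw [← C.trail_offset w]
    cases C.b
    · exact ⟨_, h3⟩
    · exact ⟨_, h4⟩
  refine ⟨(u, s / u), fun h => h0 (by rw [hu]; exact_mod_cast h), Prod.ext hu ?_⟩
  change w.2 = ((s / u : ℝ) : ℂ)
  rw [Complex.ofReal_div, ← hs, ← hu, mul_div_cancel_left₀ _ h0]

/-- The real point with real parameters `(u, v)`. -/
def realPoint (p : ℝ × ℝ) : ℝ × ℝ := C.base + p.1 • (if C.b then (1, p.2) else (p.2, 1))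

theorem up_complexify_fst (p : ℝ × ℝ) :
    (C.up (complexify p)).1.1 = τ • complexify (C.realPoint p) := by
  rw [up_fst, centre, ← smul_add, offset, realPoint]
  congr 1
  cases C.b <;> apply Prod.ext <;> simp [complexify, direction]

theorem realPoint_notMem {p : ℝ × ℝ} (hp : complexify p ∈ C.disc) (h0 : p.1 ≠ 0) :
    τ • complexify (C.realPoint p) ∉ halfLattice τ := by
  rw [← up_complexify_fst, C.up_mem_halfLattice hp]
  exact Complex.ofReal_ne_zero.2 h0

theorem par_complexify {p : ℝ × ℝ} (hp : complexify p ∈ C.disc) (h0 : p.1 ≠ 0) :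
    C.par (complexify p) = kummerLift τ (τ • complexify (C.realPoint p)) := by
  have h := C.realPoint_notMem hp h0
  rw [← up_complexify_fst] at h ⊢
  exact kummerMk_eq_kummerLift h

theorem par_complexify_mem {p : ℝ × ℝ} (hp : complexify p ∈ C.disc) (h0 : p.1 ≠ 0) :
    C.par (complexify p) ∈ SigmaX τ := by
  rw [C.par_complexify hp h0]
  exact (isRealImage_SigmaX C.im_ne).mem_complexify (C.realPoint_notMem hp h0)

end EdgeChart

end Edge

/-! ### Charts along the exceptional curves -/

section Fold

/-- The quotient map of the plane by the reflection `(u, v) ↦ (-u, v)`. -/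
def fold (w : ℂ × ℂ) : ℂ × ℂ := (w.1 ^ 2, w.2)

theorem isOpenQuotientMap_fold : IsOpenQuotientMap fold where
  surjective w := by
    obtain ⟨z, hz⟩ := IsAlgClosed.exists_pow_nat_eq w.1 two_pos
    exact ⟨(z, w.2), Prod.ext hz rfl⟩
  continuous := (continuous_fst.pow 2).prodMk continuous_snd
  isOpenMap := isOpenMap_sq.prodMap IsOpenMap.id

theorem analyticAt_fold (w : ℂ × ℂ) : AnalyticAt ℂ fold w :=
  (analyticAt_fst.pow 2).prod analyticAt_snd

theorem isClosed_complexify_halfPlane : IsClosed (complexify '' halfPlane) := by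
  have h : complexify '' halfPlane =
      {w : ℂ × ℂ | (w.1.im = 0 ∧ w.2.im = 0) ∧ 0 ≤ w.1.re} := by
    ext w
    constructor
    · rintro ⟨p, hp, rfl⟩
      exact ⟨⟨Complex.ofReal_im _, Complex.ofReal_im _⟩, hp⟩
    · rintro ⟨⟨h1, h2⟩, h3⟩
      exact ⟨(w.1.re, w.2.re), h3, Prod.ext (Complex.ext rfl h1.symm) (Complex.ext rfl h2.symm)⟩
  rw [h]
  refine IsClosed.inter (IsClosed.inter ?_ ?_) ?_
  · exact isClosed_eq (Complex.continuous_im.comp continuous_fst) continuous_const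
  · exact isClosed_eq (Complex.continuous_im.comp continuous_snd) continuous_const
  · exact isClosed_le continuous_const (Complex.continuous_re.comp continuous_fst)

end Fold

namespace EdgeChart

variable {τ : ℂ} (C : EdgeChart τ)

/-- The image of the polydisc under `fold`. -/
def squaredDisc : Set (ℂ × ℂ) := {a | ‖a.1‖ < (C.κ / (C.R + 1)) ^ 2 ∧ ‖a.2‖ < C.R}

/-- The parametrization of the Kummer surface by the quotient of the polydisc by the
reflection. The choice of the square root is immaterial by `par_neg`. -/
def quot (a : ℂ × ℂ) : KummerSurface τ := C.par (a.1 ^ (2⁻¹ : ℂ), a.2)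

theorem radius_pos : 0 < C.κ / (C.R + 1) := div_pos C.κ_pos (by linarith [C.R_pos])

theorem fold_mem_iff {w : ℂ × ℂ} : fold w ∈ C.squaredDisc ↔ w ∈ C.disc := by
  have h := C.radius_pos.le
  simp only [fold, squaredDisc, disc, mem_ofPred_eq, norm_pow]
  rw [pow_lt_pow_iff_left₀ (norm_nonneg _) h two_ne_zero]

theorem isOpen_squaredDisc : IsOpen C.squaredDisc :=
  (isOpen_lt continuous_fst.norm continuous_const).inter
    (isOpen_lt continuous_snd.norm continuous_const)

theorem quot_fold {w : ℂ × ℂ} (hw : w ∈ C.disc) : C.quot (fold w) = C.par w := by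
  have h : ((w.1 ^ 2) ^ (2⁻¹ : ℂ)) ^ 2 = w.1 ^ 2 := by
    simp
  rcases sq_eq_sq_iff_eq_or_eq_neg.1 h with h | h
  · rw [quot, fold, h]
  · rw [quot, fold, h]
    exact C.par_neg hw

/-- Every point of the squared polydisc is the image of a point of the polydisc. -/
theorem exists_fold_eq {a : ℂ × ℂ} (ha : a ∈ C.squaredDisc) : ∃ w ∈ C.disc, fold w = a := by
  obtain ⟨w, rfl⟩ := isOpenQuotientMap_fold.surjective a
  exact ⟨w, C.fold_mem_iff.1 ha, rfl⟩

theorem continuousOn_quot : ContinuousOn C.quot C.squaredDisc := by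
  rw [isOpenQuotientMap_fold.isQuotientMap.continuousOn_isOpen_iff C.isOpen_squaredDisc]
  exact (C.continuousOn_par.mono fun w hw => C.fold_mem_iff.1 hw).congr
    fun w hw => C.quot_fold (C.fold_mem_iff.1 hw)

theorem isOpen_quot_image {U : Set (ℂ × ℂ)} (hUV : U ⊆ C.squaredDisc) (hU : IsOpen U) :
    IsOpen (C.quot '' U) := by
  have h : C.quot '' U = C.par '' (fold ⁻¹' U) := by
    ext x
    constructor
    · rintro ⟨a, ha, rfl⟩
      obtain ⟨w, hw, rfl⟩ := C.exists_fold_eq (hUV ha)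
      exact ⟨w, ha, (C.quot_fold hw).symm⟩
    · rintro ⟨w, hw, rfl⟩
      exact ⟨fold w, hw, C.quot_fold (C.fold_mem_iff.1 (hUV hw))⟩
  rw [h]
  exact C.isOpen_par_image (fun w hw => C.fold_mem_iff.1 (hUV hw))
    (hU.preimage isOpenQuotientMap_fold.continuous)

theorem injOn_quot : InjOn C.quot C.squaredDisc := by
  intro a ha a' ha' h
  obtain ⟨w, hw, rfl⟩ := C.exists_fold_eq ha
  obtain ⟨w', hw', rfl⟩ := C.exists_fold_eq ha'
  rw [C.quot_fold hw, C.quot_fold hw'] at h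
  rcases C.eq_or_eq_neg_of_par_eq hw hw' h with rfl | rfl
  · rfl
  · simp [fold]

theorem holAt_quot_iff {a : ℂ × ℂ} (ha : a ∈ C.squaredDisc) (f : KummerSurface τ → ℂ) :
    HolomorphicGerms.HolAt f (C.quot a) ↔ AnalyticAt ℂ (fun a => f (C.quot a)) a := by
  obtain ⟨w, hw, rfl⟩ := C.exists_fold_eq ha
  rw [C.quot_fold hw, C.holAt_par_iff hw]
  have hev : (fun w => f (C.quot (fold w))) =ᶠ[𝓝 w] fun w => f (C.par w) := by
    filter_upwards [C.isOpen_disc.mem_nhds hw] with w' hw'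
    rw [C.quot_fold hw']
  rw [← analyticAt_congr hev]
  constructor
  · intro h
    exact analyticAt_of_comp_sq (h := fun a => f (C.quot a)) h
  · intro h
    exact AnalyticAt.fun_comp (g := fun a => f (C.quot a)) h (analyticAt_fold w)

theorem quot_mem_exceptionalLocus {a : ℂ × ℂ} (ha : a ∈ C.squaredDisc) :
    C.quot a ∈ exceptionalLocus τ ↔ a.1 = 0 := by
  obtain ⟨w, hw, rfl⟩ := C.exists_fold_eq ha
  rw [C.quot_fold hw, C.par_mem_exceptionalLocus hw]
  simp [fold]

/-- The square root of the first coordinate. -/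
def rootPoint (p : ℝ × ℝ) : ℝ × ℝ := (√p.1, p.2)

theorem fold_rootPoint {p : ℝ × ℝ} (hp : 0 ≤ p.1) :
    fold (complexify (rootPoint p)) = complexify p := by
  refine Prod.ext ?_ rfl
  change ((√p.1 : ℝ) : ℂ) ^ 2 = (p.1 : ℂ)
  rw [← Complex.ofReal_pow, Real.sq_sqrt hp]

theorem rootPoint_mem {p : ℝ × ℝ} (hp : 0 ≤ p.1) (hpV : complexify p ∈ C.squaredDisc) :
    complexify (rootPoint p) ∈ C.disc := by
  rwa [← C.fold_mem_iff, fold_rootPoint hp]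

theorem quot_complexify {p : ℝ × ℝ} (hp : 0 < p.1) (hpV : complexify p ∈ C.squaredDisc) :
    C.quot (complexify p) = kummerLift τ (τ • complexify (C.realPoint (rootPoint p))) := by
  have h := C.rootPoint_mem hp.le hpV
  rw [← fold_rootPoint hp.le, C.quot_fold h]
  exact C.par_complexify h (Real.sqrt_ne_zero'.2 hp)

theorem quot_complexify_mem {p : ℝ × ℝ} (hp : 0 ≤ p.1) (hpV : complexify p ∈ C.squaredDisc) :
    C.quot (complexify p) ∈ SigmaX τ := by
  have hO : IsOpen (complexify ⁻¹' C.squaredDisc) :=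
    C.isOpen_squaredDisc.preimage continuous_complexify
  have h1 : p ∈ closure (Ioi (0 : ℝ) ×ˢ (univ : Set ℝ)) := by
    rw [closure_prod_eq, closure_Ioi]
    exact ⟨hp, subset_closure trivial⟩
  have h2 : p ∈ closure (complexify ⁻¹' C.squaredDisc ∩ Ioi (0 : ℝ) ×ˢ (univ : Set ℝ)) :=
    hO.inter_closure ⟨hpV, h1⟩
  have hc : ContinuousWithinAt (fun p => C.quot (complexify p))
      (complexify ⁻¹' C.squaredDisc ∩ Ioi (0 : ℝ) ×ˢ (univ : Set ℝ)) p :=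
    ((C.continuousOn_quot.comp continuous_complexify.continuousOn fun _ h => h) p hpV).mono
      inter_subset_left
  have h3 := hc.mem_closure_image h2
  refine closure_minimal ?_ isClosed_closure h3
  rintro _ ⟨p', ⟨h4, h5, -⟩, rfl⟩
  have h6 := C.rootPoint_mem (le_of_lt h5) h4
  change C.quot (complexify p') ∈ SigmaX τ
  rw [← fold_rootPoint (le_of_lt h5), C.quot_fold h6]
  exact C.par_complexify_mem h6 (Real.sqrt_ne_zero'.2 h5)

/-- The square of the parameter transverse to the exceptional curve and the slope are holomorphic
coordinates in which the real surface is a half-plane. -/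
theorem exists_chart : ∃ φ : OpenPartialHomeomorph (KummerSurface τ) (ℂ × ℂ), IsHolChart φ ∧
    φ.target = C.squaredDisc ∧ φ.source = C.quot '' C.squaredDisc ∧
    (∀ a ∈ C.squaredDisc, φ.symm a = C.quot a) ∧ (∀ a ∈ C.squaredDisc, φ (C.quot a) = a) ∧
    IsAdapted φ (SigmaX τ) halfPlane := by
  obtain ⟨φ, hφ, ht, hs, hsymm, hinv⟩ := exists_holChart C.quot
    C.isOpen_squaredDisc C.continuousOn_quot (fun U h => C.isOpen_quot_image h)
    C.injOn_quot (fun a ha => C.holAt_quot_iff ha)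
  refine ⟨φ, hφ, ht, hs, hsymm, hinv, fun y hy => ⟨fun hyS => ?_, ?_⟩⟩
  · have hcl := (isRealImage_SigmaX C.im_ne).eq_closure
    have h1 : y ∈ closure
        (φ.source ∩ kummerLift τ '' (range (tauPoint τ) \ halfLattice τ)) := by
      rw [hcl] at hyS
      exact φ.open_source.inter_closure ⟨hy, hyS⟩
    have h2 := ((φ.continuousAt hy).continuousWithinAt (s := φ.source ∩
      kummerLift τ '' (range (tauPoint τ) \ halfLattice τ))).mem_closure_image h1
    have h3 : φ y ∈ complexify '' halfPlane := by
      refine closure_minimal ?_ isClosed_complexify_halfPlane h2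
      rintro _ ⟨g, ⟨hg, z, ⟨hz1, hz⟩, rfl⟩, rfl⟩
      have hgS : kummerLift τ z ∈ SigmaX τ := by
        rw [hcl]
        exact subset_closure ⟨z, ⟨hz1, hz⟩, rfl⟩
      have hge : kummerLift τ z ∉ exceptionalLocus τ := fun h =>
        hz (kummerMk_mem_exceptionalLocus_iff.1 h)
      rw [hs] at hg
      obtain ⟨a, ha, hag⟩ := hg
      obtain ⟨w, hw, rfl⟩ := C.exists_fold_eq ha
      rw [← hag, hinv _ ha]
      rw [← hag, C.quot_fold hw] at hgS hge
      rw [C.par_mem_exceptionalLocus hw] at hge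
      obtain ⟨p, -, rfl⟩ := C.eq_complexify_of_par_mem hw hge hgS
      exact ⟨(p.1 ^ 2, p.2), sq_nonneg p.1,
        Prod.ext (Complex.ofReal_pow p.1 2) rfl⟩
    obtain ⟨p, hp, h⟩ := h3
    exact ⟨p, hp, h.symm⟩
  · rintro ⟨p, hp, h⟩
    have hpt : complexify p ∈ C.squaredDisc := by
      rw [← ht, ← h]; exact φ.map_source hy
    rw [← φ.left_inv hy, h, hsymm _ hpt]
    exact C.quot_complexify_mem hp hpt

end EdgeChart

/-- Every point of the real surface on an exceptional curve lies in a chart of this kind. -/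
theorem exists_edgeChart {τ : ℂ} (hτ : τ.im ≠ 0) {x : KummerSurface τ} (hx : x ∈ SigmaX τ)
    (he : x ∈ exceptionalLocus τ) :
    ∃ C : EdgeChart τ, ∃ a ∈ C.squaredDisc, a.1 = 0 ∧ C.quot a = x := by
  obtain ⟨y, rfl⟩ := isOpenQuotientMap_kummerMk.surjective x
  obtain ⟨⟨m, hm⟩, n, hn⟩ := (resolution_kummerMk_mem_Sigma0_iff hτ).1 (SigmaX_subset hτ hx)
  have hy := kummerMk_mem_exceptionalLocus_iff.1 he
  have hl : ((-(m : ℂ), -(n : ℂ)) : ℂ × ℂ) ∈ latticeSq τ := mem_latticeSq_iff.2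
    ⟨mem_lattice_iff.2 ⟨-m, 0, by simp⟩, mem_lattice_iff.2 ⟨-n, 0, by simp⟩⟩
  let y' := blowMap (unitSym 1 hl) y
  have hxy : kummerMk y' = kummerMk y := blowMap_unitSym_mem 1 hl y
  rw [← hxy] at he ⊢
  have hy' := kummerMk_mem_exceptionalLocus_iff.1 he
  have hbase : τ • complexify (coordY τ y.1.1.1, coordY τ y.1.1.2) = y'.1.1 := by
    change _ = ((1 : ℤˣ) : ℤ) • y.1.1 + (-(m : ℂ), -(n : ℂ))
    rw [Units.val_one, one_smul]
    apply Prod.ext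
    · change τ * (coordY τ y.1.1.1 : ℂ) = y.1.1.1 + -(m : ℂ)
      conv_rhs => rw [coord_spec hτ y.1.1.1, hm]
      push_cast; ring
    · change τ * (coordY τ y.1.1.2 : ℂ) = y.1.1.2 + -(n : ℂ)
      conv_rhs => rw [coord_spec hτ y.1.1.2, hn]
      push_cast; ring
  obtain ⟨κ, hκ, hκ2, hsep, hcoord⟩ := exists_small_radius hτ
  have hbm : τ • complexify (coordY τ y.1.1.1, coordY τ y.1.1.2) ∈ halfLattice τ := by
    rw [hbase]; exact hy'
  obtain ⟨b, hb⟩ := exists_mem_chartTarget y' (p := ⟨_, hbm⟩) fun p' hp' =>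
    Subtype.ext (hp'.symm.trans hbase.symm)
  let v := projSlope b (y'.1.2 ⟨_, hbm⟩)
  have hv0 : 0 < ‖v‖ + 1 := by positivity
  let C : EdgeChart τ := ⟨hτ, _, hbm, b, ‖v‖ + 1, hv0, κ, hκ, hκ2, hsep, hcoord⟩
  have hw : ((0, v) : ℂ × ℂ) ∈ C.disc := by
    refine ⟨?_, ?_⟩
    · rw [norm_zero]; exact C.radius_pos
    · exact lt_add_one ‖v‖
  refine ⟨C, fold (0, v), C.fold_mem_iff.2 hw, by simp [fold], ?_⟩
  rw [C.quot_fold hw]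
  refine congrArg kummerMk ?_
  rw [← blowChart_invChart hb]
  change blowChart τ _ b (τ * 0, v) = _
  congr 1
  refine Prod.ext ?_ rfl
  change τ * 0 = lead b (y'.1.1 - τ • complexify _)
  rw [hbase, sub_self, mul_zero]
  cases b <;> rfl

theorem notMem_exceptionalLocus_iff {τ : ℂ} {x : KummerSurface τ} :
    x ∉ exceptionalLocus τ ↔ x ∈ kummerLift τ '' (halfLattice τ)ᶜ := by
  obtain ⟨y, rfl⟩ := isOpenQuotientMap_kummerMk.surjective x
  rw [kummerMk_mem_exceptionalLocus_iff]
  constructor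
  · intro h
    exact ⟨_, h, (kummerMk_eq_kummerLift h).symm⟩
  · rintro ⟨z, hz, h⟩ hy
    rw [← kummerMk_mem_exceptionalLocus_iff, ← h] at hy
    exact hz (kummerMk_mem_exceptionalLocus_iff.1 hy)

/-- The surface `Σ_X` is totally real, with boundary on the exceptional curves. -/
theorem isTotallyRealSurface_SigmaX {τ : ℂ} (hτ : τ.im ≠ 0) :
    IsTotallyRealSurface (SigmaX τ) (SigmaX τ ∩ exceptionalLocus τ) := by
  refine ⟨inter_subset_left, fun x hx => ?_⟩
  by_cases he : x ∈ exceptionalLocus τ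
  · obtain ⟨C, a, ha, ha0, rfl⟩ := exists_edgeChart hτ hx he
    obtain ⟨φ, hφ, ht, hs, hsymm, hinv, had⟩ := C.exists_chart
    refine ⟨φ, hφ, hs ▸ ⟨a, ha, rfl⟩, fun h => absurd ⟨hx, he⟩ h, fun _ => ⟨?_, had⟩⟩
    rw [hinv a ha, ha0]
  · obtain ⟨z, hz, rfl⟩ := notMem_exceptionalLocus_iff.1 he
    obtain ⟨p, hp, hpz⟩ := (isRealImage_SigmaX hτ).exists_param (uniformized_kummer hτ) hz hx
    obtain ⟨φ, hφ, hxs, had, -⟩ := (isRealImage_SigmaX hτ).exists_chart (uniformized_kummer hτ) hp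
    rw [hpz] at hxs
    exact ⟨φ, hφ, hxs, fun _ => had, fun h => absurd h.2 he⟩

/-! ### The invariant measure along the exceptional curves -/

section Area

/-- The map `(a, v) ↦ (√a, √a v)`. -/
def sqrtPolar (p : ℝ × ℝ) : ℝ × ℝ := (√p.1, √p.1 * p.2)

/-- The derivative of `sqrtPolar`. -/
def sqrtPolarDeriv (p : ℝ × ℝ) : ℝ × ℝ →L[ℝ] ℝ × ℝ :=
  LinearMap.toContinuousLinearMap (Matrix.toLin (Module.Basis.finTwoProd ℝ)
    (Module.Basis.finTwoProd ℝ) !![1 / (2 * √p.1), 0; 1 / (2 * √p.1) * p.2, √p.1])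

theorem hasFDerivAt_sqrtPolar {p : ℝ × ℝ} (hp : 0 < p.1) :
    HasFDerivAt sqrtPolar (sqrtPolarDeriv p) p := by
  have h1 : HasFDerivAt (fun p : ℝ × ℝ => √p.1) ((1 / (2 * √p.1)) • ContinuousLinearMap.fst ℝ ℝ ℝ)
      p := hasFDerivAt_fst.sqrt hp.ne'
  have h2 := h1.prodMk (h1.mul hasFDerivAt_snd)
  refine h2.congr_fderiv ?_
  rw [sqrtPolarDeriv, Matrix.toLin_finTwoProd_toContinuousLinearMap]
  ext <;> simp [mul_comm]

theorem det_sqrtPolarDeriv {p : ℝ × ℝ} (hp : 0 < p.1) : (sqrtPolarDeriv p).det = 1 / 2 := by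
  have h : √p.1 ≠ 0 := (Real.sqrt_pos.2 hp).ne'
  rw [sqrtPolarDeriv, LinearMap.det_toContinuousLinearMap, LinearMap.det_toLin,
    Matrix.det_fin_two_of]
  field_simp
  ring

theorem injOn_sqrtPolar : InjOn sqrtPolar {p | 0 < p.1} := by
  intro p hp p' hp' h
  have h1 : √p.1 = √p'.1 := congrArg Prod.fst h
  have h2 : √p.1 * p.2 = √p'.1 * p'.2 := congrArg Prod.snd h
  rw [← h1] at h2
  exact Prod.ext ((Real.sqrt_inj (le_of_lt hp) (le_of_lt hp')).1 h1)
    (mul_left_cancel₀ (Real.sqrt_pos.2 hp).ne' h2)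

theorem isOpen_sqrtPolar_image {U : Set (ℝ × ℝ)} (hU : IsOpen U) (hU0 : ∀ p ∈ U, 0 < p.1) :
    IsOpen (sqrtPolar '' U) := by
  have h : sqrtPolar '' U =
      {x : ℝ × ℝ | 0 < x.1} ∩ (fun x : ℝ × ℝ => (x.1 ^ 2, x.2 / x.1)) ⁻¹' U := by
    ext x
    constructor
    · rintro ⟨p, hp, rfl⟩
      have h0 := Real.sqrt_pos.2 (hU0 p hp)
      refine ⟨h0, ?_⟩
      simp only [mem_preimage, sqrtPolar, Real.sq_sqrt (hU0 p hp).le,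
        mul_div_cancel_left₀ _ h0.ne']
      exact hp
    · rintro ⟨h0, hx⟩
      have h0' : 0 < x.1 := h0
      refine ⟨_, hx, Prod.ext ?_ ?_⟩
      · exact Real.sqrt_sq h0'.le
      · simp only [sqrtPolar, Real.sqrt_sq h0'.le, mul_div_cancel₀ _ h0'.ne']
  rw [h]
  refine ContinuousOn.isOpen_inter_preimage ?_ (isOpen_lt continuous_const continuous_fst) hU
  exact (continuous_fst.pow 2).continuousOn.prodMk
    (continuous_snd.continuousOn.div continuous_fst.continuousOn fun x hx => ne_of_gt hx)

/-- The map `sqrtPolar` halves areas. -/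
theorem volume_image_sqrtPolar {A : Set (ℝ × ℝ)} (hA : MeasurableSet A) (hA0 : ∀ p ∈ A, 0 < p.1) :
    2 * volume (sqrtPolar '' A) = volume A := by
  rw [← lintegral_abs_det_fderiv_eq_addHaar_image volume hA
    (fun p hp => (hasFDerivAt_sqrtPolar (hA0 p hp)).hasFDerivWithinAt)
    (injOn_sqrtPolar.mono hA0),
    setLIntegral_congr_fun hA (g := fun _ => ENNReal.ofReal (1 / 2))
      (fun p hp => by simp only; rw [det_sqrtPolarDeriv (hA0 p hp), abs_of_pos (by norm_num)]),
    setLIntegral_const, ← mul_assoc]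
  have h : (2 : ENNReal) * ENNReal.ofReal (1 / 2) = 1 := by
    rw [← ENNReal.ofReal_ofNat 2, ← ENNReal.ofReal_mul (by norm_num)]
    norm_num
  rw [h, one_mul]

end Area

namespace EdgeChart

variable {τ : ℂ} (C : EdgeChart τ)

theorem realPoint_rootPoint (p : ℝ × ℝ) : C.realPoint (rootPoint p) =
    C.base + (if C.b then sqrtPolar p else (sqrtPolar p).swap) := by
  rw [realPoint]
  congr 1
  cases C.b <;> simp [rootPoint, sqrtPolar]

theorem volume_image_realPoint {A : Set (ℝ × ℝ)} (hA : MeasurableSet A)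
    (hA0 : ∀ p ∈ A, 0 < p.1) :
    2 * volume ((fun p => C.realPoint (rootPoint p)) '' A) = volume A := by
  rw [← volume_image_sqrtPolar hA hA0]
  congr 1
  simp only [realPoint_rootPoint]
  cases C.b
  · simp only [Bool.false_eq_true, if_false]
    rw [show (fun p => C.base + (sqrtPolar p).swap) '' A =
      (fun x => C.base + x) '' (Prod.swap '' (sqrtPolar '' A)) by rw [image_image, image_image],
      image_add_left, measure_preimage_add, image_swap_eq_preimage_swap]
    exact (Measure.measurePreserving_swap (μ := (volume : Measure ℝ))
      (ν := (volume : Measure ℝ))).measure_preimage_equiv (f := MeasurableEquiv.prodComm) _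
  · simp only [if_true]
    rw [show (fun p => C.base + sqrtPolar p) '' A =
      (fun x => C.base + x) '' (sqrtPolar '' A) by rw [image_image],
      image_add_left, measure_preimage_add]

/-- The parameters of the points of the surface near the exceptional curve. -/
def params : Set (ℝ × ℝ) := {p | 0 < p.1 ∧ complexify p ∈ C.squaredDisc}

theorem isOpen_params : IsOpen C.params :=
  (isOpen_lt continuous_const continuous_fst).inter
    (C.isOpen_squaredDisc.preimage continuous_complexify)

theorem isOpen_realPoint_image : IsOpen ((fun p => C.realPoint (rootPoint p)) '' C.params) := by
  have h := isOpen_sqrtPolar_image C.isOpen_params fun p hp => hp.1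
  simp only [realPoint_rootPoint]
  cases C.b
  · simp only [Bool.false_eq_true, if_false]
    rw [show (fun p => C.base + (sqrtPolar p).swap) '' C.params =
      (fun x => C.base + x) '' (Prod.swap '' (sqrtPolar '' C.params)) by
        rw [image_image, image_image]]
    exact (Homeomorph.addLeft C.base).isOpenMap _
      ((Homeomorph.prodComm ℝ ℝ).isOpenMap _ h)
  · simp only [if_true]
    rw [show (fun p => C.base + sqrtPolar p) '' C.params =
      (fun x => C.base + x) '' (sqrtPolar '' C.params) by rw [image_image]]
    exact (Homeomorph.addLeft C.base).isOpenMap _ h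

theorem abs_realPoint_sub_lt {p : ℝ × ℝ} (hp : complexify p ∈ C.disc) :
    |(C.realPoint p).1 - C.base.1| < 1 / 2 ∧ |(C.realPoint p).2 - C.base.2| < 1 / 2 := by
  have h1 : C.offset (complexify p) = complexify (C.realPoint p - C.base) := by
    rw [realPoint, offset, add_sub_cancel_left]
    cases C.b <;> apply Prod.ext <;> simp [complexify, direction]
  have h2 := (C.norm_offset_lt hp).trans_le C.κ_le
  rw [h1, Prod.norm_def, max_lt_iff] at h2
  simp only [complexify, Complex.norm_real, Real.norm_eq_abs] at h2
  exact h2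

variable [MeasurableSpace (KummerSurface τ)] [BorelSpace (KummerSurface τ)]

theorem hasSmoothDensityAt {a : ℂ × ℂ} (ha : a ∈ C.squaredDisc) :
    HasSmoothDensityAt (surfaceMeasure τ (kummerLift τ)) (SigmaX τ) (C.quot a) := by
  have hτ := C.im_ne
  have hq := uniformized_kummer hτ
  have hS := isRealImage_SigmaX hτ
  obtain ⟨φ, hφ, ht, hs, hsymm, hinv, had⟩ := C.exists_chart
  refine ⟨φ, hφ, hs ▸ ⟨a, ha, rfl⟩, halfPlane, Or.inr rfl, had, fun _ => 1, contDiffOn_const,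
    fun _ _ => one_pos, fun B hB hBφ => ?_⟩
  let T : ℝ × ℝ → ℝ × ℝ := fun p => C.realPoint (rootPoint p)
  have hqT : ∀ p ∈ C.params, kummerLift τ (τ • complexify (T p)) = C.quot (complexify p) :=
    fun p hp => (C.quot_complexify hp.1 hp.2).symm
  have hdisc : ∀ p ∈ C.params, complexify (rootPoint p) ∈ C.disc :=
    fun p hp => C.rootPoint_mem hp.1.le hp.2
  have hTN : ∀ p ∈ C.params, τ • complexify (T p) ∉ halfLattice τ := fun p hp =>
    C.realPoint_notMem (hdisc p hp) (Real.sqrt_ne_zero'.2 hp.1)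
  -- the part of the surface in `B`, in the parameters of the chart
  let A : Set (ℝ × ℝ) := {p | p ∈ C.params ∧ C.quot (complexify p) ∈ B}
  have hA : MeasurableSet A := by
    have hc : ContinuousOn (fun p => C.quot (complexify p)) C.params :=
      C.continuousOn_quot.comp continuous_complexify.continuousOn fun p hp => hp.2
    have h1 := (continuousOn_iff_continuous_domRestrict.1 hc).measurable hB
    have h2 := C.isOpen_params.measurableSet.subtype_image h1
    convert h2 using 1
    ext p
    simp [A, and_comm]
  rw [surfaceMeasure_eq_volume_prod hq (V := T '' C.params) C.isOpen_realPoint_image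
    (a := (C.base.1 - 1 / 2, C.base.2 - 1 / 2)) ?_ ?_ ?_ hB ?_]
  · have h1 : {p | p ∈ T '' C.params ∧ kummerLift τ (τ • complexify p) ∈ B} = T '' A := by
      ext p'
      constructor
      · rintro ⟨⟨p, hp, rfl⟩, h⟩
        exact ⟨p, ⟨hp, hqT p hp ▸ h⟩, rfl⟩
      · rintro ⟨p, ⟨hp, h⟩, rfl⟩
        exact ⟨⟨p, hp, rfl⟩, (hqT p hp).symm ▸ h⟩
    have h2 : ((univ : Set ℤˣ).ncard : ENNReal) = 2 := by
      rw [ncard_univ, Nat.card_eq_fintype_card]; rfl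
    rw [h1, h2, C.volume_image_realPoint hA fun p hp => hp.1.1]
    simp only [ENNReal.ofReal_one, setLIntegral_one]
    -- the edge of the half-plane has measure zero
    have h3 : volume {p : ℝ × ℝ | p.1 = 0} = 0 := by
      have h4 : {p : ℝ × ℝ | p.1 = 0} = {(0 : ℝ)} ×ˢ univ := by ext p; simp
      rw [h4, Measure.volume_eq_prod, Measure.prod_prod, Real.volume_singleton, zero_mul]
    refine measure_congr (Filter.EventuallyLE.antisymm ?_ ?_)
    · refine Eventually.of_forall fun p hp => ?_
      have hp' : p ∈ A := hp
      exact ⟨hp'.1.1.le, ht.symm ▸ hp'.1.2, (hsymm _ hp'.1.2).symm ▸ hp'.2⟩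
    · have h5 : ∀ᵐ p : ℝ × ℝ, p.1 ≠ 0 := measure_eq_zero_iff_ae_notMem.1 h3
      filter_upwards [h5] with p hp0 hp
      obtain ⟨h6, h7, h8⟩ : p ∈ halfPlane ∧ complexify p ∈ φ.target ∧ φ.symm (complexify p) ∈ B :=
        hp
      rw [ht] at h7
      rw [hsymm _ h7] at h8
      exact ⟨⟨lt_of_le_of_ne h6 (Ne.symm hp0), h7⟩, h8⟩
  · rintro _ ⟨p, hp, rfl⟩
    have h := C.abs_realPoint_sub_lt (hdisc p hp)
    rw [abs_lt, abs_lt] at h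
    simp only [mem_Ioc, T]
    refine ⟨⟨?_, ?_⟩, ?_, ?_⟩ <;> linarith [h.1.1, h.1.2, h.2.1, h.2.2]
  · rintro _ ⟨p, hp, rfl⟩
    exact hTN p hp
  · rintro _ ⟨p, hp, rfl⟩ _ ⟨p', hp', rfl⟩ h
    simp only at h
    rw [hqT p hp, hqT p' hp'] at h
    rw [complexify_injective (C.injOn_quot hp.2 hp'.2 h)]
  · intro p' hp' hpB
    have hsrc := hBφ hpB
    obtain ⟨p, hp, h⟩ := (had _ hsrc).1 (hS.mem_complexify hp')
    have hpt : complexify p ∈ C.squaredDisc := by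
      rw [← ht, ← h]; exact φ.map_source hsrc
    have h1 : kummerLift τ (τ • complexify p') = C.quot (complexify p) := by
      rw [← hsymm _ hpt, ← h, φ.left_inv hsrc]
    have h2 : complexify p ∈ C.squaredDisc ∧ p.1 ≠ 0 := by
      refine ⟨hpt, fun h0 => ?_⟩
      have h3 : C.quot (complexify p) ∈ exceptionalLocus τ :=
        (C.quot_mem_exceptionalLocus hpt).2 (by simp [complexify, h0])
      rw [← h1] at h3
      exact hp' (kummerMk_mem_exceptionalLocus_iff.1 h3)
    have h3 : p ∈ C.params := ⟨lt_of_le_of_ne hp (Ne.symm h2.2), hpt⟩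
    exact ⟨_, ⟨p, h3, rfl⟩, (hqT p h3).trans h1.symm⟩

end EdgeChart

theorem actsErgodicallyOn_SigmaX {τ : ℂ} (hτ : τ.im ≠ 0) :
    ActsErgodicallyOn (kummerAct hτ).range (SigmaX τ) := by
  refine (isRealImage_SigmaX hτ).actsErgodicallyOn (uniformized_kummer hτ)
    (fun g z hz => kummerAct_kummerLift hτ g hz) (isHolMap_kummerAct hτ)
    (nonElementary_kummerAct hτ) fun x hx hxe => ?_
  rw [← notMem_exceptionalLocus_iff, not_not] at hxe
  obtain ⟨C, a, ha, -, rfl⟩ := exists_edgeChart hτ hx hxe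
  exact C.hasSmoothDensityAt ha

/-! ### Isomorphic curves -/

section Curves

variable {τ τ' : ℂ}

/-- Multiplication by a number that carries one lattice onto another. -/
def curveEquiv {c : ℂ} (hc : c ≠ 0) (h : ∀ z, c * z ∈ lattice τ' ↔ z ∈ lattice τ) :
    Curve τ ≃+ Curve τ' :=
  QuotientAddGroup.congr (lattice τ) (lattice τ') (DistribMulAction.toAddEquiv₀ ℂ c hc) (by
    ext w
    constructor
    · rintro ⟨z, hz, rfl⟩
      exact (h z).2 hz
    · intro hw
      refine ⟨c⁻¹ * w, (h _).1 ?_, mul_inv_cancel_left₀ hc w⟩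
      rwa [mul_inv_cancel_left₀ hc])

theorem isHolMap_of_lift {e : Curve τ → Curve τ'} (c : ℂ)
    (he : ∀ z : ℂ, e (z : Curve τ) = ((c * z : ℂ) : Curve τ')) : IsHolMap e := by
  constructor
  · refine
      (QuotientAddGroup.isOpenQuotientMap_mk (N := lattice τ)).isQuotientMap.continuous_iff.2 ?_
    have h : e ∘ (fun z : ℂ => (z : Curve τ)) = fun z : ℂ => ((c * z : ℂ) : Curve τ') := funext he
    change Continuous (e ∘ fun z : ℂ => (z : Curve τ))
    rw [h]
    exact QuotientAddGroup.isOpenQuotientMap_mk.continuous.comp (continuous_const.mul continuous_id)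
  · rintro _ f hf z rfl
    have h1 := hf (c * z) (he z).symm
    simp only [he]
    exact AnalyticAt.fun_comp (f := fun z : ℂ => c * z) (g := fun w : ℂ => f (w : Curve τ')) h1
      (analyticAt_const.mul analyticAt_id)

theorem curvesIsomorphic_of_mul {c : ℂ} (hc : c ≠ 0)
    (h : ∀ z, c * z ∈ lattice τ' ↔ z ∈ lattice τ) : CurvesIsomorphic τ τ' :=
  ⟨curveEquiv hc h, isHolMap_of_lift c fun _ => rfl, isHolMap_of_lift c⁻¹ fun _ => rfl⟩

/-- If `1 / τ = a - τ'`, then division by `τ` carries the lattice of `τ` onto that of `τ'`. -/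
theorem curvesIsomorphic_of_mul_eq_one {a : ℤ} (h : (a - τ') * τ = 1) : CurvesIsomorphic τ τ' := by
  have hc : (a : ℂ) - τ' ≠ 0 := left_ne_zero_of_mul_eq_one h
  refine curvesIsomorphic_of_mul hc fun z => ?_
  rw [mem_lattice_iff, mem_lattice_iff]
  constructor
  · rintro ⟨m, n, hz⟩
    refine ⟨-n, m + n * a, mul_left_cancel₀ hc ?_⟩
    push_cast
    linear_combination hz - (m + n * a) * h
  · rintro ⟨m, n, rfl⟩
    refine ⟨m * a + n, -m, ?_⟩
    push_cast
    linear_combination n * h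

end Curves

/-! ### The special values of the parameter -/

section Parameter

variable {t : ℝ}

theorem tau_im (t : ℝ) : (tau t).im = t := by simp [tau]

theorem conj_tau (t : ℝ) : (starRingEnd ℂ) (tau t) = 1 - tau t := by
  apply Complex.ext <;> simp [tau]; norm_num

theorem tau_mul_conj (t : ℝ) : tau t * (1 - tau t) = ((1 / 4 + t ^ 2 : ℝ) : ℂ) := by
  push_cast
  linear_combination (norm := (simp only [tau]; ring_nf)) -(t : ℂ) ^ 2 * Complex.I_sq

theorem tau_div_conj (ht : 0 < t) : tau t / (starRingEnd ℂ) (tau t) =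
    ((-1 : ℝ) : ℂ) + ((1 / (1 / 4 + t ^ 2) : ℝ) : ℂ) * tau t := by
  have h := tau_mul_conj t
  have hN : (((1 / 4 + t ^ 2 : ℝ)) : ℂ) ≠ 0 := Complex.ofReal_ne_zero.2 (by positivity)
  have h1 : 1 - tau t ≠ 0 := by
    intro h0
    rw [h0, mul_zero] at h
    exact hN h.symm
  rw [conj_tau, div_eq_iff h1, Complex.ofReal_div, Complex.ofReal_one, Complex.ofReal_neg,
    Complex.ofReal_one, add_mul, mul_assoc, h, div_mul_cancel₀ _ hN]
  ring

/-- The parameters for which the square of the modulus of `τ` is the inverse of an integer. -/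
theorem special_iff (ht : 0 < t) : (t = √3 / 2 ∨ t = 1 / 2 ∨ t = √3 / 6) ↔
    ∃ n : ℤ, 1 / (1 / 4 + t ^ 2) = (n : ℝ) := by
  have h3 : (√3 : ℝ) ^ 2 = 3 := Real.sq_sqrt (by norm_num)
  have h30 : (0 : ℝ) < √3 := by positivity
  have hpos : 0 < 1 / 4 + t ^ 2 := by positivity
  constructor
  · rintro (h | h | h)
    · exact ⟨1, by rw [h, div_pow, h3]; norm_num⟩
    · exact ⟨2, by rw [h]; norm_num⟩
    · exact ⟨3, by rw [h, div_pow, h3]; norm_num⟩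
  · rintro ⟨n, hn⟩
    rw [div_eq_iff hpos.ne'] at hn
    have hn0 : 0 < n := by
      by_contra! h
      have h1 : (n : ℝ) ≤ 0 := by exact_mod_cast h
      nlinarith
    have hn4 : n < 4 := by
      by_contra! h
      have h1 : (4 : ℝ) ≤ n := by exact_mod_cast h
      nlinarith [sq_pos_of_pos ht]
    have key : ∀ s : ℝ, 0 < s → t ^ 2 = s ^ 2 → t = s := fun s hs h =>
      (pow_left_inj₀ ht.le hs.le two_ne_zero).1 h
    interval_cases n
    · left
      refine key _ (by positivity) ?_
      rw [div_pow, h3]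
      push_cast at hn
      linarith
    · right; left
      refine key _ (by norm_num) ?_
      push_cast at hn
      linarith
    · right; right
      refine key _ (by positivity) ?_
      rw [div_pow, h3]
      push_cast at hn
      linarith

theorem special_of_mem_lattice (ht : 0 < t)
    (h : tau t / (starRingEnd ℂ) (tau t) ∈ lattice (tau t)) :
    t = √3 / 2 ∨ t = 1 / 2 ∨ t = √3 / 6 := by
  have hτ : (tau t).im ≠ 0 := by rw [tau_im]; exact ht.ne'
  obtain ⟨n, hn⟩ := ((mem_lattice_iff_coord hτ).1 h).2
  rw [tau_div_conj ht, coordY_basis hτ] at hn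
  exact (special_iff ht).2 ⟨n, hn⟩

theorem isConjMultiplier_of_special (ht : 0 < t) (h : t = √3 / 2 ∨ t = 1 / 2 ∨ t = √3 / 6) :
    IsConjMultiplier (tau t) (tau t / (starRingEnd ℂ) (tau t)) := by
  have hτ0 : tau t ≠ 0 := fun h0 => by
    have := tau_im t
    rw [h0] at this
    exact ht.ne this
  have hτ1 : (starRingEnd ℂ) (tau t) ≠ 0 := by simpa using hτ0
  constructor
  · rw [map_div₀, Complex.conj_conj]
    field_simp
  · intro l hl
    obtain ⟨k, hk⟩ := (special_iff ht).1 h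
    obtain ⟨m, n, rfl⟩ := mem_lattice_iff.1 hl
    have h1 := tau_div_conj ht
    rw [hk] at h1
    have h2 : tau t / (starRingEnd ℂ) (tau t) * (starRingEnd ℂ) (tau t) = tau t :=
      div_mul_cancel₀ _ hτ1
    refine mem_lattice_iff.2 ⟨-m, m * k + n, ?_⟩
    rw [map_add, map_mul, map_intCast, map_intCast]
    push_cast at h1 ⊢
    linear_combination (m : ℂ) * h1 + (n : ℂ) * h2

theorem curvesIsomorphic_I (h : t = 1 / 2) : CurvesIsomorphic (tau t) Complex.I := by
  refine curvesIsomorphic_of_mul_eq_one (a := 1) ?_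
  rw [tau, h]
  push_cast
  linear_combination (-1 / 2 : ℂ) * Complex.I_sq

theorem curvesIsomorphic_sqrt_three (h : t = √3 / 2 ∨ t = √3 / 6) :
    CurvesIsomorphic (tau t) ((1 + Complex.I * (√3 : ℝ)) / 2) := by
  have h3 : ((√3 : ℝ) : ℂ) ^ 2 = 3 := by
    rw [← Complex.ofReal_pow, Real.sq_sqrt (by norm_num)]; norm_num
  rcases h with h | h
  · have h1 : tau t = (1 + Complex.I * (√3 : ℝ)) / 2 := by
      rw [tau, h]; push_cast; ring
    rw [h1]
    exact curvesIsomorphic_of_mul one_ne_zero fun z => by rw [one_mul]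
  · refine curvesIsomorphic_of_mul_eq_one (a := 2) ?_
    rw [tau, h]
    push_cast
    linear_combination (-((√3 : ℝ) : ℂ) ^ 2 / 12) * Complex.I_sq + (1 / 12 : ℂ) * h3

end Parameter

end RealStructures
end

open RealStructures in
theorem mainTheorem11 (t : ℝ) (ht : 0 < t) :
    -- the equivalence of (a), (b) and (c)
    List.TFAE
      [ ∃ s : AbelianSurface (tau t) → AbelianSurface (tau t),
          IsRealStructure s ∧ SigmaA (tau t) ⊆ realPart s,
        ∃ s : KummerSurface (tau t) → KummerSurface (tau t),
          IsRealStructure s ∧ SigmaX (tau t) ⊆ realPart s,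
        t = √3 / 2 ∨ t = 1 / 2 ∨ t = √3 / 6 ] ∧
    -- the curve in the special cases
    (t = 1 / 2 → CurvesIsomorphic (tau t) Complex.I) ∧
    (t = √3 / 2 ∨ t = √3 / 6 →
      CurvesIsomorphic (tau t) ((1 + Complex.I * (√3 : ℝ)) / 2)) ∧
    -- invariant totally real surfaces that lie in no real part
    (¬ (t = √3 / 2 ∨ t = 1 / 2 ∨ t = √3 / 6) →
      (IsTotallyRealSurface (SigmaA (tau t)) ∅ ∧
        (∃ G : Subgroup (AbelianSurface (tau t) ≃ₜ AbelianSurface (tau t)),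
          ActsErgodicallyOn G (SigmaA (tau t))) ∧
        ¬ ∃ s : AbelianSurface (tau t) → AbelianSurface (tau t),
          IsRealStructure s ∧ SigmaA (tau t) ⊆ realPart s) ∧
      (IsTotallyRealSurface (SigmaX (tau t)) (SigmaX (tau t) ∩ exceptionalLocus (tau t)) ∧
        (∃ G : Subgroup (KummerSurface (tau t) ≃ₜ KummerSurface (tau t)),
          ActsErgodicallyOn G (SigmaX (tau t))) ∧
        ¬ ∃ s : KummerSurface (tau t) → KummerSurface (tau t),
          IsRealStructure s ∧ SigmaX (tau t) ⊆ realPart s)) := by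
  have hτ : (tau t).im ≠ 0 := by rw [tau_im]; exact ht.ne'
  have hA : (∃ s : AbelianSurface (tau t) → AbelianSurface (tau t),
      IsRealStructure s ∧ SigmaA (tau t) ⊆ realPart s) → t = √3 / 2 ∨ t = 1 / 2 ∨ t = √3 / 6 :=
    fun ⟨_, hs, hfix⟩ => special_of_mem_lattice ht (div_conj_mem_lattice_of_abelian hτ hs hfix)
  have hX : (∃ s : KummerSurface (tau t) → KummerSurface (tau t),
      IsRealStructure s ∧ SigmaX (tau t) ⊆ realPart s) → t = √3 / 2 ∨ t = 1 / 2 ∨ t = √3 / 6 :=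
    fun ⟨_, hs, hfix⟩ => special_of_mem_lattice ht (div_conj_mem_lattice_of_kummer hτ hs hfix)
  refine ⟨?_, curvesIsomorphic_I, curvesIsomorphic_sqrt_three, fun h => ⟨?_, ?_⟩⟩
  · tfae_have 1 → 3 := hA
    tfae_have 2 → 3 := hX
    tfae_have 3 → 1 := fun h => exists_realStructure_abelian hτ (isConjMultiplier_of_special ht h)
    tfae_have 3 → 2 := fun h => exists_realStructure_kummer hτ (isConjMultiplier_of_special ht h)
    tfae_finish
  · exact ⟨isTotallyRealSurface_SigmaA hτ, ⟨_, actsErgodicallyOn_SigmaA hτ⟩, fun hs => h (hA hs)⟩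
  · exact ⟨isTotallyRealSurface_SigmaX hτ, ⟨_, actsErgodicallyOn_SigmaX hτ⟩, fun hs => h (hX hs)⟩
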